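/- **Setting.** For $u\in H^1(\mathbb R^2;\mathbb C)$ and $a,b\in\mathbb R$ put $$F_{a,b}(u)=a\int_{\mathbb R^2}|u|^4+b\int_{\mathbb R^2}\big(U^{2D}\star|u|^2\big)|u|^2,\qquad U^{2D}(x)=\frac{1-2\cos^2\theta_x}{2\pi|x|^2},\quad \cos\theta_x=\frac{x_1}{|x|},$$ where the singular convolution is a principal value, i.e. $U^{2D}\star\rho$ is the $L^2$ limit of $x\mapsto\int_{|y|>\varepsilon}U^{2D}(y)\rho(x-y)\,dy$ as $\varepsilon\to0^+$. Let $C(a,b)$ be the infimum of the constants $C$ such that $F_{a,b}(u)\le C\int|\nabla u|^2\int|u|^2$ for all $u\in H^1(\mathbb R^2;\mathbb C)$. Let $\beta,\lambda\in\mathbb R$, $n_3\in[-1,1]$, and let $V:\mathbb R^2\to\mathbb R$ be smooth with $V(x)\to\infty$ as $|x|\to\infty$. The 2D dipolar energy is $$\mathcal E_{2D}[u]=\int_{\mathbb R^2}\frac12|\nabla u|^2+V|u|^2+\frac{\beta-\lambda+3n_3^2\lambda}{2}|u|^4-\frac{3\lambda}{4}|u|^2\,\Phi,\qquad \Phi=\big((1-2n_3^2)\partial_{x_1}^2-n_3^2\partial_{x_2}^2\big)\big(K\star|u|^2\big),$$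 $$K(x)=\frac{1}{2\sqrt2\,\pi^{3/2}}\int_{\mathbb R}\frac{e^{-s^2/2}}{\sqrt{|x|^2+s^2/(2\pi)}}\,ds,$$ with the derivatives in $\Phi$ in the sense of distributions, and $E_{2D}\in[-\infty,\infty)$ is the infimum of $\mathcal E_{2D}[u]$ over all $u\in H^1(\mathbb R^2;\mathbb C)$ with $\int|u|^2=1$ and $V|u|^2$ integrable. **Theorem (stability/instability of the 2D dipolar gas).** For every $u\in H^1(\mathbb R^2;\mathbb C)$, $|u|^2$ and the functions $U^{2D}\star|u|^2$ and $\Phi$ above exist in $L^2(\mathbb R^2)$, so all the terms above are well defined. Moreover: (1) If $a+\frac b2>0$ or $a-\frac b2>0$, then $0<C(a,b)<\infty$, the inequality $$F_{a,b}(u)\le C(a,b)\int|\nabla u|^2\int|u|^2$$ holds for all $u\in H^1(\mathbb R^2;\mathbb C)$, $C(a,b)$ is the least constant with this property, and there is a nonzero $u_{a,b}\in H^1(\mathbb R^2;\mathbb C)$ for which equality holds. (2) Set $a=\lambda-\beta+\frac{3\lambda}{2}(n_3^2-1)$ and $b=3\lambda(n_3^2-1)$. If both $a+\frac b2\le0$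 and $a-\frac b2\le0$, or if ($a+\frac b2>0$ or $a-\frac b2>0$) and $C(a,b)<1$, then $E_{2D}>-\infty$ and the infimum $E_{2D}$ is attained. (3) With the same $a,b$: if ($a+\frac b2>0$ or $a-\frac b2>0$) and $C(a,b)>1$, then $E_{2D}=-\infty$. -/

import Mathlib

open MeasureTheory Filter Topology
open scoped ContDiff ENNReal

noncomputable section

namespace Dipolar

/-- The Euclidean plane, with Lebesgue measure as its volume. -/
abbrev Plane : Type := EuclideanSpace ℝ (Fin 2)

/-- The classical partial derivative `∂ᵢ f` (it is only applied to smooth functions). -/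
def pderiv (i : Fin 2) (f : Plane → ℝ) (x : Plane) : ℝ :=
  fderiv ℝ f x (EuclideanSpace.single i 1)

/-- Real test functions: smooth with compact support. -/
def IsTest (φ : Plane → ℝ) : Prop :=
  ContDiff ℝ ∞ φ ∧ HasCompactSupport φ

/-- `g` is the `i`-th weak partial derivative of `u`. -/
def IsWeakPartial (i : Fin 2) (u g : Plane → ℂ) : Prop :=
  ∀ φ : Plane → ℝ, IsTest φ → ∫ x, pderiv i φ x • u x = -∫ x, φ x • g x

/-- A function in the Sobolev space `H¹(ℝ²; ℂ)`, together with its weak gradient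
(which is determined by the function up to null sets). -/
structure H1 where
  /-- the function `u` -/
  toFun : Plane → ℂ
  /-- its weak partial derivatives `∂₁ u`, `∂₂ u` -/
  grad : Fin 2 → Plane → ℂ
  memLp : MemLp toFun 2 volume
  memLp_grad : ∀ i, MemLp (grad i) 2 volume
  isWeakPartial : ∀ i, IsWeakPartial i toFun (grad i)

/-- The density `ρ = |u|²`. -/
def H1.density (u : H1) (x : Plane) : ℝ := ‖u.toFun x‖ ^ 2

/-- The mass `∫ |u|²`. -/
def H1.mass (u : H1) : ℝ := ∫ x, ‖u.toFun x‖ ^ 2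

/-- `∫ |∇u|²`. -/
def H1.dirichlet (u : H1) : ℝ := ∫ x, ∑ i, ‖u.grad i x‖ ^ 2

/-- `∫ |u|⁴`. -/
def H1.quartic (u : H1) : ℝ := ∫ x, ‖u.toFun x‖ ^ 4

/-! ### The singular dipolar interaction -/

/-- The kernel `U(x) = (1 - 2 cos² θ) / (2π |x|²)`, where `cos θ = x₁ / |x|`. -/
def U2D (x : Plane) : ℝ :=
  (1 - 2 * (x 0 / ‖x‖) ^ 2) / (2 * Real.pi * ‖x‖ ^ 2)

/-- The truncated convolution `∫_{|y| > ε} U(y) ρ(x - y) dy`. -/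
def truncConv (ε : ℝ) (ρ : Plane → ℝ) (x : Plane) : ℝ :=
  ∫ y in {y : Plane | ε < ‖y‖}, U2D y * ρ (x - y)

/-- `w` is the principal value convolution `U ⋆ ρ`: the limit in `L²` of the truncated
convolutions as `ε → 0⁺`. -/
def IsPVConv (ρ w : Plane → ℝ) : Prop :=
  MemLp w 2 volume ∧
    Tendsto (fun ε : ℝ => eLpNorm (fun x => truncConv ε ρ x - w x) 2 volume) (𝓝[>] 0) (𝓝 0)

open Classical in
/-- The principal value convolution `U ⋆ ρ` (well defined up to null sets when it exists). -/
def pvConv (ρ : Plane → ℝ) : Plane → ℝ :=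
  if h : ∃ w, IsPVConv ρ w then h.choose else 0

/-- `F_{a,b}(u) = a ∫ |u|⁴ + b ∫ (U ⋆ |u|²) |u|²`. -/
def interaction (a b : ℝ) (u : H1) : ℝ :=
  a * u.quartic + b * ∫ x, pvConv u.density x * u.density x

/-- `C` is an admissible constant in the generalized Gagliardo–Nirenberg inequality. -/
def IsGNConst (a b C : ℝ) : Prop :=
  ∀ u : H1, interaction a b u ≤ C * (u.dirichlet * u.mass)

/-- The optimal constant `C(a,b)`. -/
def gnConst (a b : ℝ) : ℝ := sInf {C : ℝ | IsGNConst a b C}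

/-! ### The physical two-dimensional energy -/

/-- The kernel `K(x) = (2√2 π^{3/2})⁻¹ ∫ e^{-s²/2} / √(|x|² + ε² s²) ds` at `ε = (2π)^{-1/2}`. -/
def K (x : Plane) : ℝ :=
  (2 * Real.sqrt 2 * Real.pi ^ (3 / 2 : ℝ))⁻¹ *
    ∫ s : ℝ, Real.exp (-s ^ 2 / 2) / Real.sqrt (‖x‖ ^ 2 + s ^ 2 / (2 * Real.pi))

/-- The convolution `K ⋆ ρ`. -/
def KConv (ρ : Plane → ℝ) (x : Plane) : ℝ := ∫ y, K (x - y) * ρ y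

/-- `Φ ∈ L²` equals `((1 - 2 n₃²) ∂₁² - n₃² ∂₂²) (K ⋆ ρ)` in the sense of distributions. -/
def IsDipolarPotential (n₃ : ℝ) (ρ Φ : Plane → ℝ) : Prop :=
  MemLp Φ 2 volume ∧
    ∀ φ : Plane → ℝ, IsTest φ →
      ∫ x, Φ x * φ x =
        ∫ x, KConv ρ x *
          ((1 - 2 * n₃ ^ 2) * pderiv 0 (pderiv 0 φ) x - n₃ ^ 2 * pderiv 1 (pderiv 1 φ) x)

open Classical in
/-- The dipolar potential `Φ` generated by `ρ` (well defined up to null sets when it exists). -/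
def dipolarPotential (n₃ : ℝ) (ρ : Plane → ℝ) : Plane → ℝ :=
  if h : ∃ Φ, IsDipolarPotential n₃ ρ Φ then h.choose else 0

/-- A smooth trapping potential: `V(x) → ∞` as `|x| → ∞`. -/
def IsTrap (V : Plane → ℝ) : Prop :=
  ContDiff ℝ ∞ V ∧ Tendsto V (cocompact Plane) atTop

/-- The states of unit mass and finite energy. As `V` is bounded below, all other functions of
unit mass have energy `+∞`. -/
def Admissible (V : Plane → ℝ) (u : H1) : Prop :=
  Integrable (fun x => V x * ‖u.toFun x‖ ^ 2) volume ∧ u.mass = 1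

/-- The two-dimensional dipolar energy functional. -/
def energy (V : Plane → ℝ) (β lam n₃ : ℝ) (u : H1) : ℝ :=
  1 / 2 * u.dirichlet + (∫ x, V x * ‖u.toFun x‖ ^ 2)
    + (β - lam + 3 * n₃ ^ 2 * lam) / 2 * u.quartic
    - 3 * lam / 4 * ∫ x, u.density x * dipolarPotential n₃ u.density x

/-- The ground state energy, an extended real number. -/
def groundEnergy (V : Plane → ℝ) (β lam n₃ : ℝ) : EReal :=
  ⨅ (u : H1) (_ : Admissible V u), (energy V β lam n₃ u : EReal)

/-- The effective parameter `a`. -/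
def aParam (β lam n₃ : ℝ) : ℝ := lam - β + 3 * lam / 2 * (n₃ ^ 2 - 1)

/-- The effective parameter `b`. -/
def bParam (lam n₃ : ℝ) : ℝ := 3 * lam * (n₃ ^ 2 - 1)

end Dipolar

end

noncomputable section
namespace Dipolar
open FourierTransform SchwartzMap

/-! Everything is read off the Fourier transform of the density ρ = |u|². The principal value
convolution is the multiplier with symbol (ξ₁² - ξ₂²) / (2|ξ|²), and Φ is the multiplier with symbol
-4π²((1 - 2n²)ξ₁² - n²ξ₂²) times the transform of K. Hence F_{a,b} and the interaction part of the
energy are both quadratic forms ∫ σ |ρ̂|² with bounded real σ (`interaction_eq_quad`, `energy_eq`).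
The principal value is identified by comparing the sharp truncation with a Gaussian regularization
whose transform is explicit; the difference is a dilated integrable kernel of mean zero
(`isPVConv_pvLimit`). The kernel K is a superposition of Gaussians (`K_eq_integral`), so its
transform is 1 / (2π²|ξ|²) up to a relative error O(|ξ|⁻²). The symbol of the energy therefore
agrees with that of F_{a,b} at high frequency, and the two forms differ by ε ∫|u|⁴ plus a multiple
of the squared mass (`exists_abs_energySymbol_quad_sub_le`).

Finiteness of C(a,b) comes from `H1.quartic_le`, proved through the embedding of Ḣ^{1/2} into L⁴.
Positivity holds because the symbol of F_{a,b} takes the values a ± b/2 on the coordinate axes, and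
stretching a bump concentrates ρ̂ near either axis (`exists_interaction_pos`).

For the optimizer, a maximizing sequence is normalized to mass and Dirichlet energy one. Its quartic
term stays away from zero, so some ball of fixed radius keeps a fixed mass
(`H1.exists_ball_mass_ge`), and after translation there is a nonzero weak limit w. Mass, Dirichlet
energy and interaction each split asymptotically into the part of w and that of the remainder
(`H1.WeakTo.tendsto_quad_sub`). With D and M for w, the inequality applied to both parts gives C ≤
C(DM + (1 - D)(1 - M)), and M > 0 forces D = M = 1.

For the energy, an admissible constant κ < 1 makes the functional coercive. The trap prevents loss
of mass, so minimizing sequences converge strongly in L², the interaction passes to the limit, and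
Fatou's lemma and weak lower semicontinuity treat the other terms (`exists_ground_state`). If the
constant 1 is not admissible, some u has F_{a,b}(u) > ∫|∇u|² ∫|u|². Truncated to compact support and
concentrated by dilations of unit mass, it makes the energy decrease like -s², while the potential
energy stays bounded (`groundEnergy_eq_bot`). -/

/-- The complex Hilbert space of square integrable functions on the plane. -/
abbrev L2 : Type := Lp ℂ 2 (volume : Measure Plane)

/-! ### The Fourier transform on L² and on L¹ ∩ L² -/

/-- A compactly supported smooth real function as a complex Schwartz function. -/
def toSchwartz (g : Plane → ℝ) (hg : ContDiff ℝ ∞ g) (hc : HasCompactSupport g) : 𝓢(Plane, ℂ) :=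
  HasCompactSupport.toSchwartzMap (f := Complex.ofRealCLM ∘ g)
    (hc.comp_left (g := Complex.ofRealCLM) (map_zero _)) (by fun_prop)

lemma toSchwartz_apply (g : Plane → ℝ) (hg : ContDiff ℝ ∞ g) (hc : HasCompactSupport g) (x : Plane) :
    toSchwartz g hg hc x = (g x : ℂ) := by
  simp [toSchwartz]

/-- The L² transform agrees with the transform of tempered distributions, whose definition by
duality is exactly this multiplication formula. -/
lemma integral_smul_fourier_lp (f : L2) (g : 𝓢(Plane, ℂ)) :
    ∫ x, g x • (𝓕 f : L2) x = ∫ x, (𝓕 g) x • f x := by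
  have := congrArg (fun T => T g) (Lp.fourier_toTemperedDistribution_eq f)
  simpa [Lp.toTemperedDistribution_apply] using this.symm

lemma integral_smul_fourierInv_lp (f : L2) (g : 𝓢(Plane, ℂ)) :
    ∫ x, g x • (𝓕⁻ f : L2) x = ∫ x, (𝓕⁻ g) x • f x := by
  have := congrArg (fun T => T g) (Lp.fourierInv_toTemperedDistribution_eq f)
  simpa [Lp.toTemperedDistribution_apply] using this.symm

lemma continuous_fourier {f : Plane → ℂ} (h1 : Integrable f) : Continuous (𝓕 f) :=
  VectorFourier.fourierIntegral_continuous Real.continuous_fourierChar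
    (L := innerₗ Plane) (by simpa using continuous_inner) h1

lemma fourierInv_eq_comp_neg (f : Plane → ℂ) : 𝓕⁻ f = fun x => 𝓕 f (-x) := by
  ext x; exact Real.fourierInv_eq_fourier_neg f x

lemma continuous_fourierInv {f : Plane → ℂ} (h1 : Integrable f) : Continuous (𝓕⁻ f) := by
  rw [fourierInv_eq_comp_neg]
  exact (continuous_fourier h1).comp continuous_neg

lemma norm_fourier_le {f : Plane → ℂ} (x : Plane) : ‖𝓕 f x‖ ≤ ∫ y, ‖f y‖ :=
  VectorFourier.norm_fourierIntegral_le_integral_norm _ _ _ _ _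

lemma norm_fourierInv_le {f : Plane → ℂ} (x : Plane) : ‖𝓕⁻ f x‖ ≤ ∫ y, ‖f y‖ := by
  rw [fourierInv_eq_comp_neg]; exact norm_fourier_le _

lemma integral_fourier_mul {f g : Plane → ℂ} (hf : Integrable f) (hg : Integrable g) :
    ∫ x, 𝓕 g x * f x = ∫ x, g x * 𝓕 f x := by
  have := VectorFourier.integral_fourierIntegral_smul_eq_flip (L := innerₗ Plane) (μ := volume)
    (ν := volume) Real.continuous_fourierChar (by simpa using continuous_inner) hg hf
  simp only [flip_innerₗ, smul_eq_mul] at this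
  exact this

lemma integral_fourierInv_mul {f g : Plane → ℂ} (hf : Integrable f) (hg : Integrable g) :
    ∫ x, 𝓕⁻ g x * f x = ∫ x, g x * 𝓕⁻ f x := by
  rw [fourierInv_eq_comp_neg, Real.fourierInv_eq_fourier_comp_neg f, ← integral_neg_eq_self]
  simp only [neg_neg]
  exact integral_fourier_mul hf.comp_neg hg

/-- One side is an extension by density, the other an integral. By the multiplication formula both
have the same pairing with every test function. Pointwise bounds and continuity of `𝓕 f` thereby
become available in L². -/
theorem fourier_toLp_ae_eq {f : Plane → ℂ} (h1 : Integrable f) (h2 : MemLp f 2 volume) :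
    (𝓕 (h2.toLp f) : L2) =ᵐ[volume] 𝓕 f := by
  apply ae_eq_of_integral_contDiff_smul_eq
  · exact (Lp.memLp _).locallyIntegrable (by norm_num)
  · exact (continuous_fourier h1).locallyIntegrable
  intro g hg hc
  have e := integral_smul_fourier_lp (h2.toLp f) (toSchwartz g hg hc)
  simp only [toSchwartz_apply] at e
  have e2 : ∫ x, g x • (𝓕 (h2.toLp f) : L2) x = ∫ x, (g x : ℂ) • (𝓕 (h2.toLp f) : L2) x := by simp
  rw [e2, e]
  have e3 : ∫ x, (𝓕 (toSchwartz g hg hc)) x • (h2.toLp f) x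
      = ∫ x, 𝓕 (toSchwartz g hg hc : Plane → ℂ) x * f x := by
    apply integral_congr_ae
    filter_upwards [h2.coeFn_toLp] with x hx
    rw [hx, SchwartzMap.fourier_coe]; rfl
  rw [e3, integral_fourier_mul h1 (toSchwartz g hg hc).integrable]
  simp [toSchwartz_apply]

theorem fourierInv_toLp_ae_eq {f : Plane → ℂ} (h1 : Integrable f) (h2 : MemLp f 2 volume) :
    (𝓕⁻ (h2.toLp f) : L2) =ᵐ[volume] 𝓕⁻ f := by
  apply ae_eq_of_integral_contDiff_smul_eq
  · exact (Lp.memLp _).locallyIntegrable (by norm_num)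
  · exact (continuous_fourierInv h1).locallyIntegrable
  intro g hg hc
  have e := integral_smul_fourierInv_lp (h2.toLp f) (toSchwartz g hg hc)
  simp only [toSchwartz_apply] at e
  have e2 : ∫ x, g x • (𝓕⁻ (h2.toLp f) : L2) x = ∫ x, (g x : ℂ) • (𝓕⁻ (h2.toLp f) : L2) x := by simp
  rw [e2, e]
  have e3 : ∫ x, (𝓕⁻ (toSchwartz g hg hc)) x • (h2.toLp f) x
      = ∫ x, 𝓕⁻ (toSchwartz g hg hc : Plane → ℂ) x * f x := by
    apply integral_congr_ae
    filter_upwards [h2.coeFn_toLp] with x hx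
    rw [hx, SchwartzMap.fourierInv_coe]; rfl
  rw [e3, integral_fourierInv_mul h1 (toSchwartz g hg hc).integrable]
  simp [toSchwartz_apply]

lemma memLp_fourier {f : Plane → ℂ} (h1 : Integrable f) (h2 : MemLp f 2 volume) :
    MemLp (𝓕 f) 2 volume :=
  (memLp_congr_ae (fourier_toLp_ae_eq h1 h2)).1 (Lp.memLp _)

lemma norm_sq_lp (f : L2) : ‖f‖ ^ 2 = ∫ x, ‖f x‖ ^ 2 := by
  have := L2.inner_def (𝕜 := ℂ) f f
  rw [inner_self_eq_norm_sq_to_K] at this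
  have h2 : ∀ x, inner ℂ (f x) (f x) = ((‖f x‖ ^ 2 : ℝ) : ℂ) := by
    intro x; rw [inner_self_eq_norm_sq_to_K]; simp
  simp_rw [h2] at this
  rw [integral_complex_ofReal] at this
  apply Complex.ofReal_injective
  push_cast
  exact this

lemma integrable_norm_sq {E : Type*} [NormedAddCommGroup E] {f : Plane → E} (hf : MemLp f 2 volume) :
    Integrable (fun x => ‖f x‖ ^ 2) := hf.integrable_norm_pow (by norm_num)

lemma norm_sq_toLp {f : Plane → ℂ} (h2 : MemLp f 2 volume) :
    ‖h2.toLp f‖ ^ 2 = ∫ x, ‖f x‖ ^ 2 := by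
  rw [norm_sq_lp]
  apply integral_congr_ae
  filter_upwards [h2.coeFn_toLp] with x hx
  rw [hx]

/-! ### Bounded Fourier multipliers and their quadratic forms -/

/-- A bounded measurable real Fourier symbol. -/
structure Symbol where
  /-- the symbol -/
  toFun : Plane → ℝ
  measurable : Measurable toFun
  /-- a bound -/
  bound : ℝ
  le_bound : ∀ ξ, |toFun ξ| ≤ bound

lemma Symbol.bound_nonneg (σ : Symbol) : 0 ≤ σ.bound := (abs_nonneg _).trans (σ.le_bound 0)

lemma Symbol.memLp_mul (σ : Symbol) {f : Plane → ℂ} (hf : MemLp f 2 volume) :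
    MemLp (fun ξ => (σ.toFun ξ : ℂ) * f ξ) 2 volume := by
  refine hf.of_le_mul (c := σ.bound) ?_ ?_
  · exact (Complex.measurable_ofReal.comp σ.measurable).aestronglyMeasurable.mul hf.1
  · filter_upwards with ξ
    rw [norm_mul, Complex.norm_real]
    exact mul_le_mul_of_nonneg_right (σ.le_bound ξ) (norm_nonneg _)

/-- Multiplication by a symbol on `L²`. -/
def Symbol.mul (σ : Symbol) : L2 →L[ℂ] L2 :=
  LinearMap.mkContinuous
    { toFun := fun f => (σ.memLp_mul (Lp.memLp f)).toLp _
      map_add' := by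
        intro f g
        apply Lp.ext
        filter_upwards [(σ.memLp_mul (Lp.memLp (f + g))).coeFn_toLp, (σ.memLp_mul (Lp.memLp f)).coeFn_toLp,
          (σ.memLp_mul (Lp.memLp g)).coeFn_toLp, Lp.coeFn_add f g, Lp.coeFn_add ((σ.memLp_mul (Lp.memLp f)).toLp _)
            ((σ.memLp_mul (Lp.memLp g)).toLp _)] with x h1 h2 h3 h4 h5
        rw [h1, h5, Pi.add_apply, h2, h3, h4, Pi.add_apply, mul_add]
      map_smul' := by
        intro c f
        apply Lp.ext
        filter_upwards [(σ.memLp_mul (Lp.memLp (c • f))).coeFn_toLp, (σ.memLp_mul (Lp.memLp f)).coeFn_toLp,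
          Lp.coeFn_smul c f, Lp.coeFn_smul c ((σ.memLp_mul (Lp.memLp f)).toLp _)] with x h1 h2 h3 h4
        simp only [RingHom.id_apply]
        rw [h1, h4, Pi.smul_apply, h2, h3, Pi.smul_apply]
        simp only [smul_eq_mul]; ring } σ.bound (by
    intro f
    apply Lp.norm_le_mul_norm_of_ae_le_mul
    filter_upwards [(σ.memLp_mul (Lp.memLp f)).coeFn_toLp] with x hx
    simp only [LinearMap.coe_mk, AddHom.coe_mk]
    rw [hx, norm_mul, Complex.norm_real]
    exact mul_le_mul_of_nonneg_right (σ.le_bound x) (norm_nonneg _))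

lemma Symbol.mul_ae (σ : Symbol) (f : L2) : σ.mul f =ᵐ[volume] fun ξ => (σ.toFun ξ : ℂ) * f ξ :=
  (σ.memLp_mul (Lp.memLp f)).coeFn_toLp

/-- The Fourier multiplier with a given symbol. -/
def Symbol.op (σ : Symbol) : L2 →L[ℂ] L2 :=
  ((Lp.fourierTransformₗᵢ Plane ℂ).symm.toContinuousLinearEquiv : L2 →L[ℂ] L2).comp
    (σ.mul.comp ((Lp.fourierTransformₗᵢ Plane ℂ).toContinuousLinearEquiv : L2 →L[ℂ] L2))

lemma Symbol.op_apply (σ : Symbol) (f : L2) : σ.op f = 𝓕⁻ (σ.mul (𝓕 f)) := rfl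

lemma Symbol.fourier_op (σ : Symbol) (f : L2) : 𝓕 (σ.op f) = σ.mul (𝓕 f) := by
  rw [σ.op_apply, fourier_fourierInv_eq]

lemma Symbol.inner_op (σ : Symbol) (f g : L2) :
    inner ℂ f (σ.op g) = ∫ ξ, (σ.toFun ξ : ℂ) * ((starRingEnd ℂ) ((𝓕 f : L2) ξ) * (𝓕 g : L2) ξ) := by
  rw [← Lp.inner_fourier_eq, σ.fourier_op, L2.inner_def]
  apply integral_congr_ae
  filter_upwards [σ.mul_ae (𝓕 g)] with x hx
  rw [hx, RCLike.inner_apply]; ring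

/-- The quadratic form of a Fourier multiplier. -/
def Symbol.quad (σ : Symbol) (f : L2) : ℝ := RCLike.re (inner ℂ f (σ.op f))

lemma Symbol.quad_eq (σ : Symbol) (f : L2) :
    σ.quad f = ∫ ξ, σ.toFun ξ * ‖(𝓕 f : L2) ξ‖ ^ 2 := by
  rw [Symbol.quad, σ.inner_op]
  have : ∀ ξ, (σ.toFun ξ : ℂ) * ((starRingEnd ℂ) ((𝓕 f : L2) ξ) * (𝓕 f : L2) ξ)
      = ((σ.toFun ξ * ‖(𝓕 f : L2) ξ‖ ^ 2 : ℝ) : ℂ) := by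
    intro ξ; rw [RCLike.conj_mul]; push_cast; rfl
  simp_rw [this]
  rw [integral_complex_ofReal]; simp

lemma Symbol.integrable_quad (σ : Symbol) (f : L2) :
    Integrable (fun ξ => σ.toFun ξ * ‖(𝓕 f : L2) ξ‖ ^ 2) := by
  refine (integrable_norm_sq (Lp.memLp (𝓕 f : L2))).bdd_mul (c := σ.bound) σ.measurable.aestronglyMeasurable ?_
  filter_upwards with x using σ.le_bound x

/-- A real symbol gives a self-adjoint operator; this merges the two cross terms in
`Symbol.quad_add`. -/
lemma Symbol.inner_op_comm (σ : Symbol) (f g : L2) :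
    inner ℂ f (σ.op g) = (starRingEnd ℂ) (inner ℂ g (σ.op f)) := by
  rw [σ.inner_op, σ.inner_op, ← integral_conj]
  congr 1; ext ξ
  simp; left; ring

lemma Symbol.quad_add (σ : Symbol) (f g : L2) :
    σ.quad (f + g) = σ.quad f + σ.quad g + 2 * RCLike.re (inner ℂ g (σ.op f)) := by
  simp only [Symbol.quad, map_add, inner_add_left, inner_add_right, σ.inner_op_comm f g]
  rw [RCLike.conj_re]; ring

lemma Symbol.continuous_quad (σ : Symbol) : Continuous σ.quad := by
  unfold Symbol.quad; fun_prop

lemma integral_norm_sq_fourier (f : L2) : ∫ ξ, ‖(𝓕 f : L2) ξ‖ ^ 2 = ‖f‖ ^ 2 := by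
  rw [← norm_sq_lp, Lp.norm_fourier_eq]

lemma Symbol.quad_le (σ : Symbol) (f : L2) {c : ℝ} (h : ∀ ξ, σ.toFun ξ ≤ c) :
    σ.quad f ≤ c * ‖f‖ ^ 2 := by
  rw [σ.quad_eq, ← integral_norm_sq_fourier, ← integral_const_mul]
  apply integral_mono (σ.integrable_quad f) ((integrable_norm_sq (Lp.memLp (𝓕 f : L2))).const_mul c)
  intro ξ
  exact mul_le_mul_of_nonneg_right (h ξ) (by positivity)


/-! ### Cutoff functions -/

/-- A fixed smooth bump function, equal to one on the unit ball. -/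
def bump : ContDiffBump (0 : Plane) := ⟨1, 2, by norm_num, by norm_num⟩

/-- The bump function at scale `R`. -/
def cut (R : ℝ) (x : Plane) : ℝ := bump (R⁻¹ • x)

lemma IsTest.continuous {φ : Plane → ℝ} (h : IsTest φ) : Continuous φ := h.1.continuous

lemma IsTest.differentiable {φ : Plane → ℝ} (h : IsTest φ) : Differentiable ℝ φ :=
  h.1.differentiable (by simp)

lemma IsTest.pderiv {φ : Plane → ℝ} (h : IsTest φ) (i : Fin 2) : IsTest (pderiv i φ) := by
  constructor
  · exact (h.1.fderiv_right (m := ∞) (by simp)).clm_apply contDiff_const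
  · exact h.2.fderiv_apply (𝕜 := ℝ) _

lemma IsTest.memLp {φ : Plane → ℝ} (h : IsTest φ) (p : ℝ≥0∞) : MemLp φ p volume :=
  h.continuous.memLp_of_hasCompactSupport h.2

lemma IsTest.integrable {φ : Plane → ℝ} (h : IsTest φ) : Integrable φ :=
  h.continuous.integrable_of_hasCompactSupport h.2

lemma IsTest.exists_bound {φ : Plane → ℝ} (h : IsTest φ) : ∃ C, 0 < C ∧ ∀ x, |φ x| ≤ C := by
  obtain ⟨C, hC⟩ := h.continuous.bounded_above_of_compact_support h.2
  exact ⟨|C| + 1, by positivity, fun x => (hC x).trans (by linarith [le_abs_self C])⟩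

lemma IsTest.mul {φ ψ : Plane → ℝ} (h : IsTest φ) (h' : ContDiff ℝ ∞ ψ) :
    IsTest (fun x => φ x * ψ x) :=
  ⟨h.1.mul h', h.2.mul_right⟩

lemma isTest_bump : IsTest bump := ⟨bump.contDiff, bump.hasCompactSupport⟩

lemma isTest_cut {R : ℝ} (hR : 0 < R) : IsTest (cut R) :=
  ⟨bump.contDiff.comp (contDiff_const_smul _),
    bump.hasCompactSupport.comp_homeomorph (Homeomorph.smulOfNeZero R⁻¹ (inv_ne_zero hR.ne'))⟩

lemma cut_nonneg (R : ℝ) (x : Plane) : 0 ≤ cut R x := bump.nonneg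

lemma cut_le_one (R : ℝ) (x : Plane) : cut R x ≤ 1 := bump.le_one

lemma abs_cut_le_one (R : ℝ) (x : Plane) : |cut R x| ≤ 1 := by
  rw [abs_of_nonneg (cut_nonneg R x)]; exact cut_le_one R x

lemma cut_eq_one {R : ℝ} (hR : 0 < R) {x : Plane} (hx : ‖x‖ ≤ R) : cut R x = 1 := by
  apply bump.one_of_mem_closedBall
  rw [mem_closedBall_zero_iff, norm_smul, norm_inv, Real.norm_of_nonneg hR.le]
  show R⁻¹ * ‖x‖ ≤ 1
  rw [inv_mul_le_iff₀ hR]; linarith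

lemma cut_eq_zero {R : ℝ} (hR : 0 < R) {x : Plane} (hx : 2 * R ≤ ‖x‖) : cut R x = 0 := by
  apply bump.zero_of_le_dist
  rw [dist_zero_right, norm_smul, norm_inv, Real.norm_of_nonneg hR.le]
  show 2 ≤ R⁻¹ * ‖x‖
  rw [le_inv_mul_iff₀ hR]; linarith

lemma pderiv_cut (R : ℝ) (i : Fin 2) (x : Plane) :
    pderiv i (cut R) x = R⁻¹ * pderiv i bump (R⁻¹ • x) := by
  unfold pderiv
  have h : HasFDerivAt (cut R) ((fderiv ℝ bump (R⁻¹ • x)).comp (R⁻¹ • ContinuousLinearMap.id ℝ Plane)) x := by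
    refine HasFDerivAt.comp x ((isTest_bump.differentiable _).hasFDerivAt) ?_
    exact (hasFDerivAt_id x).const_smul R⁻¹
  rw [h.fderiv]; simp

lemma exists_pderiv_cut_bound : ∃ B, 0 < B ∧ ∀ R, 0 < R → ∀ i x, |pderiv i (cut R) x| ≤ B / R := by
  obtain ⟨B0, h0, hB0⟩ := (isTest_bump.pderiv 0).exists_bound
  obtain ⟨B1, h1, hB1⟩ := (isTest_bump.pderiv 1).exists_bound
  refine ⟨B0 + B1, by positivity, fun R hR i x => ?_⟩
  rw [pderiv_cut, abs_mul, abs_of_pos (inv_pos.2 hR), div_eq_inv_mul]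
  apply mul_le_mul_of_nonneg_left _ (inv_pos.2 hR).le
  fin_cases i
  · exact (hB0 _).trans (by linarith)
  · exact (hB1 _).trans (by linarith)

lemma pderiv_mul {φ ψ : Plane → ℝ} (h : Differentiable ℝ φ) (h' : Differentiable ℝ ψ) (i : Fin 2)
    (x : Plane) : pderiv i (fun x => φ x * ψ x) x = φ x * pderiv i ψ x + ψ x * pderiv i φ x := by
  unfold pderiv
  rw [fderiv_fun_mul (h x) (h' x)]; simp

/-! ### Weak derivatives tested against Schwartz functions -/

lemma integrable_mul_of_memLp_two {f g : Plane → ℂ} (hf : MemLp f 2 volume) (hg : MemLp g 2 volume) :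
    Integrable (fun x => f x * g x) := hf.integrable_mul hg

lemma IsTest.integrable_smul {φ : Plane → ℝ} (h : IsTest φ) {u : Plane → ℂ} (hu : MemLp u 2 volume) :
    Integrable (fun x => φ x • u x) := by
  simpa using integrable_mul_of_memLp_two (h.memLp 2).ofReal hu

/-- Weak derivatives are defined through real test functions; the complex ones follow by splitting
into real and imaginary parts. -/
lemma IsWeakPartial.complex {i : Fin 2} {u g : Plane → ℂ} (h : IsWeakPartial i u g)
    (hu : MemLp u 2 volume) (hg : MemLp g 2 volume) {ψ : Plane → ℂ} (hψ : ContDiff ℝ ∞ ψ)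
    (hc : HasCompactSupport ψ) :
    ∫ x, fderiv ℝ ψ x (EuclideanSpace.single i 1) * u x = -∫ x, ψ x * g x := by
  have hre : IsTest (fun x => (ψ x).re) :=
    ⟨Complex.reCLM.contDiff.comp hψ, hc.comp_left (g := Complex.re) rfl⟩
  have him : IsTest (fun x => (ψ x).im) :=
    ⟨Complex.imCLM.contDiff.comp hψ, hc.comp_left (g := Complex.im) rfl⟩
  have hd : Differentiable ℝ ψ := hψ.differentiable (by simp)
  have dre : ∀ x, Dipolar.pderiv i (fun x => (ψ x).re) x = (fderiv ℝ ψ x (EuclideanSpace.single i 1)).re := by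
    intro x
    have := (Complex.reCLM.hasFDerivAt.comp x (hd x).hasFDerivAt).fderiv
    unfold Dipolar.pderiv
    change fderiv ℝ (Complex.reCLM ∘ ψ) x _ = _
    rw [this]; simp
  have dim : ∀ x, Dipolar.pderiv i (fun x => (ψ x).im) x = (fderiv ℝ ψ x (EuclideanSpace.single i 1)).im := by
    intro x
    have := (Complex.imCLM.hasFDerivAt.comp x (hd x).hasFDerivAt).fderiv
    unfold Dipolar.pderiv
    change fderiv ℝ (Complex.imCLM ∘ ψ) x _ = _
    rw [this]; simp
  have e1 : ∀ x, fderiv ℝ ψ x (EuclideanSpace.single i 1) * u x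
      = Dipolar.pderiv i (fun x => (ψ x).re) x • u x + Complex.I * (Dipolar.pderiv i (fun x => (ψ x).im) x • u x) := by
    intro x
    rw [dre, dim]
    nth_rw 1 [← Complex.re_add_im (fderiv ℝ ψ x (EuclideanSpace.single i 1))]
    simp only [Complex.real_smul]; ring
  have e2 : ∀ x, ψ x * g x = (ψ x).re • g x + Complex.I * ((ψ x).im • g x) := by
    intro x
    nth_rw 1 [← Complex.re_add_im (ψ x)]
    simp only [Complex.real_smul]; ring
  simp_rw [e1, e2]
  rw [integral_add ((hre.pderiv i).integrable_smul hu) (((him.pderiv i).integrable_smul hu).const_mul _),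
    integral_add (hre.integrable_smul hg) ((him.integrable_smul hg).const_mul _),
    integral_const_mul, integral_const_mul, h _ hre, h _ him]
  ring

/-- The transform of a test function is Schwartz but in general not compactly supported, so the
integration by parts has to be extended. A cutoff at radius n + 1 costs a term of size B / (n + 1),
and dominated convergence removes the cutoff. -/
lemma IsWeakPartial.schwartz {i : Fin 2} {u g : Plane → ℂ} (h : IsWeakPartial i u g)
    (hu : MemLp u 2 volume) (hg : MemLp g 2 volume) (ψ : 𝓢(Plane, ℂ)) :
    ∫ x, fderiv ℝ ψ x (EuclideanSpace.single i 1) * u x = -∫ x, ψ x * g x := by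
  obtain ⟨B, hB, hcut⟩ := exists_pderiv_cut_bound
  have hn : ∀ n : ℕ, (0 : ℝ) < n + 1 := fun n => by positivity
  have hψd : MemLp (fun x => fderiv ℝ ψ x (EuclideanSpace.single i 1)) 2 volume := by
    have := (LineDeriv.lineDerivOp (EuclideanSpace.single i (1:ℝ) : Plane) ψ).memLp 2 volume
    exact (memLp_congr_ae (ae_of_all _ fun x => SchwartzMap.lineDerivOp_apply_eq_fderiv _ ψ x)).1 this
  have key : ∀ n : ℕ, ∫ x, ((cut (n+1) x : ℂ) * fderiv ℝ ψ x (EuclideanSpace.single i 1)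
      + (pderiv i (cut (n+1)) x : ℂ) * ψ x) * u x = -∫ x, ((cut (n+1) x : ℂ) * ψ x) * g x := by
    intro n
    have ht := isTest_cut (hn n)
    have hc1 : ContDiff ℝ ∞ (fun x => (cut (n+1) x : ℂ)) := Complex.ofRealCLM.contDiff.comp ht.1
    have hcs : HasCompactSupport (fun x => (cut (n+1) x : ℂ) * ψ x) :=
      (ht.2.comp_left (g := ((↑) : ℝ → ℂ)) rfl).mul_right
    rw [← h.complex hu hg (hc1.mul (ψ.smooth _)) hcs]
    congr 1; ext x
    have d1 : HasFDerivAt (fun x => (cut (n+1) x : ℂ)) (Complex.ofRealCLM.comp (fderiv ℝ (cut (n+1)) x)) x :=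
      Complex.ofRealCLM.hasFDerivAt.comp x (ht.differentiable x).hasFDerivAt
    rw [fderiv_fun_mul d1.differentiableAt ψ.differentiableAt, d1.fderiv]
    simp [pderiv]; left; ring
  have lim1 : ∀ x : Plane, Tendsto (fun n : ℕ => (cut (n+1) x : ℂ)) atTop (𝓝 1) := by
    intro x
    apply tendsto_const_nhds.congr'
    filter_upwards [eventually_ge_atTop ⌈‖x‖⌉₊] with n hnx
    rw [cut_eq_one (hn n)]; · simp
    have := Nat.ceil_le.1 hnx
    linarith
  have lim2 : ∀ x : Plane, Tendsto (fun n : ℕ => (pderiv i (cut (n+1)) x : ℂ)) atTop (𝓝 0) := by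
    intro x
    have : Tendsto (fun n : ℕ => pderiv i (cut (n+1)) x) atTop (𝓝 0) := by
      apply squeeze_zero_norm (a := fun n : ℕ => B / ((n:ℝ) + 1)) (fun n => hcut _ (hn n) i x)
      exact tendsto_const_div_atTop_nhds_zero_nat B |>.comp (tendsto_add_atTop_nat 1) |>.congr (by intro n; simp)
    exact_mod_cast (Complex.continuous_ofReal.tendsto 0).comp this
  have hψ2 : MemLp ψ 2 volume := ψ.memLp 2
  have L1 : Tendsto (fun n : ℕ => ∫ x, ((cut (n+1) x : ℂ) * fderiv ℝ ψ x (EuclideanSpace.single i 1)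
      + (pderiv i (cut (n+1)) x : ℂ) * ψ x) * u x) atTop
      (𝓝 (∫ x, fderiv ℝ ψ x (EuclideanSpace.single i 1) * u x)) := by
    apply tendsto_integral_of_dominated_convergence
      (fun x => ‖fderiv ℝ ψ x (EuclideanSpace.single i 1) * u x‖ + B * ‖ψ x * u x‖)
    · intro n
      have ht := isTest_cut (hn n)
      refine AEStronglyMeasurable.mul (AEStronglyMeasurable.add (AEStronglyMeasurable.mul ?_ hψd.1) (AEStronglyMeasurable.mul ?_ hψ2.1)) hu.1
      · exact (Complex.continuous_ofReal.comp ht.continuous).aestronglyMeasurable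
      · exact (Complex.continuous_ofReal.comp (ht.pderiv i).continuous).aestronglyMeasurable
    · exact (integrable_mul_of_memLp_two hψd hu).norm.add ((integrable_mul_of_memLp_two hψ2 hu).norm.const_mul B)
    · intro n
      filter_upwards with x
      rw [add_mul]
      refine (norm_add_le _ _).trans (add_le_add ?_ ?_)
      · rw [mul_assoc, norm_mul, Complex.norm_real]
        exact mul_le_of_le_one_left (norm_nonneg _) (abs_cut_le_one _ x)
      · rw [mul_assoc, norm_mul, Complex.norm_real]
        refine mul_le_mul_of_nonneg_right ((hcut _ (hn n) i x).trans ?_) (norm_nonneg _)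
        apply div_le_self hB.le; linarith [(Nat.cast_nonneg n : (0:ℝ) ≤ n)]
    · filter_upwards with x
      have := (((lim1 x).mul_const (fderiv ℝ ψ x (EuclideanSpace.single i 1))).add ((lim2 x).mul_const (ψ x))).mul_const (u x)
      simpa using this
  have L2 : Tendsto (fun n : ℕ => -∫ x, ((cut (n+1) x : ℂ) * ψ x) * g x) atTop
      (𝓝 (-∫ x, ψ x * g x)) := by
    refine Tendsto.neg ?_
    apply tendsto_integral_of_dominated_convergence (fun x => ‖ψ x * g x‖)
    · intro n
      have ht := isTest_cut (hn n)
      refine AEStronglyMeasurable.mul (AEStronglyMeasurable.mul ?_ hψ2.1) hg.1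
      exact (Complex.continuous_ofReal.comp ht.continuous).aestronglyMeasurable
    · exact (integrable_mul_of_memLp_two hψ2 hg).norm
    · intro n
      filter_upwards with x
      rw [mul_assoc, norm_mul, Complex.norm_real]
      exact mul_le_of_le_one_left (norm_nonneg _) (abs_cut_le_one _ x)
    · filter_upwards with x
      simpa using ((lim1 x).mul_const (ψ x)).mul_const (g x)
  simp_rw [key] at L1
  exact tendsto_nhds_unique L1 L2

/-! ### The weak gradient on the Fourier side -/

/-- A Sobolev function as an element of `L²`. -/
def H1.lp (u : H1) : L2 := u.memLp.toLp u.toFun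

/-- The weak gradient as an element of `L²`. -/
def H1.glp (u : H1) (i : Fin 2) : L2 := (u.memLp_grad i).toLp (u.grad i)

/-- Pairing with a test function g moves the transform onto g and the weak derivative onto ĝ;
differentiating ĝ amounts to multiplying g by a coordinate. Both sides then have the same pairings.
-/
theorem H1.fourier_glp (u : H1) (i : Fin 2) :
    (𝓕 (u.glp i) : L2) =ᵐ[volume] fun ξ => (2 * Real.pi * ξ i : ℝ) * Complex.I * (𝓕 u.lp : L2) ξ := by
  apply ae_eq_of_integral_contDiff_smul_eq
  · exact (Lp.memLp _).locallyIntegrable (by norm_num)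
  · have h2 : LocallyIntegrable (𝓕 u.lp : L2) := (Lp.memLp (𝓕 u.lp : L2)).locallyIntegrable (by norm_num)
    have : (fun ξ : Plane => (2 * Real.pi * ξ i : ℝ) * Complex.I * (𝓕 u.lp : L2) ξ)
        = fun ξ : Plane => ((2 * Real.pi * ξ i : ℝ) * Complex.I : ℂ) • (𝓕 u.lp : L2) ξ := by
      ext; simp
    rw [this, ← locallyIntegrableOn_univ]
    apply LocallyIntegrableOn.continuousOn_smul isOpen_univ.isLocallyClosed (h2.locallyIntegrableOn _)
    apply Continuous.continuousOn
    fun_prop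
  intro g hg hc
  set G := toSchwartz g hg hc
  set e : Plane := EuclideanSpace.single i 1
  have e1 : ∫ x, g x • (𝓕 (u.glp i) : L2) x = ∫ x, G x • (𝓕 (u.glp i) : L2) x := by
    simp [G, toSchwartz_apply]
  have h3 := u.isWeakPartial i |>.schwartz u.memLp (u.memLp_grad i) (𝓕 G)
  have e2 : ∫ x, (𝓕 G : 𝓢(Plane, ℂ)) x • (u.glp i) x = ∫ x, (𝓕 G : 𝓢(Plane, ℂ)) x * u.grad i x := by
    apply integral_congr_ae
    filter_upwards [(u.memLp_grad i).coeFn_toLp] with x hx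
    rw [H1.glp, hx]; rfl
  have e3 : ∫ x, fderiv ℝ (𝓕 G : 𝓢(Plane, ℂ)) x e * u.toFun x = ∫ x, (LineDeriv.lineDerivOp e (𝓕 G)) x • u.lp x := by
    apply integral_congr_ae
    filter_upwards [u.memLp.coeFn_toLp] with x hx
    rw [H1.lp, hx, SchwartzMap.lineDerivOp_apply_eq_fderiv]; rfl
  rw [e1, integral_smul_fourier_lp, e2, ← neg_eq_iff_eq_neg.2 h3, e3, SchwartzMap.lineDerivOp_fourier_eq,
    ← integral_smul_fourier_lp, ← integral_neg]
  congr 1; ext x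
  have ht : (fun y : Plane => y i).HasTemperateGrowth := by
    have : (fun y : Plane => inner ℝ y e).HasTemperateGrowth := by fun_prop
    simpa [e, EuclideanSpace.inner_single_right] using this
  simp [SchwartzMap.smulLeftCLM_apply_apply ht, G, toSchwartz_apply, e, EuclideanSpace.inner_single_right]
  ring


/-! ### The critical embedding of Ḣ^{1/2} into L⁴ -/

lemma abs_integral_mul_le {α : Type*} [MeasurableSpace α] {μ : Measure α} {f g : α → ℝ}
    (hf : MemLp f 2 μ) (hg : MemLp g 2 μ) :
    |∫ x, f x * g x ∂μ| ≤ √(∫ x, f x ^ 2 ∂μ) * √(∫ x, g x ^ 2 ∂μ) := by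
  have h : ∀ {p q : α → ℝ} (hp : MemLp p 2 μ) (hq : MemLp q 2 μ),
      inner ℝ (hp.toLp p) (hq.toLp q) = ∫ x, p x * q x ∂μ := by
    intro p q hp hq
    rw [L2.inner_def]
    apply integral_congr_ae
    filter_upwards [hp.coeFn_toLp, hq.coeFn_toLp] with x h1 h2
    rw [h1, h2]; simp [mul_comm]
  have hn : ∀ {p : α → ℝ} (hp : MemLp p 2 μ), ‖hp.toLp p‖ = √(∫ x, p x ^ 2 ∂μ) := by
    intro p hp
    rw [norm_eq_sqrt_real_inner, h]; simp_rw [← pow_two]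
  rw [← h hf hg, ← hn hf, ← hn hg]
  exact abs_real_inner_le_norm _ _

lemma volume_real_ball_plane : (volume : Measure Plane).real (Metric.ball 0 1) = Real.pi := by
  rw [measureReal_def, InnerProductSpace.volume_ball_of_dim_even (k := 1) (by simp)]
  simp [Real.pi_pos.le]

lemma integrableOn_ball_inv_norm (R : ℝ) :
    IntegrableOn (fun x : Plane => ‖x‖⁻¹) (Metric.ball 0 R) := by
  rw [integrableOn_fun_norm_addHaar (μ := volume) (f := fun r => r⁻¹)]
  have : IntegrableOn (fun _ : ℝ => (1:ℝ)) (Set.Ioo 0 R) := by simp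
  refine this.congr_fun ?_ measurableSet_Ioo
  intro y hy
  have : y ≠ 0 := hy.1.ne'
  simp [this]

lemma integral_ball_inv_norm {R : ℝ} (hR : 0 ≤ R) :
    ∫ x in Metric.ball (0 : Plane) R, ‖x‖⁻¹ = 2 * Real.pi * R := by
  have h := integral_fun_norm_addHaar (volume : Measure Plane) ((Set.Iio R).indicator fun r => r⁻¹)
  have e : ∫ x in Metric.ball (0 : Plane) R, ‖x‖⁻¹ = ∫ x : Plane, (Set.Iio R).indicator (fun r => r⁻¹) ‖x‖ := by
    rw [← integral_indicator Metric.isOpen_ball.measurableSet]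
    congr 1; ext x; simp [Set.indicator]
  rw [e, h, volume_real_ball_plane]
  have e2 : ∫ y in Set.Ioi (0:ℝ), y ^ (Module.finrank ℝ Plane - 1) • (Set.Iio R).indicator (fun r => r⁻¹) y = R := by
    have : ∀ y ∈ Set.Ioi (0:ℝ), y ^ (Module.finrank ℝ Plane - 1) • (Set.Iio R).indicator (fun r => r⁻¹) y
        = (Set.Iio R).indicator (fun _ => (1:ℝ)) y := by
      intro y hy
      have hy' : y ≠ 0 := (ne_of_gt hy)
      by_cases hyR : y < R <;> simp [Set.indicator, hyR, hy']
    rw [setIntegral_congr_fun measurableSet_Ioi this, setIntegral_indicator measurableSet_Iio]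
    simp [Set.Ioi_inter_Iio, hR]
  rw [e2]; simp; ring

/-- The symbol of the sharp frequency cutoff. -/
def ballSymbol (R : ℝ) : Symbol where
  toFun := (Metric.ball (0 : Plane) R).indicator 1
  measurable := measurable_one.indicator Metric.isOpen_ball.measurableSet
  bound := 1
  le_bound := by
    intro ξ
    by_cases h : ξ ∈ Metric.ball (0 : Plane) R <;> simp [h]

lemma integrable_indicator_ball (R : ℝ) {F : Plane → ℂ} (hF : MemLp F 2 volume) :
    Integrable ((Metric.ball (0 : Plane) R).indicator F) := by
  rw [integrable_indicator_iff Metric.isOpen_ball.measurableSet]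
  exact hF.locallyIntegrable (by norm_num) |>.integrableOn_isCompact (isCompact_closedBall 0 R) |>.mono_set
    Metric.ball_subset_closedBall

lemma memLp_indicator_ball (R : ℝ) {F : Plane → ℂ} (hF : MemLp F 2 volume) :
    MemLp ((Metric.ball (0 : Plane) R).indicator F) 2 volume :=
  hF.indicator Metric.isOpen_ball.measurableSet

lemma ballSymbol_mul (R : ℝ) (F : L2) :
    (ballSymbol R).mul F = (memLp_indicator_ball R (Lp.memLp F)).toLp _ := by
  apply Lp.ext
  filter_upwards [(ballSymbol R).mul_ae F, (memLp_indicator_ball R (Lp.memLp F)).coeFn_toLp] with x h1 h2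
  rw [h1, h2]
  by_cases h : x ∈ Metric.ball (0 : Plane) R <;> simp [h, ballSymbol]

lemma ballSymbol_op_ae (R : ℝ) (f : L2) :
    (ballSymbol R).op f =ᵐ[volume] 𝓕⁻ ((Metric.ball (0 : Plane) R).indicator (𝓕 f : L2)) := by
  rw [Symbol.op_apply, ballSymbol_mul]
  exact fourierInv_toLp_ae_eq (integrable_indicator_ball R (Lp.memLp _)) _

/-- Low frequencies are bounded pointwise: the inversion integral is written with |ξ|^{-1/2} ·
|ξ|^{1/2}|f̂| and Cauchy–Schwarz applies, the integral of |ξ|⁻¹ over the ball being 2πR. Only the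
Ḣ^{1/2} size κ enters. -/
lemma norm_ballSymbol_op_le (f : L2) {κ R : ℝ} (hR : 0 ≤ R)
    (hint : Integrable (fun ξ : Plane => ‖ξ‖ * ‖(𝓕 f : L2) ξ‖ ^ 2))
    (hκ : ∫ ξ : Plane, ‖ξ‖ * ‖(𝓕 f : L2) ξ‖ ^ 2 ≤ κ) :
    ∀ᵐ x : Plane, ‖(ballSymbol R).op f x‖ ≤ √(2 * Real.pi * R * κ) := by
  filter_upwards [ballSymbol_op_ae R f] with x hx
  rw [hx]
  refine (norm_fourierInv_le x).trans ?_
  simp_rw [norm_indicator_eq_indicator_norm]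
  rw [integral_indicator Metric.isOpen_ball.measurableSet]
  have hm : AEStronglyMeasurable (fun ξ : Plane => √‖ξ‖ * ‖(𝓕 f : L2) ξ‖) volume :=
    (Real.continuous_sqrt.comp continuous_norm).aestronglyMeasurable.mul (Lp.aestronglyMeasurable _).norm
  have h1 : MemLp (fun ξ : Plane => √‖ξ‖ * ‖(𝓕 f : L2) ξ‖) 2 (volume.restrict (Metric.ball 0 R)) := by
    refine MemLp.restrict _ ((memLp_two_iff_integrable_sq hm).2 ?_)
    refine hint.congr (ae_of_all _ fun ξ => ?_)
    simp [mul_pow]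
  have hm2 : AEStronglyMeasurable (fun ξ : Plane => √(‖ξ‖⁻¹)) (volume.restrict (Metric.ball 0 R)) := by
    apply Measurable.aestronglyMeasurable; fun_prop
  have h2 : MemLp (fun ξ : Plane => √(‖ξ‖⁻¹)) 2 (volume.restrict (Metric.ball 0 R)) := by
    refine (memLp_two_iff_integrable_sq hm2).2 ?_
    refine (integrableOn_ball_inv_norm R).congr (ae_of_all _ fun ξ => ?_)
    show ‖ξ‖⁻¹ = √‖ξ‖⁻¹ ^ 2
    rw [Real.sq_sqrt (by positivity)]
  have cs := abs_integral_mul_le h2 h1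
  have e1 : ∫ ξ in Metric.ball (0:Plane) R, √(‖ξ‖⁻¹) ^ 2 = 2 * Real.pi * R := by
    rw [← integral_ball_inv_norm hR]
    congr 1; ext ξ; rw [Real.sq_sqrt (by positivity)]
  have e2 : ∫ ξ in Metric.ball (0:Plane) R, (√‖ξ‖ * ‖(𝓕 f : L2) ξ‖) ^ 2 ≤ κ := by
    have : ∀ ξ : Plane, (√‖ξ‖ * ‖(𝓕 f : L2) ξ‖) ^ 2 = ‖ξ‖ * ‖(𝓕 f : L2) ξ‖ ^ 2 := by
      intro ξ; rw [mul_pow, Real.sq_sqrt (norm_nonneg _)]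
    simp_rw [this]
    exact (setIntegral_le_integral hint (ae_of_all _ fun ξ => by positivity)).trans hκ
  have e3 : ∫ ξ in Metric.ball (0:Plane) R, √(‖ξ‖⁻¹) * (√‖ξ‖ * ‖(𝓕 f : L2) ξ‖)
      = ∫ ξ in Metric.ball (0:Plane) R, ‖(𝓕 f : L2) ξ‖ := by
    apply integral_congr_ae
    have h0 : ∀ᵐ ξ : Plane, ξ ≠ 0 := by
      simp [ae_iff]
    filter_upwards [ae_restrict_of_ae h0] with ξ hξ
    have : 0 < ‖ξ‖ := norm_pos_iff.2 hξ
    rw [← mul_assoc, ← Real.sqrt_mul (by positivity), inv_mul_cancel₀ this.ne']; simp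
  rw [e3, e1] at cs
  refine (le_abs_self _).trans (cs.trans ?_)
  rw [← Real.sqrt_mul (by positivity)]
  apply Real.sqrt_le_sqrt
  exact mul_le_mul_of_nonneg_left e2 (by positivity)

lemma norm_fourier_sub_ballSymbol_op (R : ℝ) (f : L2) :
    ∀ᵐ ξ : Plane, ‖(𝓕 (f - (ballSymbol R).op f) : L2) ξ‖ₑ = (Metric.ball (0 : Plane) R)ᶜ.indicator (fun ξ => ‖(𝓕 f : L2) ξ‖ₑ) ξ := by
  have : 𝓕 (f - (ballSymbol R).op f) = 𝓕 f - (ballSymbol R).mul (𝓕 f) := by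
    rw [← Symbol.fourier_op]; exact (Lp.fourierTransformₗᵢ Plane ℂ).map_sub _ _
  rw [this]
  filter_upwards [Lp.coeFn_sub (𝓕 f) ((ballSymbol R).mul (𝓕 f)), (ballSymbol R).mul_ae (𝓕 f)] with ξ h1 h2
  rw [h1, Pi.sub_apply, h2]
  by_cases h : ξ ∈ Metric.ball (0 : Plane) R
  · have h' : ξ ∉ (Metric.ball (0 : Plane) R)ᶜ := by simpa using h
    rw [Set.indicator_of_notMem h']
    simp [ballSymbol, Set.indicator_of_mem h]
  · have h' : ξ ∈ (Metric.ball (0 : Plane) R)ᶜ := h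
    rw [Set.indicator_of_mem h']
    simp [ballSymbol, Set.indicator_of_notMem h]

lemma lintegral_enorm_sq_lp (f : L2) : ∫⁻ x, ‖f x‖ₑ ^ 2 = ‖f‖ₑ ^ 2 := by
  have := eLpNorm_nnreal_pow_eq_lintegral (f := f) (μ := volume) (p := 2) two_ne_zero
  rw [Lp.enorm_def]
  simpa using this.symm

lemma lintegral_enorm_sq_fourier (f : L2) : ∫⁻ x, ‖(𝓕 f : L2) x‖ₑ ^ 2 = ∫⁻ x, ‖f x‖ₑ ^ 2 := by
  rw [lintegral_enorm_sq_lp, lintegral_enorm_sq_lp]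
  congr 1
  rw [← ofReal_norm, ← ofReal_norm, Lp.norm_fourier_eq]

/-- The radius makes the bound of `norm_ballSymbol_op_le` equal to t/2. Where |f| > t the
high-frequency part is thus at least t/2, and Chebyshev's inequality with Plancherel gives the
estimate. -/
lemma meas_lt_norm_le (f : L2) {κ t : ℝ} (hκ0 : 0 < κ) (ht : 0 < t)
    (hint : Integrable (fun ξ : Plane => ‖ξ‖ * ‖(𝓕 f : L2) ξ‖ ^ 2))
    (hκ : ∫ ξ : Plane, ‖ξ‖ * ‖(𝓕 f : L2) ξ‖ ^ 2 ≤ κ) :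
    volume {x : Plane | t < ‖f x‖} ≤ ENNReal.ofReal (4 / t ^ 2) *
      ∫⁻ ξ, (Metric.ball (0 : Plane) (t ^ 2 / (8 * Real.pi * κ)))ᶜ.indicator (fun ξ => ‖(𝓕 f : L2) ξ‖ₑ ^ 2) ξ := by
  set R := t ^ 2 / (8 * Real.pi * κ)
  have hpi := Real.pi_pos
  have hb := norm_ballSymbol_op_le f (R := R) (by positivity) hint hκ
  have hRe : √(2 * Real.pi * R * κ) = t / 2 := by
    have : 2 * Real.pi * R * κ = (t / 2) ^ 2 := by
      simp only [R]; field_simp; norm_num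
    rw [this, Real.sqrt_sq (by positivity)]
  rw [hRe] at hb
  set d := f - (ballSymbol R).op f
  have h1 : volume {x : Plane | t < ‖f x‖} ≤ volume {x : Plane | ENNReal.ofReal ((t / 2) ^ 2) ≤ ‖d x‖ₑ ^ 2} := by
    apply measure_mono_ae
    filter_upwards [hb, Lp.coeFn_sub f ((ballSymbol R).op f)] with x h2 h3 h4
    change t < ‖f x‖ at h4
    change ENNReal.ofReal ((t / 2) ^ 2) ≤ ‖d x‖ₑ ^ 2
    have h5 : d x = f x - (ballSymbol R).op f x := h3
    have h6 : t / 2 ≤ ‖d x‖ := by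
      rw [h5]
      have := norm_sub_norm_le (f x) ((ballSymbol R).op f x)
      linarith
    rw [← ofReal_norm, ← ENNReal.ofReal_pow (norm_nonneg _)]
    exact ENNReal.ofReal_le_ofReal (by gcongr)
  have h2 := mul_meas_ge_le_lintegral₀ (μ := volume) ((Lp.aestronglyMeasurable d).enorm.pow_const 2)
    (ENNReal.ofReal ((t / 2) ^ 2))
  have h3 : ∫⁻ x, ‖d x‖ₑ ^ 2 = ∫⁻ ξ, (Metric.ball (0 : Plane) R)ᶜ.indicator (fun ξ => ‖(𝓕 f : L2) ξ‖ₑ ^ 2) ξ := by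
    rw [← lintegral_enorm_sq_fourier]
    apply lintegral_congr_ae
    filter_upwards [norm_fourier_sub_ballSymbol_op R f] with ξ hξ
    simp only [d]
    rw [hξ]
    by_cases h : ξ ∈ (Metric.ball (0 : Plane) R)ᶜ
    · rw [Set.indicator_of_mem h, Set.indicator_of_mem h]
    · rw [Set.indicator_of_notMem h, Set.indicator_of_notMem h]; simp
  rw [h3] at h2
  refine h1.trans ?_
  have hpos : ENNReal.ofReal ((t / 2) ^ 2) ≠ 0 := by simp; positivity
  have e4 : ENNReal.ofReal (4 / t ^ 2) = (ENNReal.ofReal ((t / 2) ^ 2))⁻¹ := by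
    rw [← ENNReal.ofReal_inv_of_pos (by positivity)]
    congr 1; field_simp; norm_num
  rw [e4]
  rw [mul_comm, ← div_eq_mul_inv, ENNReal.le_div_iff_mul_le (Or.inl hpos) (Or.inl ENNReal.ofReal_ne_top), mul_comm]
  exact h2

/-- Layer cake: the level set at height t is controlled by the frequencies with t² ≤ c|ξ|, where c =
8πκ. After exchanging the integrals, t runs up to √(c|ξ|), and ∫ 4t dt = 2c|ξ| reproduces the
Ḣ^{1/2} norm. -/
lemma lintegral_enorm_four_le_of_pos (f : L2) {κ : ℝ} (hκ0 : 0 < κ)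
    (hint : Integrable (fun ξ : Plane => ‖ξ‖ * ‖(𝓕 f : L2) ξ‖ ^ 2))
    (hκ : ∫ ξ : Plane, ‖ξ‖ * ‖(𝓕 f : L2) ξ‖ ^ 2 ≤ κ) :
    ∫⁻ x, ‖f x‖ₑ ^ 4 ≤ ENNReal.ofReal (64 * Real.pi * κ ^ 2) := by
  have hpi := Real.pi_pos
  set c := 8 * Real.pi * κ with hc
  have hc0 : 0 < c := by positivity
  have e0 : ∫⁻ x, ‖f x‖ₑ ^ 4 = ∫⁻ x, ENNReal.ofReal (‖f x‖ ^ (4:ℝ)) := by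
    congr 1; ext x
    rw [← ofReal_norm, ← ENNReal.ofReal_pow (norm_nonneg _)]
    congr 1; norm_cast
  rw [e0, lintegral_rpow_eq_lintegral_meas_lt_mul volume (ae_of_all _ fun x => norm_nonneg _)
    (Lp.aestronglyMeasurable f).norm.aemeasurable (by norm_num)]
  -- A measurable representative of |f̂| makes the integrand jointly measurable in (t, ξ), as
  -- Tonelli's theorem requires.
  let F : Plane → ℝ≥0∞ := (Lp.aestronglyMeasurable (𝓕 f : L2)).enorm.mk _
  have hFm : Measurable F := AEMeasurable.measurable_mk _
  have hFae : (fun ξ => ‖(𝓕 f : L2) ξ‖ₑ) =ᵐ[volume] F := AEMeasurable.ae_eq_mk _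
  let T : ℝ × Plane → ℝ≥0∞ := fun p => ENNReal.ofReal (4 * p.1) * ({q : ℝ × Plane | q.1 ^ 2 ≤ c * ‖q.2‖}.indicator (fun q => F q.2 ^ 2) p)
  have hT : Measurable T := by
    apply Measurable.mul (by fun_prop)
    apply Measurable.indicator (by fun_prop)
    exact measurableSet_le (by fun_prop) (by fun_prop)
  have b1 : ∫⁻ t in Set.Ioi (0:ℝ), volume {x : Plane | t < ‖f x‖} * ENNReal.ofReal (t ^ ((4:ℝ) - 1))
      ≤ ∫⁻ t in Set.Ioi (0:ℝ), ∫⁻ ξ, T (t, ξ) := by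
    apply setLIntegral_mono' measurableSet_Ioi
    intro t ht
    have ht' : 0 < t := ht
    refine (mul_le_mul_left (meas_lt_norm_le f hκ0 ht hint hκ) _).trans ?_
    rw [mul_right_comm, ← ENNReal.ofReal_mul (by positivity), ← lintegral_const_mul' _ _ ENNReal.ofReal_ne_top]
    apply le_of_eq
    apply lintegral_congr_ae
    filter_upwards [hFae] with ξ hξ
    have e : 4 / t ^ 2 * t ^ ((4:ℝ) - 1) = 4 * t := by
      have : (4:ℝ) - 1 = (3:ℕ) := by norm_num
      rw [this, Real.rpow_natCast]; field_simp
    rw [e]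
    simp only [T]
    congr 1
    have hiff : ξ ∈ (Metric.ball (0 : Plane) (t ^ 2 / c))ᶜ ↔ (t, ξ) ∈ {q : ℝ × Plane | q.1 ^ 2 ≤ c * ‖q.2‖} := by
      simp only [Set.mem_compl_iff, Metric.mem_ball, dist_zero_right, not_lt, Set.mem_ofPred_eq]
      rw [div_le_iff₀ hc0, mul_comm]
    by_cases h : ξ ∈ (Metric.ball (0 : Plane) (t ^ 2 / c))ᶜ
    · rw [Set.indicator_of_mem h, Set.indicator_of_mem (hiff.1 h), hξ]
    · rw [Set.indicator_of_notMem h, Set.indicator_of_notMem (fun h' => h (hiff.2 h'))]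
  have b2 : ∫⁻ t in Set.Ioi (0:ℝ), ∫⁻ ξ, T (t, ξ) = ∫⁻ ξ, ∫⁻ t in Set.Ioi (0:ℝ), T (t, ξ) :=
    lintegral_lintegral_swap hT.aemeasurable
  have b3 : ∀ ξ : Plane, ∫⁻ t in Set.Ioi (0:ℝ), T (t, ξ) = ENNReal.ofReal (2 * c) * (ENNReal.ofReal ‖ξ‖ * F ξ ^ 2) := by
    intro ξ
    have e : ∀ t ∈ Set.Ioi (0:ℝ), T (t, ξ) = (Set.Iic √(c * ‖ξ‖)).indicator (fun t => ENNReal.ofReal (4 * t) * F ξ ^ 2) t := by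
      intro t ht
      have ht' : 0 < t := ht
      simp only [T, Set.indicator, Set.mem_ofPred_eq, Set.mem_Iic]
      have : t ^ 2 ≤ c * ‖ξ‖ ↔ t ≤ √(c * ‖ξ‖) := (Real.le_sqrt' ht').symm
      simp only [this]
      split_ifs <;> simp
    rw [setLIntegral_congr_fun measurableSet_Ioi e, setLIntegral_indicator measurableSet_Iic,
      lintegral_mul_const _ (by fun_prop), Set.inter_comm, Set.Ioi_inter_Iic, ← mul_assoc]
    congr 1
    have hs : 0 ≤ √(c * ‖ξ‖) := Real.sqrt_nonneg _
    rw [← ofReal_integral_eq_lintegral_ofReal, ← intervalIntegral.integral_of_le hs]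
    · rw [← ENNReal.ofReal_mul (by positivity)]
      congr 1
      rw [intervalIntegral.integral_const_mul, integral_id, Real.sq_sqrt (by positivity)]; ring
    · exact (Continuous.integrableOn_Ioc (by fun_prop))
    · filter_upwards [ae_restrict_mem measurableSet_Ioc] with t ht
      have := ht.1
      simp; linarith
  simp_rw [b3] at b2
  have b4 : ∫⁻ ξ : Plane, ENNReal.ofReal (2 * c) * (ENNReal.ofReal ‖ξ‖ * F ξ ^ 2) ≤ ENNReal.ofReal (2 * c * κ) := by
    rw [lintegral_const_mul _ (by fun_prop), ENNReal.ofReal_mul (p := 2 * c) (q := κ) (by positivity)]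
    refine mul_le_mul' le_rfl ?_
    have : ∫⁻ ξ : Plane, ENNReal.ofReal ‖ξ‖ * F ξ ^ 2 = ENNReal.ofReal (∫ ξ : Plane, ‖ξ‖ * ‖(𝓕 f : L2) ξ‖ ^ 2) := by
      rw [ofReal_integral_eq_lintegral_ofReal hint (ae_of_all _ fun ξ => by positivity)]
      apply lintegral_congr_ae
      filter_upwards [hFae] with ξ hξ
      rw [← hξ, ENNReal.ofReal_mul (norm_nonneg _), ← ofReal_norm, ENNReal.ofReal_pow (norm_nonneg _)]
    rw [this]
    exact ENNReal.ofReal_le_ofReal hκ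
  calc _ ≤ ENNReal.ofReal 4 * ENNReal.ofReal (2 * c * κ) := by
        gcongr; exact b1.trans (b2.le.trans b4)
    _ = _ := by
        rw [← ENNReal.ofReal_mul (by norm_num), hc]; congr 1; ring

/-- The critical embedding of the homogeneous Sobolev space of order `1/2` in `L⁴`. -/
theorem lintegral_enorm_four_le (f : L2)
    (hint : Integrable (fun ξ : Plane => ‖ξ‖ * ‖(𝓕 f : L2) ξ‖ ^ 2)) :
    ∫⁻ x, ‖f x‖ₑ ^ 4 ≤ ENNReal.ofReal (64 * Real.pi * (∫ ξ : Plane, ‖ξ‖ * ‖(𝓕 f : L2) ξ‖ ^ 2) ^ 2) := by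
  set k := ∫ ξ : Plane, ‖ξ‖ * ‖(𝓕 f : L2) ξ‖ ^ 2 with hk
  have hk0 : 0 ≤ k := integral_nonneg fun ξ => by positivity
  -- The previous bound needs κ > 0; taking κ = k + δ with δ → 0⁺ covers k = 0.
  have lim : Tendsto (fun δ : ℝ => ENNReal.ofReal (64 * Real.pi * (k + δ) ^ 2)) (𝓝[>] 0)
      (𝓝 (ENNReal.ofReal (64 * Real.pi * (k + 0) ^ 2))) := by
    have : Continuous fun δ : ℝ => ENNReal.ofReal (64 * Real.pi * (k + δ) ^ 2) :=
      ENNReal.continuous_ofReal.comp (by fun_prop)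
    exact (this.tendsto 0).mono_left nhdsWithin_le_nhds
  rw [add_zero] at lim
  refine ge_of_tendsto lim ?_
  filter_upwards [self_mem_nhdsWithin] with δ hδ
  have : (0:ℝ) < δ := hδ
  exact lintegral_enorm_four_le_of_pos f (by linarith) hint (by linarith)


/-! ### Functions in H¹, their densities and the L⁴ inequality -/

namespace H1

lemma lp_ae (u : H1) : u.lp =ᵐ[volume] u.toFun := u.memLp.coeFn_toLp

lemma glp_ae (u : H1) (i : Fin 2) : u.glp i =ᵐ[volume] u.grad i := (u.memLp_grad i).coeFn_toLp

lemma mass_eq (u : H1) : u.mass = ‖u.lp‖ ^ 2 := (norm_sq_toLp u.memLp).symm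

lemma dirichlet_eq (u : H1) : u.dirichlet = ∑ i, ‖u.glp i‖ ^ 2 := by
  unfold dirichlet
  rw [integral_finsetSum _ fun i _ => integrable_norm_sq (u.memLp_grad i)]
  exact Finset.sum_congr rfl fun i _ => (norm_sq_toLp (u.memLp_grad i)).symm

lemma mass_nonneg (u : H1) : 0 ≤ u.mass := integral_nonneg fun x => by positivity

lemma dirichlet_nonneg (u : H1) : 0 ≤ u.dirichlet := by rw [dirichlet_eq]; positivity

lemma quartic_nonneg (u : H1) : 0 ≤ u.quartic := integral_nonneg fun x => by positivity

lemma fourier_glp_norm_sq (u : H1) (i : Fin 2) :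
    (fun ξ => ‖(𝓕 (u.glp i) : L2) ξ‖ ^ 2) =ᵐ[volume]
      fun ξ => 4 * Real.pi ^ 2 * (ξ i) ^ 2 * ‖(𝓕 u.lp : L2) ξ‖ ^ 2 := by
  filter_upwards [u.fourier_glp i] with ξ hξ
  rw [hξ]
  simp only [norm_mul, Complex.norm_real, Complex.norm_I, mul_pow, Real.norm_eq_abs, sq_abs, mul_one,
    abs_two]
  ring

lemma integrable_norm_sq_mul (u : H1) :
    Integrable (fun ξ : Plane => ‖ξ‖ ^ 2 * ‖(𝓕 u.lp : L2) ξ‖ ^ 2) := by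
  have h : ∀ i, Integrable (fun ξ : Plane => 4 * Real.pi ^ 2 * (ξ i) ^ 2 * ‖(𝓕 u.lp : L2) ξ‖ ^ 2) := fun i =>
    (integrable_norm_sq (Lp.memLp (𝓕 (u.glp i) : L2))).congr (u.fourier_glp_norm_sq i)
  refine (((h 0).add (h 1)).const_mul (1 / (4 * Real.pi ^ 2))).congr (ae_of_all _ fun ξ => ?_)
  have := Real.pi_pos
  simp only [Pi.add_apply, EuclideanSpace.norm_sq_eq, Fin.sum_univ_two, Real.norm_eq_abs, sq_abs]
  field_simp

lemma dirichlet_eq_integral (u : H1) :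
    u.dirichlet = 4 * Real.pi ^ 2 * ∫ ξ : Plane, ‖ξ‖ ^ 2 * ‖(𝓕 u.lp : L2) ξ‖ ^ 2 := by
  rw [dirichlet_eq]
  simp_rw [← integral_norm_sq_fourier]
  rw [← integral_finsetSum _ fun i _ => integrable_norm_sq (Lp.memLp (𝓕 (u.glp i) : L2)), ← integral_const_mul]
  apply integral_congr_ae
  filter_upwards [u.fourier_glp_norm_sq 0, u.fourier_glp_norm_sq 1] with ξ h0 h1
  rw [Fin.sum_univ_two, h0, h1]
  simp only [EuclideanSpace.norm_sq_eq, Fin.sum_univ_two, Real.norm_eq_abs, sq_abs]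
  ring

lemma memLp_norm_mul (u : H1) : MemLp (fun ξ : Plane => ‖ξ‖ * ‖(𝓕 u.lp : L2) ξ‖) 2 volume := by
  refine (memLp_two_iff_integrable_sq ?_).2 ?_
  · exact continuous_norm.aestronglyMeasurable.mul (Lp.aestronglyMeasurable _).norm
  · refine u.integrable_norm_sq_mul.congr (ae_of_all _ fun ξ => ?_)
    simp [mul_pow]

lemma integrable_norm_mul (u : H1) :
    Integrable (fun ξ : Plane => ‖ξ‖ * ‖(𝓕 u.lp : L2) ξ‖ ^ 2) := by
  refine (u.memLp_norm_mul.integrable_mul (Lp.memLp (𝓕 u.lp : L2)).norm).congr (ae_of_all _ fun ξ => ?_)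
  simp; ring

/-- Cauchy–Schwarz for |ξ||û| and |û|: the Ḣ^{1/2} norm is interpolated between Ḣ¹ and L². -/
lemma integral_norm_mul_le (u : H1) :
    (2 * Real.pi * ∫ ξ : Plane, ‖ξ‖ * ‖(𝓕 u.lp : L2) ξ‖ ^ 2) ^ 2 ≤ u.dirichlet * u.mass := by
  have cs := abs_integral_mul_le u.memLp_norm_mul (Lp.memLp (𝓕 u.lp : L2)).norm
  have e1 : ∫ ξ : Plane, ‖ξ‖ * ‖(𝓕 u.lp : L2) ξ‖ * ‖(𝓕 u.lp : L2) ξ‖ = ∫ ξ : Plane, ‖ξ‖ * ‖(𝓕 u.lp : L2) ξ‖ ^ 2 := by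
    congr 1; ext ξ; ring
  rw [e1] at cs
  simp_rw [mul_pow] at cs
  have hpi := Real.pi_pos
  set A := ∫ ξ : Plane, ‖ξ‖ ^ 2 * ‖(𝓕 u.lp : L2) ξ‖ ^ 2 with hA
  have hA0 : 0 ≤ A := integral_nonneg fun ξ => by positivity
  rw [u.dirichlet_eq_integral, u.mass_eq, ← integral_norm_sq_fourier]
  set B := ∫ ξ : Plane, ‖(𝓕 u.lp : L2) ξ‖ ^ 2
  have hB0 : 0 ≤ B := integral_nonneg fun ξ => by positivity
  have := pow_le_pow_left₀ (abs_nonneg _) cs 2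
  rw [sq_abs, mul_pow, Real.sq_sqrt hA0, Real.sq_sqrt hB0] at this
  calc _ = 4 * Real.pi ^ 2 * (∫ ξ : Plane, ‖ξ‖ * ‖(𝓕 u.lp : L2) ξ‖ ^ 2) ^ 2 := by ring
    _ ≤ 4 * Real.pi ^ 2 * (A * B) := by gcongr
    _ = _ := by ring

/-- The embedding gives 64πI² with I the Ḣ^{1/2} integral, and (2πI)² is bounded by the Dirichlet
energy times the mass. What remains is 16/π, rounded up to 6; no sharpness is needed. -/
lemma lintegral_enorm_four_le (u : H1) :
    ∫⁻ x, ‖u.toFun x‖ₑ ^ 4 ≤ ENNReal.ofReal (6 * (u.dirichlet * u.mass)) := by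
  have h1 : ∫⁻ x, ‖u.toFun x‖ₑ ^ 4 = ∫⁻ x, ‖u.lp x‖ₑ ^ 4 := by
    apply lintegral_congr_ae
    filter_upwards [u.lp_ae] with x hx
    rw [hx]
  rw [h1]
  refine (Dipolar.lintegral_enorm_four_le u.lp u.integrable_norm_mul).trans (ENNReal.ofReal_le_ofReal ?_)
  have h2 := u.integral_norm_mul_le
  set I := ∫ ξ : Plane, ‖ξ‖ * ‖(𝓕 u.lp : L2) ξ‖ ^ 2
  have hpi : 3 < Real.pi := Real.pi_gt_three
  have h3 : 64 * Real.pi * I ^ 2 = 16 / Real.pi * (2 * Real.pi * I) ^ 2 := by field_simp; ring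
  rw [h3]
  have h4 : 16 / Real.pi ≤ 6 := by rw [div_le_iff₀ (by linarith)]; linarith
  calc _ ≤ 6 * (2 * Real.pi * I) ^ 2 := by gcongr
    _ ≤ _ := by gcongr

lemma memLp_four (u : H1) : MemLp u.toFun 4 volume := by
  refine ⟨u.memLp.1, ?_⟩
  have h := eLpNorm_nnreal_pow_eq_lintegral (f := u.toFun) (μ := volume) (p := 4) (by norm_num)
  have h2 : eLpNorm u.toFun ((4 : NNReal) : ℝ≥0∞) volume ^ ((4 : NNReal) : ℝ) < ⊤ := by
    rw [h]
    have : ∀ x, ‖u.toFun x‖ₑ ^ ((4 : NNReal) : ℝ) = ‖u.toFun x‖ₑ ^ 4 := by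
      intro x; exact ENNReal.rpow_natCast _ 4
    simp_rw [this]
    exact u.lintegral_enorm_four_le.trans_lt ENNReal.ofReal_lt_top
  have h3 := (ENNReal.rpow_lt_top_iff_of_pos (by norm_num)).1 h2
  exact_mod_cast h3

lemma integrable_pow_four (u : H1) : Integrable (fun x => ‖u.toFun x‖ ^ 4) := by
  exact_mod_cast u.memLp_four.integrable_norm_pow (by norm_num)

theorem quartic_le (u : H1) : u.quartic ≤ 6 * (u.dirichlet * u.mass) := by
  have h := u.lintegral_enorm_four_le
  have e : ∫⁻ x, ‖u.toFun x‖ₑ ^ 4 = ENNReal.ofReal u.quartic := by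
    unfold quartic
    rw [ofReal_integral_eq_lintegral_ofReal u.integrable_pow_four (ae_of_all _ fun x => by positivity)]
    congr 1; ext x
    rw [← ofReal_norm, ENNReal.ofReal_pow (norm_nonneg _)]
  rw [e] at h
  exact (ENNReal.ofReal_le_ofReal_iff (by have := u.mass_nonneg; have := u.dirichlet_nonneg; positivity)).1 h

lemma integrable_density (u : H1) : Integrable u.density := integrable_norm_sq u.memLp

lemma memLp_density (u : H1) : MemLp u.density 2 volume := by
  refine (memLp_two_iff_integrable_sq u.integrable_density.1).2 ?_
  refine u.integrable_pow_four.congr (ae_of_all _ fun x => ?_)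
  simp only [density]; ring

/-- The density as an element of the complex `L²`. -/
def densLp (u : H1) : L2 := u.memLp_density.ofReal.toLp (fun x => (u.density x : ℂ))

lemma densLp_ae (u : H1) : u.densLp =ᵐ[volume] fun x => (u.density x : ℂ) :=
  u.memLp_density.ofReal.coeFn_toLp

lemma norm_sq_densLp (u : H1) : ‖u.densLp‖ ^ 2 = u.quartic := by
  rw [densLp, norm_sq_toLp]
  unfold quartic density
  congr 1; ext x
  simp; ring

lemma integrable_density_complex (u : H1) : Integrable (fun x => (u.density x : ℂ)) :=
  u.integrable_density.ofReal

lemma fourier_densLp_ae (u : H1) : (𝓕 u.densLp : L2) =ᵐ[volume] 𝓕 (fun x => (u.density x : ℂ)) :=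
  fourier_toLp_ae_eq u.integrable_density_complex _

/-- This uniform bound controls the low frequencies when two symbols are compared. -/
lemma norm_fourier_density_le (u : H1) (ξ : Plane) : ‖𝓕 (fun x => (u.density x : ℂ)) ξ‖ ≤ u.mass := by
  refine (norm_fourier_le ξ).trans (le_of_eq ?_)
  simp [mass, density]

/-! ### Operations on Sobolev functions -/

/-- The difference of two Sobolev functions. -/
def sub (u v : H1) : H1 where
  toFun x := u.toFun x - v.toFun x
  grad i x := u.grad i x - v.grad i x
  memLp := u.memLp.sub v.memLp
  memLp_grad i := (u.memLp_grad i).sub (v.memLp_grad i)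
  isWeakPartial i := by
    intro φ hφ
    simp_rw [smul_sub]
    rw [integral_sub ((hφ.pderiv i).integrable_smul u.memLp) ((hφ.pderiv i).integrable_smul v.memLp),
      integral_sub (hφ.integrable_smul (u.memLp_grad i)) (hφ.integrable_smul (v.memLp_grad i)),
      u.isWeakPartial i φ hφ, v.isWeakPartial i φ hφ]
    ring

lemma sub_lp (u v : H1) : (u.sub v).lp = u.lp - v.lp := MemLp.toLp_sub u.memLp v.memLp

lemma sub_glp (u v : H1) (i : Fin 2) : (u.sub v).glp i = u.glp i - v.glp i :=
  MemLp.toLp_sub (u.memLp_grad i) (v.memLp_grad i)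

lemma _root_.Dipolar.IsTest.memLp_smul {φ : Plane → ℝ} (h : IsTest φ) {u : Plane → ℂ} (hu : MemLp u 2 volume) :
    MemLp (fun x => φ x • u x) 2 volume := by
  obtain ⟨C, hC0, hC⟩ := h.exists_bound
  refine hu.of_le_mul (c := C) (h.continuous.aestronglyMeasurable.smul hu.1) (ae_of_all _ fun x => ?_)
  rw [norm_smul]
  exact mul_le_mul_of_nonneg_right (hC x) (norm_nonneg _)

/-- The product of a Sobolev function and a test function. -/
def mulTest (u : H1) (χ : Plane → ℝ) (hχ : IsTest χ) : H1 where
  toFun x := χ x • u.toFun x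
  grad i x := χ x • u.grad i x + pderiv i χ x • u.toFun x
  memLp := hχ.memLp_smul u.memLp
  memLp_grad i := (hχ.memLp_smul (u.memLp_grad i)).add ((hχ.pderiv i).memLp_smul u.memLp)
  isWeakPartial i := by
    intro φ hφ
    have h := u.isWeakPartial i _ (hφ.mul hχ.1)
    have e : ∀ x, pderiv i (fun x => φ x * χ x) x • u.toFun x
        = pderiv i φ x • (χ x • u.toFun x) + φ x • (pderiv i χ x • u.toFun x) := by
      intro x
      rw [pderiv_mul hφ.differentiable hχ.differentiable, add_smul, smul_smul, smul_smul,
        add_comm, mul_comm (χ x)]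
    simp_rw [e] at h
    rw [integral_add ((hφ.pderiv i).integrable_smul (hχ.memLp_smul u.memLp))
      (hφ.integrable_smul ((hχ.pderiv i).memLp_smul u.memLp))] at h
    simp_rw [smul_add]
    rw [integral_add (hφ.integrable_smul (hχ.memLp_smul (u.memLp_grad i)))
      (hφ.integrable_smul ((hχ.pderiv i).memLp_smul u.memLp))]
    simp_rw [mul_smul] at h
    rw [neg_add, ← h]; ring

end H1

/-! ### Diagonal changes of variables and their action on the functionals -/

/-- The diagonal linear equivalence with nonzero entries. -/
def diagEquiv (s : Fin 2 → ℝ) (hs : ∀ i, 0 < s i) : Plane ≃L[ℝ] Plane :=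
  LinearEquiv.toContinuousLinearEquiv
    { toFun := fun x => WithLp.toLp 2 fun i => s i * x i
      invFun := fun x => WithLp.toLp 2 fun i => (s i)⁻¹ * x i
      map_add' := by intro x y; ext i; simp [mul_add]
      map_smul' := by intro c x; ext i; simp; ring
      left_inv := by intro x; ext i; simp [(hs i).ne']
      right_inv := by intro x; ext i; simp [(hs i).ne'] }

lemma diagEquiv_apply (s : Fin 2 → ℝ) (hs : ∀ i, 0 < s i) (x : Plane) (i : Fin 2) :
    diagEquiv s hs x i = s i * x i := rfl

lemma diagEquiv_symm_apply (s : Fin 2 → ℝ) (hs : ∀ i, 0 < s i) (x : Plane) (i : Fin 2) :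
    (diagEquiv s hs).symm x i = (s i)⁻¹ * x i := rfl

lemma det_diagEquiv (s : Fin 2 → ℝ) (hs : ∀ i, 0 < s i) :
    LinearMap.det ((diagEquiv s hs).toLinearEquiv : Plane →ₗ[ℝ] Plane) = s 0 * s 1 := by
  rw [← LinearMap.det_toMatrix (EuclideanSpace.basisFun (Fin 2) ℝ).toBasis, Matrix.det_fin_two]
  simp [LinearMap.toMatrix_apply, diagEquiv_apply]

lemma map_diagEquiv_add (s : Fin 2 → ℝ) (hs : ∀ i, 0 < s i) (y : Plane) :
    Measure.map (fun x => diagEquiv s hs x + y) (volume : Measure Plane)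
      = ENNReal.ofReal ((s 0 * s 1)⁻¹) • volume := by
  have h : (fun x => diagEquiv s hs x + y) = (fun x => x + y) ∘ (diagEquiv s hs) := rfl
  rw [h, ← Measure.map_map (by fun_prop) (diagEquiv s hs).continuous.measurable]
  have h2 := Measure.map_linearMap_addHaar_eq_smul_addHaar (volume : Measure Plane)
    (f := ((diagEquiv s hs).toLinearEquiv : Plane →ₗ[ℝ] Plane)) (by rw [det_diagEquiv]; have := hs 0; have := hs 1; positivity)
  rw [det_diagEquiv, abs_of_pos (by have := hs 0; have := hs 1; positivity)] at h2
  have h3 : ⇑(diagEquiv s hs) = ⇑((diagEquiv s hs).toLinearEquiv : Plane →ₗ[ℝ] Plane) := rfl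
  rw [h3, h2, Measure.map_smul, map_add_right_eq_self]

/-- The affine change of variables as a homeomorphism. -/
def diagAffine (s : Fin 2 → ℝ) (hs : ∀ i, 0 < s i) (y : Plane) : Plane ≃ₜ Plane :=
  (diagEquiv s hs).toHomeomorph.trans (Homeomorph.addRight y)

lemma diagAffine_apply (s : Fin 2 → ℝ) (hs : ∀ i, 0 < s i) (y x : Plane) :
    diagAffine s hs y x = diagEquiv s hs x + y := rfl

lemma diagAffine_symm_apply (s : Fin 2 → ℝ) (hs : ∀ i, 0 < s i) (y x : Plane) :
    (diagAffine s hs y).symm x = (diagEquiv s hs).symm (x - y) := by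
  rw [sub_eq_add_neg]; rfl

lemma integral_comp_diagAffine {E : Type*} [NormedAddCommGroup E] [NormedSpace ℝ E] (s : Fin 2 → ℝ)
    (hs : ∀ i, 0 < s i) (y : Plane) (f : Plane → E) :
    ∫ x, f (diagAffine s hs y x) = (s 0 * s 1)⁻¹ • ∫ x, f x := by
  have h := (diagAffine s hs y).measurableEmbedding.integral_map (μ := volume) f
  rw [← h]
  change ∫ x, f x ∂(Measure.map (fun x => diagEquiv s hs x + y) volume) = _
  rw [map_diagEquiv_add, integral_smul_measure, ENNReal.toReal_ofReal]
  have := hs 0; have := hs 1; positivity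

lemma memLp_comp_diagAffine {E : Type*} [NormedAddCommGroup E] (s : Fin 2 → ℝ)
    (hs : ∀ i, 0 < s i) (y : Plane) {f : Plane → E} {p : ℝ≥0∞} (hf : MemLp f p volume) :
    MemLp (fun x => f (diagAffine s hs y x)) p volume := by
  have h := ((diagAffine s hs y).measurableEmbedding.memLp_map_measure_iff (μ := volume) (g := f) (p := p))
  apply h.1
  change MemLp f p (Measure.map (fun x => diagEquiv s hs x + y) volume)
  rw [map_diagEquiv_add]
  exact hf.smul_measure ENNReal.ofReal_ne_top

lemma isTest_comp_diagAffine_symm (s : Fin 2 → ℝ) (hs : ∀ i, 0 < s i) (y : Plane) {φ : Plane → ℝ}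
    (h : IsTest φ) : IsTest (fun x => φ ((diagAffine s hs y).symm x)) := by
  refine ⟨h.1.comp ?_, h.2.comp_homeomorph (diagAffine s hs y).symm⟩
  have : ⇑(diagAffine s hs y).symm = fun x => (diagEquiv s hs).symm (x - y) := by
    ext1 x; exact diagAffine_symm_apply s hs y x
  rw [this]
  exact (diagEquiv s hs).symm.contDiff.comp (contDiff_id.sub contDiff_const)

lemma diagEquiv_symm_single (s : Fin 2 → ℝ) (hs : ∀ i, 0 < s i) (i : Fin 2) :
    (diagEquiv s hs).symm (EuclideanSpace.single i 1) = (s i)⁻¹ • EuclideanSpace.single i 1 := by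
  ext j
  rw [diagEquiv_symm_apply]
  fin_cases i <;> fin_cases j <;> simp

lemma pderiv_comp_diagAffine_symm (s : Fin 2 → ℝ) (hs : ∀ i, 0 < s i) (y : Plane) {φ : Plane → ℝ}
    (h : IsTest φ) (i : Fin 2) (x : Plane) :
    pderiv i (fun x => φ ((diagAffine s hs y).symm x)) x = (s i)⁻¹ * pderiv i φ ((diagAffine s hs y).symm x) := by
  unfold pderiv
  simp_rw [diagAffine_symm_apply]
  have h1 : HasFDerivAt (fun x => (diagEquiv s hs).symm (x - y)) ((diagEquiv s hs).symm : Plane →L[ℝ] Plane) x :=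
    (diagEquiv s hs).symm.hasFDerivAt.comp x (hasFDerivAt_sub_const y)
  have h2 := (h.differentiable ((diagEquiv s hs).symm (x - y))).hasFDerivAt.comp x h1
  have h3 : fderiv ℝ (fun x => φ ((diagEquiv s hs).symm (x - y))) x = _ := h2.fderiv
  rw [h3]
  simp only [ContinuousLinearMap.comp_apply, ContinuousLinearEquiv.coe_coe, diagEquiv_symm_single, map_smul, smul_eq_mul]

namespace H1

/-- The Sobolev function `x ↦ c u(s x + y)`, with a diagonal scaling `s`. -/
def rescale (u : H1) (c : ℝ) (s : Fin 2 → ℝ) (hs : ∀ i, 0 < s i) (y : Plane) : H1 where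
  toFun x := c • u.toFun (diagAffine s hs y x)
  grad i x := (c * s i) • u.grad i (diagAffine s hs y x)
  memLp := (memLp_comp_diagAffine s hs y u.memLp).const_smul c
  memLp_grad i := (memLp_comp_diagAffine s hs y (u.memLp_grad i)).const_smul (c * s i)
  isWeakPartial i := by
    intro φ hφ
    have h := u.isWeakPartial i _ (isTest_comp_diagAffine_symm s hs y hφ)
    have e1 : ∫ x, pderiv i φ x • c • u.toFun (diagAffine s hs y x)
        = (s 0 * s 1)⁻¹ • (c * s i) • ∫ x, pderiv i (fun x => φ ((diagAffine s hs y).symm x)) x • u.toFun x := by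
      rw [← integral_smul, ← integral_comp_diagAffine s hs y]
      congr 1; ext1 x
      rw [pderiv_comp_diagAffine_symm s hs y hφ, Homeomorph.symm_apply_apply]
      simp only [smul_smul]
      congr 1
      have := (hs i).ne'
      field_simp
    have e2 : ∫ x, φ x • (c * s i) • u.grad i (diagAffine s hs y x)
        = (s 0 * s 1)⁻¹ • (c * s i) • ∫ x, φ ((diagAffine s hs y).symm x) • u.grad i x := by
      rw [← integral_smul, ← integral_comp_diagAffine s hs y]
      congr 1; ext1 x
      rw [Homeomorph.symm_apply_apply]
      simp only [smul_smul]
      congr 1; ring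
    rw [e1, e2, h, smul_neg, smul_neg]

variable (u : H1) (c : ℝ) (s : Fin 2 → ℝ) (hs : ∀ i, 0 < s i) (y : Plane)

lemma rescale_mass : (u.rescale c s hs y).mass = c ^ 2 * (s 0 * s 1)⁻¹ * u.mass := by
  have h := integral_comp_diagAffine s hs y (fun x => ‖u.toFun x‖ ^ 2)
  unfold mass rescale
  simp_rw [norm_smul, mul_pow, Real.norm_eq_abs, sq_abs]
  rw [integral_const_mul, h, smul_eq_mul]; ring

lemma rescale_density (x : Plane) :
    (u.rescale c s hs y).density x = c ^ 2 * u.density (diagAffine s hs y x) := by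
  simp [density, rescale, mul_pow]

/-- In two dimensions the factor t² from the gradient cancels the Jacobian t⁻², so only the
amplitude is seen. -/
lemma rescale_dirichlet_iso (t : ℝ) (ht : 0 < t) :
    (u.rescale c (fun _ => t) (fun _ => ht) y).dirichlet = c ^ 2 * u.dirichlet := by
  have h := integral_comp_diagAffine (fun _ => t) (fun _ => ht) y (fun x => ∑ i, ‖u.grad i x‖ ^ 2)
  unfold dirichlet rescale
  simp_rw [norm_smul, mul_pow, ← Finset.mul_sum, Real.norm_eq_abs, sq_abs]
  rw [integral_const_mul, h, smul_eq_mul]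
  field_simp

/-- The translation contributes only a phase, which the norm discards; the diagonal map is symmetric
and acts on frequencies through its inverse. -/
lemma fourier_rescale_density (ξ : Plane) :
    ‖𝓕 (fun x => ((u.rescale c s hs y).density x : ℂ)) ξ‖
      = c ^ 2 * (s 0 * s 1)⁻¹ * ‖𝓕 (fun x => (u.density x : ℂ)) ((diagEquiv s hs).symm ξ)‖ := by
  have hadj : ∀ z, inner ℝ ((diagEquiv s hs).symm z) ξ = inner ℝ z ((diagEquiv s hs).symm ξ) := by
    intro z
    simp only [PiLp.inner_apply, diagEquiv_symm_apply]
    congr 1; ext i; simp; ring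
  have e : 𝓕 (fun x => ((u.rescale c s hs y).density x : ℂ)) ξ
      = ∫ x, (fun z => (Real.fourierChar (-inner ℝ ((diagEquiv s hs).symm (z - y)) ξ)) •
          (((c ^ 2 * u.density z : ℝ)) : ℂ)) (diagAffine s hs y x) := by
    rw [Real.fourier_eq]
    congr 1; ext1 x
    simp only [rescale_density, diagAffine_apply, add_sub_cancel_right, ContinuousLinearEquiv.symm_apply_apply]
  rw [e, integral_comp_diagAffine s hs y (fun z => (Real.fourierChar (-inner ℝ ((diagEquiv s hs).symm (z - y)) ξ)) •
          (((c ^ 2 * u.density z : ℝ)) : ℂ))]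
  have e2 : ∀ z, (Real.fourierChar (-inner ℝ ((diagEquiv s hs).symm (z - y)) ξ)) • (((c ^ 2 * u.density z : ℝ)) : ℂ)
      = (((c ^ 2 : ℝ) : ℂ) * (Real.fourierChar (inner ℝ ((diagEquiv s hs).symm y) ξ) : ℂ)) •
        ((Real.fourierChar (-inner ℝ z ((diagEquiv s hs).symm ξ))) • (u.density z : ℂ)) := by
    intro z
    rw [map_sub, inner_sub_left, hadj z, neg_sub, sub_eq_add_neg, AddChar.map_add_eq_mul]
    simp only [Circle.smul_def, Circle.coe_mul, smul_eq_mul]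
    push_cast; ring
  simp_rw [e2]
  rw [integral_smul, ← Real.fourier_eq, norm_smul, norm_smul, norm_mul,
    Circle.norm_coe, Complex.norm_real, mul_one, Real.norm_of_nonneg (sq_nonneg c),
    Real.norm_of_nonneg (inv_nonneg.2 (mul_pos (hs 0) (hs 1)).le)]
  ring

/-- Up to a factor, rescaling u amounts to composing the symbol with the diagonal map. Isotropic
dilations then fix symbols of degree zero, while anisotropic ones push them to their values on an
axis. -/
lemma quad_rescale (σ : Symbol) :
    σ.quad (u.rescale c s hs y).densLp = c ^ 4 * (s 0 * s 1)⁻¹ *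
      ∫ ξ, σ.toFun (diagEquiv s hs ξ) * ‖𝓕 (fun x => (u.density x : ℂ)) ξ‖ ^ 2 := by
  have h := integral_comp_diagAffine s hs 0 (fun ξ => σ.toFun ξ * ‖𝓕 (fun x => ((u.rescale c s hs y).density x : ℂ)) ξ‖ ^ 2)
  have e : σ.quad (u.rescale c s hs y).densLp = ∫ ξ, σ.toFun ξ * ‖𝓕 (fun x => ((u.rescale c s hs y).density x : ℂ)) ξ‖ ^ 2 := by
    rw [σ.quad_eq]
    apply integral_congr_ae
    filter_upwards [(u.rescale c s hs y).fourier_densLp_ae] with ξ hξ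
    rw [hξ]
  rw [e]
  have h0 := hs 0
  have h1 := hs 1
  have e3 : ∫ ξ, σ.toFun ξ * ‖𝓕 (fun x => ((u.rescale c s hs y).density x : ℂ)) ξ‖ ^ 2
      = (s 0 * s 1) * ∫ ξ, (fun ξ => σ.toFun ξ * ‖𝓕 (fun x => ((u.rescale c s hs y).density x : ℂ)) ξ‖ ^ 2) (diagAffine s hs 0 ξ) := by
    rw [h, smul_eq_mul, ← mul_assoc, mul_inv_cancel₀ (by positivity), one_mul]
  rw [e3, ← integral_const_mul, ← integral_const_mul]
  congr 1; ext ξ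
  simp only [fourier_rescale_density, diagAffine_apply, add_zero, ContinuousLinearEquiv.symm_apply_apply]
  field_simp

lemma quad_eq_fourier_density (σ : Symbol) :
    σ.quad u.densLp = ∫ ξ, σ.toFun ξ * ‖𝓕 (fun x => (u.density x : ℂ)) ξ‖ ^ 2 := by
  rw [σ.quad_eq]
  apply integral_congr_ae
  filter_upwards [u.fourier_densLp_ae] with ξ hξ
  rw [hξ]

end H1


/-! ### Fourier transforms of Gaussians -/

lemma integrable_gaussian {b : ℝ} (hb : 0 < b) : Integrable (fun x : Plane => Real.exp (-b * ‖x‖ ^ 2)) := by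
  have h := GaussianFourier.integrable_cexp_neg_mul_sq_norm_add (V := Plane) (b := b) (by simpa using hb) 0 0
  refine h.norm.congr (ae_of_all _ fun x => ?_)
  simp only [inner_zero_left, Complex.norm_exp]
  congr 1
  simp [← Complex.ofReal_pow]

lemma integral_gaussian_plane {b : ℝ} (hb : 0 < b) : ∫ x : Plane, Real.exp (-b * ‖x‖ ^ 2) = Real.pi / b := by
  have := GaussianFourier.integral_rexp_neg_mul_sq_norm (V := Plane) hb
  simpa using this

lemma norm_sq_mul_gaussian_le {b : ℝ} (hb : 0 < b) (x : Plane) :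
    ‖x‖ ^ 2 * Real.exp (-b * ‖x‖ ^ 2) ≤ 2 / b * Real.exp (-(b / 2) * ‖x‖ ^ 2) := by
  have h1 : b / 2 * ‖x‖ ^ 2 ≤ Real.exp (b / 2 * ‖x‖ ^ 2) := by
    linarith [Real.add_one_le_exp (b / 2 * ‖x‖ ^ 2)]
  have e : Real.exp (-b * ‖x‖ ^ 2) = Real.exp (-(b / 2) * ‖x‖ ^ 2) * Real.exp (-(b / 2) * ‖x‖ ^ 2) := by
    rw [← Real.exp_add]; congr 1; ring
  have e2 : Real.exp (b / 2 * ‖x‖ ^ 2) * Real.exp (-(b / 2) * ‖x‖ ^ 2) = 1 := by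
    rw [← Real.exp_add]; simp
  have hp := Real.exp_pos (-(b / 2) * ‖x‖ ^ 2)
  rw [e, ← mul_assoc]
  apply mul_le_mul_of_nonneg_right _ hp.le
  rw [le_div_iff₀ hb]
  nlinarith [mul_le_mul_of_nonneg_right h1 hp.le]

lemma integrable_norm_sq_mul_gaussian {b : ℝ} (hb : 0 < b) :
    Integrable (fun x : Plane => ‖x‖ ^ 2 * Real.exp (-b * ‖x‖ ^ 2)) := by
  refine ((integrable_gaussian (half_pos hb)).const_mul (2 / b)).mono' (by fun_prop) (ae_of_all _ fun x => ?_)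
  rw [Real.norm_of_nonneg (by positivity)]
  exact norm_sq_mul_gaussian_le hb x

lemma abs_apply_le (x : Plane) (i : Fin 2) : |x i| ≤ ‖x‖ := by
  simpa using PiLp.norm_apply_le x i

lemma sq_apply_le (x : Plane) (i : Fin 2) : (x i) ^ 2 ≤ ‖x‖ ^ 2 := by
  rw [← sq_abs]; exact pow_le_pow_left₀ (abs_nonneg _) (abs_apply_le x i) 2

lemma norm_sq_plane (x : Plane) : ‖x‖ ^ 2 = x 0 ^ 2 + x 1 ^ 2 := by
  simp [EuclideanSpace.norm_sq_eq, Fin.sum_univ_two]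

lemma fourier_const_mul (c : ℂ) (f : Plane → ℂ) (ξ : Plane) : 𝓕 (fun x => c * f x) ξ = c * 𝓕 f ξ := by
  rw [Real.fourier_eq, Real.fourier_eq, ← integral_const_mul]
  congr 1; ext x
  simp only [Circle.smul_def, smul_eq_mul]; ring

lemma fourier_add_apply {f g : Plane → ℂ} (hf : Integrable f) (hg : Integrable g) (ξ : Plane) :
    𝓕 (fun x => f x + g x) ξ = 𝓕 f ξ + 𝓕 g ξ := by
  rw [Real.fourier_eq, Real.fourier_eq, Real.fourier_eq, ← integral_add
    ((Real.fourierIntegral_convergent_iff ξ).2 hf) ((Real.fourierIntegral_convergent_iff ξ).2 hg)]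
  simp_rw [smul_add]

lemma fourier_sub_apply {f g : Plane → ℂ} (hf : Integrable f) (hg : Integrable g) (ξ : Plane) :
    𝓕 (fun x => f x - g x) ξ = 𝓕 f ξ - 𝓕 g ξ := by
  rw [Real.fourier_eq, Real.fourier_eq, Real.fourier_eq, ← integral_sub
    ((Real.fourierIntegral_convergent_iff ξ).2 hf) ((Real.fourierIntegral_convergent_iff ξ).2 hg)]
  simp_rw [smul_sub]

/-- Integration by parts against the character. Integrability removes the boundary terms, so
Gaussians with polynomial factors are covered as well as test functions. -/
lemma fourier_pderiv {g : Plane → ℂ} (hg : Integrable g) (hd : Differentiable ℝ g) (i : Fin 2)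
    (hi : Integrable (fun x => fderiv ℝ g x (EuclideanSpace.single i 1))) (ξ : Plane) :
    𝓕 (fun x => fderiv ℝ g x (EuclideanSpace.single i 1)) ξ = (2 * Real.pi * ξ i : ℝ) * Complex.I * 𝓕 g ξ := by
  set e : Plane → ℂ := fun x => Complex.exp (((-2 * Real.pi * inner ℝ x ξ : ℝ) : ℂ) * Complex.I)
  have hder : ∀ x, HasFDerivAt e (e x • (((-2 * Real.pi : ℝ) • innerSL ℝ ξ).smulRight Complex.I)) x := by
    intro x
    have h1 : HasFDerivAt (fun x : Plane => -2 * Real.pi * inner ℝ x ξ) ((-2 * Real.pi : ℝ) • innerSL ℝ ξ) x := by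
      have : (fun x : Plane => -2 * Real.pi * inner ℝ x ξ) = fun x => ((-2 * Real.pi : ℝ) • innerSL ℝ ξ) x := by
        ext x; simp [real_inner_comm]
      rw [this]
      exact ((-2 * Real.pi : ℝ) • innerSL ℝ ξ).hasFDerivAt
    have h2 := (Complex.ofRealCLM.hasFDerivAt.comp x h1).mul_const Complex.I
    refine h2.cexp.congr_fderiv ?_
    ext v
    simp [e]; ring
  have hnorm : ∀ x, ‖e x‖ = 1 := fun x => Complex.norm_exp_ofReal_mul_I _
  have hcont : Continuous e := by fun_prop
  have hval : ∀ x, fderiv ℝ e x (EuclideanSpace.single i 1) = -((2 * Real.pi * ξ i : ℝ) * Complex.I) * e x := by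
    intro x
    rw [(hder x).fderiv]
    simp [EuclideanSpace.inner_single_right]
    ring
  have hbdd : ∀ {h : Plane → ℂ}, Integrable h → Integrable (fun x => e x * h x) := fun hh =>
    hh.bdd_mul (c := 1) hcont.aestronglyMeasurable (ae_of_all _ fun x => (hnorm x).le)
  have ibp := integral_mul_fderiv_eq_neg_fderiv_mul_of_integrable (μ := volume) (f := e) (g := g)
    (v := EuclideanSpace.single i 1) (by
      simp_rw [hval, mul_assoc]; exact (hbdd hg).const_mul _) (hbdd hi) (hbdd hg) (fun x _ => (hder x).differentiableAt)
    (fun x _ => hd x)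
  rw [Real.fourier_eq', Real.fourier_eq']
  simp only [smul_eq_mul]
  change ∫ x, e x * fderiv ℝ g x (EuclideanSpace.single i 1) = _ * ∫ x, e x * g x
  rw [ibp, ← integral_neg, ← integral_const_mul]
  congr 1; ext x
  rw [hval]; ring

/-- The complex Gaussian `exp(-b|x|²)`. -/
def cgauss (b : ℝ) (x : Plane) : ℂ := (Real.exp (-b * ‖x‖ ^ 2) : ℝ)

lemma integrable_cgauss {b : ℝ} (hb : 0 < b) : Integrable (cgauss b) := (integrable_gaussian hb).ofReal

lemma fourier_cgauss {b : ℝ} (hb : 0 < b) (ξ : Plane) :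
    𝓕 (cgauss b) ξ = (Real.pi / b * Real.exp (-(Real.pi ^ 2 / b) * ‖ξ‖ ^ 2) : ℝ) := by
  have h := fourier_gaussian_innerProductSpace (V := Plane) (b := b) (by simpa using hb) ξ
  have e : cgauss b = fun v : Plane => Complex.exp (-b * ‖v‖ ^ 2) := by
    ext x; simp [cgauss]
  rw [e, h]
  simp
  ring_nf
  simp

lemma hasFDerivAt_cgauss (b : ℝ) (x : Plane) :
    HasFDerivAt (cgauss b) ((-2 * b * Real.exp (-b * ‖x‖ ^ 2)) • (Complex.ofRealCLM.comp (innerSL ℝ x))) x := by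
  have h1 : HasFDerivAt (fun x : Plane => -b * ‖x‖ ^ 2) ((-b) • (2 • (innerSL ℝ x))) x :=
    (hasStrictFDerivAt_norm_sq x).hasFDerivAt.const_mul (-b)
  have h2 := Complex.ofRealCLM.hasFDerivAt.comp x h1.exp
  refine h2.congr_fderiv ?_
  ext v; simp; ring

lemma fderiv_cgauss (b : ℝ) (i : Fin 2) (x : Plane) :
    fderiv ℝ (cgauss b) x (EuclideanSpace.single i 1) = (-2 * b : ℝ) * ((x i : ℂ) * cgauss b x) := by
  rw [(hasFDerivAt_cgauss b x).fderiv]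
  simp [cgauss, EuclideanSpace.inner_single_right]; ring

lemma integrable_apply_mul_cgauss {b : ℝ} (hb : 0 < b) (i : Fin 2) :
    Integrable (fun x : Plane => (x i : ℂ) * cgauss b x) := by
  refine ((integrable_gaussian hb).add (integrable_norm_sq_mul_gaussian hb)).mono' ?_ (ae_of_all _ fun x => ?_)
  · unfold cgauss; fun_prop
  · have h := abs_apply_le x i
    have : |x i| ≤ 1 + ‖x‖ ^ 2 := by nlinarith [sq_nonneg (‖x‖ - 1), norm_nonneg x]
    have hp := Real.exp_pos (-b * ‖x‖ ^ 2)
    simp only [cgauss, norm_mul, Complex.norm_real, Real.norm_eq_abs, abs_of_pos hp, Pi.add_apply]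
    nlinarith

lemma integrable_sq_apply_mul_cgauss {b : ℝ} (hb : 0 < b) (i : Fin 2) :
    Integrable (fun x : Plane => (x i : ℂ) ^ 2 * cgauss b x) := by
  refine (integrable_norm_sq_mul_gaussian hb).mono' ?_ (ae_of_all _ fun x => ?_)
  · unfold cgauss; fun_prop
  · have hp := Real.exp_pos (-b * ‖x‖ ^ 2)
    simp only [cgauss, norm_mul, norm_pow, Complex.norm_real, Real.norm_eq_abs, abs_of_pos hp, sq_abs]
    exact mul_le_mul_of_nonneg_right (sq_apply_le x i) hp.le

lemma fourier_apply_mul_cgauss {b : ℝ} (hb : 0 < b) (i : Fin 2) (ξ : Plane) :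
    𝓕 (fun x : Plane => (x i : ℂ) * cgauss b x) ξ = -((Real.pi / b * ξ i : ℝ) * Complex.I) * 𝓕 (cgauss b) ξ := by
  have h := fourier_pderiv (integrable_cgauss hb) (fun x => (hasFDerivAt_cgauss b x).differentiableAt) i (by
    simp_rw [fderiv_cgauss]; exact (integrable_apply_mul_cgauss hb i).const_mul _) ξ
  simp_rw [fderiv_cgauss] at h
  rw [fourier_const_mul] at h
  have hb' : (b : ℂ) ≠ 0 := by exact_mod_cast hb.ne'
  have h3 : ((-2 * b : ℝ) : ℂ) ≠ 0 := by simp [hb.ne']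
  apply mul_left_cancel₀ h3
  rw [h]
  push_cast
  field_simp

/-- The derivative of the first moment `x i * cgauss b x` combines the Gaussian with the second
moment, so the rule for derivatives can be solved for the latter. -/
lemma fourier_sq_apply_mul_cgauss {b : ℝ} (hb : 0 < b) (i : Fin 2) (ξ : Plane) :
    𝓕 (fun x : Plane => (x i : ℂ) ^ 2 * cgauss b x) ξ =
      ((1 / (2 * b) - Real.pi ^ 2 / b ^ 2 * ξ i ^ 2 : ℝ) : ℂ) * 𝓕 (cgauss b) ξ := by
  have hd : ∀ x : Plane, HasFDerivAt (fun x : Plane => (x i : ℂ)) (Complex.ofRealCLM.comp (EuclideanSpace.proj i : Plane →L[ℝ] ℝ)) x :=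
    fun x => (Complex.ofRealCLM.comp (EuclideanSpace.proj i : Plane →L[ℝ] ℝ)).hasFDerivAt
  have hval : ∀ x : Plane, fderiv ℝ (fun x : Plane => (x i : ℂ) * cgauss b x) x (EuclideanSpace.single i 1)
      = cgauss b x + (-2 * b : ℝ) * ((x i : ℂ) ^ 2 * cgauss b x) := by
    intro x
    rw [fderiv_fun_mul (hd x).differentiableAt (hasFDerivAt_cgauss b x).differentiableAt]
    simp only [add_apply, smul_apply, fderiv_cgauss, (hd x).fderiv]
    simp; ring
  have h := fourier_pderiv (integrable_apply_mul_cgauss hb i)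
    (fun x => (hd x).differentiableAt.mul (hasFDerivAt_cgauss b x).differentiableAt) i (by
      simp_rw [hval]; exact (integrable_cgauss hb).add ((integrable_sq_apply_mul_cgauss hb i).const_mul _)) ξ
  simp_rw [hval] at h
  rw [fourier_apply_mul_cgauss hb] at h
  rw [fourier_add_apply (integrable_cgauss hb) ((integrable_sq_apply_mul_cgauss hb i).const_mul _),
    fourier_const_mul] at h
  have hb' : (b : ℂ) ≠ 0 := by exact_mod_cast hb.ne'
  have h3 : ((-2 * b : ℝ) : ℂ) ≠ 0 := by simp [hb.ne']
  apply mul_left_cancel₀ h3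
  rw [← sub_eq_iff_eq_add'.2 h.symm]
  push_cast
  field_simp
  ring_nf
  simp [Complex.I_sq]

/-- The quadratic harmonic `x₁² - x₂²`. -/
def quadHarm (x : Plane) : ℝ := x 0 ^ 2 - x 1 ^ 2

lemma abs_quadHarm_le (x : Plane) : |quadHarm x| ≤ ‖x‖ ^ 2 := by
  rw [norm_sq_plane, quadHarm, abs_le]
  constructor <;> nlinarith [sq_nonneg (x 0), sq_nonneg (x 1)]

lemma continuous_quadHarm : Continuous quadHarm := by unfold quadHarm; fun_prop

/-- The isotropic terms 1/(2b) of the two squares cancel, so the harmonic polynomial reproduces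
itself times a Gaussian, as in the Bochner–Hecke formula. The minus sign is i². -/
lemma fourierInv_quadHarm_mul_cgauss {b : ℝ} (hb : 0 < b) (y : Plane) :
    𝓕⁻ (fun x : Plane => (quadHarm x : ℂ) * cgauss b x) y =
      (-(Real.pi ^ 3 / b ^ 3) * quadHarm y * Real.exp (-(Real.pi ^ 2 / b) * ‖y‖ ^ 2) : ℝ) := by
  rw [Real.fourierInv_eq_fourier_neg]
  have : (fun x : Plane => (quadHarm x : ℂ) * cgauss b x)
      = fun x => (x 0 : ℂ) ^ 2 * cgauss b x - (x 1 : ℂ) ^ 2 * cgauss b x := by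
    ext x; simp [quadHarm]; ring
  rw [this, fourier_sub_apply (integrable_sq_apply_mul_cgauss hb 0) (integrable_sq_apply_mul_cgauss hb 1),
    fourier_sq_apply_mul_cgauss hb, fourier_sq_apply_mul_cgauss hb, fourier_cgauss hb, ← sub_mul,
    ← Complex.ofReal_sub, ← Complex.ofReal_mul]
  congr 1
  simp only [quadHarm, norm_neg, PiLp.neg_apply]
  field_simp
  ring


/-! ### The Gaussian regularization of the dipolar kernel -/

/-- The symbol `(ξ₁² - ξ₂²) / (2|ξ|²)` of the dipolar kernel. -/
def dipSymbol : Symbol where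
  toFun ξ := quadHarm ξ / (2 * ‖ξ‖ ^ 2)
  measurable := by have := continuous_quadHarm; fun_prop
  bound := 1 / 2
  le_bound ξ := by
    rw [abs_div, abs_of_nonneg (by positivity : 0 ≤ 2 * ‖ξ‖ ^ 2)]
    apply div_le_of_le_mul₀ (by positivity) (by norm_num)
    linarith [abs_quadHarm_le ξ]

lemma ae_ne_zero_plane : ∀ᵐ ξ : Plane, ξ ≠ 0 := by simp [ae_iff]

lemma integrableOn_exp_decay {a : ℝ} (ha : 0 < a) (δ : ℝ) :
    IntegrableOn (fun s => Real.exp (-a * s)) (Set.Ioi δ) := exp_neg_integrableOn_Ioi δ ha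

lemma integral_exp_decay {a : ℝ} (ha : 0 < a) (δ : ℝ) :
    ∫ s in Set.Ioi δ, Real.exp (-a * s) = Real.exp (-a * δ) / a := by
  rw [integral_exp_mul_Ioi (by linarith) δ]
  rw [neg_div_neg_eq]

/-- The regularized symbol. -/
def regSymbol (δ : ℝ) (ξ : Plane) : ℝ := dipSymbol.toFun ξ * Real.exp (-(Real.pi ^ 2 * δ) * ‖ξ‖ ^ 2)

lemma measurable_regSymbol (δ : ℝ) : Measurable (regSymbol δ) := by
  unfold regSymbol; have := dipSymbol.measurable; fun_prop

lemma abs_regSymbol_le (δ : ℝ) (ξ : Plane) :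
    |regSymbol δ ξ| ≤ 1 / 2 * Real.exp (-(Real.pi ^ 2 * δ) * ‖ξ‖ ^ 2) := by
  rw [regSymbol, abs_mul, abs_of_pos (Real.exp_pos _)]
  exact mul_le_mul_of_nonneg_right (dipSymbol.le_bound ξ) (Real.exp_pos _).le

lemma integrable_regSymbol {δ : ℝ} (hδ : 0 < δ) : Integrable (regSymbol δ) :=
  ((integrable_gaussian (b := Real.pi ^ 2 * δ) (by positivity)).const_mul (1 / 2)).mono'
    (measurable_regSymbol δ).aestronglyMeasurable (ae_of_all _ fun ξ => abs_regSymbol_le δ ξ)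

/-- The integral of e^{-sA} over s > δ is e^{-δA}/A; with A = π²|ξ|² this trades the division by
|ξ|² for a superposition of Gaussians with known inverse transforms. -/
lemma regSymbol_eq_integral (δ : ℝ) {ξ : Plane} (hξ : ξ ≠ 0) :
    regSymbol δ ξ = ∫ s in Set.Ioi δ, Real.pi ^ 2 / 2 * (quadHarm ξ * Real.exp (-(Real.pi ^ 2 * s) * ‖ξ‖ ^ 2)) := by
  have h0 : 0 < ‖ξ‖ := norm_pos_iff.2 hξ
  have hpi := Real.pi_pos
  have e : ∀ s : ℝ, Real.exp (-(Real.pi ^ 2 * s) * ‖ξ‖ ^ 2) = Real.exp (-(Real.pi ^ 2 * ‖ξ‖ ^ 2) * s) := by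
    intro s; congr 1; ring
  simp_rw [e]
  rw [integral_const_mul, integral_const_mul, integral_exp_decay (by positivity), regSymbol, e, dipSymbol]
  field_simp

/-- The Gaussian regularization of the dipolar kernel. -/
def regKernel (δ : ℝ) (y : Plane) : ℝ := U2D y * (1 - (1 + ‖y‖ ^ 2 / δ) * Real.exp (-(‖y‖ ^ 2 / δ)))

lemma U2D_eq (y : Plane) : U2D y = -quadHarm y / (2 * Real.pi * ‖y‖ ^ 4) := by
  by_cases h : y = 0
  · simp [h, U2D, quadHarm]
  have h0 : ‖y‖ ≠ 0 := norm_ne_zero_iff.2 h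
  have hpi := Real.pi_pos.ne'
  rw [U2D, quadHarm, div_pow]
  field_simp
  rw [norm_sq_plane]; ring

/-- An antiderivative in s is e^{-r²/s}(1/(r²s) + 1/r⁴), with limit 1/r⁴ at infinity. -/
lemma integral_inv_cube_exp {r δ : ℝ} (hr : 0 < r) (hδ : 0 < δ) :
    ∫ s in Set.Ioi δ, Real.exp (-(r ^ 2 / s)) / s ^ 3 =
      (1 - (1 + r ^ 2 / δ) * Real.exp (-(r ^ 2 / δ))) / r ^ 4 := by
  have hder : ∀ s ∈ Set.Ici δ, HasDerivAt (fun s => Real.exp (-(r ^ 2 / s)) * (1 / (r ^ 2 * s) + 1 / r ^ 4))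
      (Real.exp (-(r ^ 2 / s)) / s ^ 3) s := by
    intro s hs
    have hs0 : s ≠ 0 := (hδ.trans_le hs).ne'
    have h1 : HasDerivAt (fun s : ℝ => s⁻¹) (-(s ^ 2)⁻¹) s := hasDerivAt_inv hs0
    have h2 : HasDerivAt (fun s : ℝ => Real.exp (-(r ^ 2 / s))) (Real.exp (-(r ^ 2 / s)) * (r ^ 2 / s ^ 2)) s := by
      have := ((h1.const_mul (r ^ 2)).neg).exp
      refine this.congr_deriv ?_
      simp only [Pi.neg_apply, div_eq_mul_inv]; ring
    have h3 : HasDerivAt (fun s : ℝ => 1 / (r ^ 2 * s) + 1 / r ^ 4) (-(1 / (r ^ 2 * s ^ 2))) s := by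
      have := (h1.const_mul (1 / r ^ 2)).add_const (1 / r ^ 4)
      refine (this.congr_deriv ?_).congr_of_eventuallyEq (Eventually.of_forall fun t => ?_)
      · field_simp
      · simp [mul_comm]
    refine (h2.mul h3).congr_deriv ?_
    field_simp
    ring
  have hlim : Tendsto (fun s : ℝ => Real.exp (-(r ^ 2 / s)) * (1 / (r ^ 2 * s) + 1 / r ^ 4)) atTop
      (𝓝 (1 / r ^ 4)) := by
    have i1 : Tendsto (fun s : ℝ => s⁻¹) atTop (𝓝 0) := tendsto_inv_atTop_zero
    have i2 : Tendsto (fun s : ℝ => Real.exp (-(r ^ 2 * s⁻¹)) * (1 / r ^ 2 * s⁻¹ + 1 / r ^ 4)) atTop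
        (𝓝 (Real.exp (-(r ^ 2 * 0)) * (1 / r ^ 2 * 0 + 1 / r ^ 4))) :=
      ((Real.continuous_exp.tendsto _).comp (i1.const_mul (r ^ 2)).neg).mul ((i1.const_mul _).add_const _)
    simp only [mul_zero, neg_zero, Real.exp_zero, zero_add, one_mul] at i2
    refine i2.congr fun s => ?_
    simp [div_eq_mul_inv]; ring
  have hint : IntegrableOn (fun s : ℝ => Real.exp (-(r ^ 2 / s)) / s ^ 3) (Set.Ioi δ) := by
    refine integrableOn_Ioi_deriv_of_nonneg' hder (fun s hs => ?_) hlim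
    have : 0 < s := hδ.trans hs
    positivity
  rw [integral_Ioi_of_hasDerivAt_of_tendsto' hder hint hlim]
  field_simp
  ring

/-- Exchange the frequency integral with the superposition in s, invert each Gaussian, then
integrate e^{-|y|²/s}/s³. Absolute convergence holds because the s-integral of the norms is
|`regSymbol δ`|, integrable since δ > 0. -/
lemma fourierInv_regSymbol {δ : ℝ} (hδ : 0 < δ) (y : Plane) :
    𝓕⁻ (fun ξ => (regSymbol δ ξ : ℂ)) y = (regKernel δ y : ℂ) := by
  have hpi := Real.pi_pos
  let E : Plane → ℂ := fun ξ => Complex.exp (((2 * Real.pi * inner ℝ ξ y : ℝ) : ℂ) * Complex.I)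
  have hE : ∀ ξ, ‖E ξ‖ = 1 := fun ξ => Complex.norm_exp_ofReal_mul_I _
  have hEc : Continuous E := by fun_prop
  let H : Plane → ℝ → ℂ := fun ξ s =>
    E ξ * ((Real.pi ^ 2 / 2 * (quadHarm ξ * Real.exp (-(Real.pi ^ 2 * s) * ‖ξ‖ ^ 2)) : ℝ) : ℂ)
  have hHc : Continuous (Function.uncurry H) := by
    have := continuous_quadHarm
    simp only [H, Function.uncurry_def]; fun_prop
  have hHn : ∀ ξ s, ‖H ξ s‖ = Real.pi ^ 2 / 2 * (|quadHarm ξ| * Real.exp (-(Real.pi ^ 2 * ‖ξ‖ ^ 2) * s)) := by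
    intro ξ s
    simp only [H, norm_mul, hE, one_mul, Complex.norm_real, Real.norm_eq_abs]
    rw [abs_of_pos (Real.exp_pos _), abs_of_pos (by positivity : 0 < Real.pi ^ 2 / 2)]
    congr 3; ring
  have hHs : ∀ ξ ≠ 0, IntegrableOn (H ξ) (Set.Ioi δ) := by
    intro ξ hξ
    have h0 : 0 < ‖ξ‖ := norm_pos_iff.2 hξ
    refine Integrable.mono' (((integrableOn_exp_decay (a := Real.pi ^ 2 * ‖ξ‖ ^ 2) (by positivity) δ).const_mul (|quadHarm ξ|)).const_mul (Real.pi ^ 2 / 2)) ?_ (ae_of_all _ fun s => (hHn ξ s).le)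
    exact (hHc.comp (by fun_prop : Continuous fun s : ℝ => (ξ, s))).aestronglyMeasurable
  have hprod : Integrable (Function.uncurry H) ((volume : Measure Plane).prod (volume.restrict (Set.Ioi δ))) := by
    rw [integrable_prod_iff hHc.aestronglyMeasurable]
    refine ⟨?_, ?_⟩
    · filter_upwards [ae_ne_zero_plane] with ξ hξ using hHs ξ hξ
    · refine (integrable_regSymbol hδ).norm.congr ?_
      filter_upwards [ae_ne_zero_plane] with ξ hξ
      have h0 : 0 < ‖ξ‖ := norm_pos_iff.2 hξ
      simp only [Function.uncurry_apply_pair, hHn]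
      rw [integral_const_mul, integral_const_mul, integral_exp_decay (by positivity), regSymbol, dipSymbol]
      simp only [norm_mul, norm_div, Real.norm_eq_abs, abs_of_pos (Real.exp_pos _), abs_two, abs_pow, abs_norm]
      have : -(Real.pi ^ 2 * δ) * ‖ξ‖ ^ 2 = -(Real.pi ^ 2 * ‖ξ‖ ^ 2) * δ := by ring
      rw [this]
      field_simp
  have e1 : 𝓕⁻ (fun ξ => (regSymbol δ ξ : ℂ)) y = ∫ ξ, ∫ s in Set.Ioi δ, H ξ s := by
    rw [Real.fourierInv_eq']
    apply integral_congr_ae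
    filter_upwards [ae_ne_zero_plane] with ξ hξ
    simp only [H]
    rw [integral_const_mul, integral_complex_ofReal, ← regSymbol_eq_integral δ hξ]
    rfl
  have e2 : ∀ s ∈ Set.Ioi δ, ∫ ξ, H ξ s = ((-(quadHarm y) / (2 * Real.pi) * (Real.exp (-(‖y‖ ^ 2 / s)) / s ^ 3) : ℝ) : ℂ) := by
    intro s hs
    have hs0 : 0 < s := hδ.trans hs
    have h := fourierInv_quadHarm_mul_cgauss (b := Real.pi ^ 2 * s) (by positivity) y
    rw [Real.fourierInv_eq'] at h
    have e3 : ∫ ξ, H ξ s = ((Real.pi ^ 2 / 2 : ℝ) : ℂ) * ∫ ξ, E ξ • ((quadHarm ξ : ℂ) * cgauss (Real.pi ^ 2 * s) ξ) := by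
      rw [← integral_const_mul]
      congr 1; ext ξ
      simp only [H, cgauss, smul_eq_mul]; push_cast; ring
    rw [e3]
    change ((Real.pi ^ 2 / 2 : ℝ) : ℂ) * ∫ ξ, Complex.exp (((2 * Real.pi * inner ℝ ξ y : ℝ) : ℂ) * Complex.I) • ((quadHarm ξ : ℂ) * cgauss (Real.pi ^ 2 * s) ξ) = _
    rw [h, ← Complex.ofReal_mul]
    congr 1
    have : -(Real.pi ^ 2 / (Real.pi ^ 2 * s)) * ‖y‖ ^ 2 = -(‖y‖ ^ 2 / s) := by field_simp
    rw [this]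
    field_simp
  rw [e1, integral_integral_swap hprod, setIntegral_congr_fun measurableSet_Ioi e2, integral_complex_ofReal,
    integral_const_mul]
  congr 1
  by_cases hy : y = 0
  · simp [hy, quadHarm, regKernel, U2D]
  have h0 : 0 < ‖y‖ := norm_pos_iff.2 hy
  rw [integral_inv_cube_exp h0 hδ, regKernel, U2D_eq]
  field_simp


/-! ### Dominated convergence in L² and convolutions as multipliers -/

lemma eLpNorm_two_sq {E : Type*} [NormedAddCommGroup E] (f : Plane → E) :
    eLpNorm f 2 volume ^ 2 = ∫⁻ x, ‖f x‖ₑ ^ 2 := by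
  simpa using eLpNorm_nnreal_pow_eq_lintegral (f := f) (μ := volume) (p := 2) two_ne_zero

lemma eLpNorm_fourier {f : Plane → ℂ} (h1 : Integrable f) (h2 : MemLp f 2 volume) :
    eLpNorm (𝓕 f) 2 volume = eLpNorm f 2 volume := by
  have h := congrArg (fun x : ℝ => ENNReal.ofReal x) (Lp.norm_fourier_eq (h2.toLp f))
  simp only [Lp.norm_def, ENNReal.ofReal_toReal (Lp.eLpNorm_ne_top _)] at h
  rwa [eLpNorm_congr_ae (fourier_toLp_ae_eq h1 h2), eLpNorm_congr_ae h2.coeFn_toLp] at h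

lemma tendsto_eLpNorm_two_of_dominated {ι E : Type*} [NormedAddCommGroup E] {l : Filter ι} [l.IsCountablyGenerated]
    {f : ι → Plane → E} {g : Plane → ℝ} (hg : MemLp g 2 volume)
    (hm : ∀ᶠ i in l, AEStronglyMeasurable (f i) volume)
    (hb : ∀ᶠ i in l, ∀ᵐ x, ‖f i x‖ ≤ g x)
    (hl : ∀ᵐ x, Tendsto (fun i => f i x) l (𝓝 0)) :
    Tendsto (fun i => eLpNorm (f i) 2 volume) l (𝓝 0) := by
  have h : Tendsto (fun i => ∫⁻ x, ‖f i x‖ₑ ^ 2) l (𝓝 (∫⁻ _ : Plane, 0)) := by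
    have hI : Tendsto (fun i => ∫ x, ‖f i x‖ ^ 2) l (𝓝 (∫ _ : Plane, (0 : ℝ))) := by
      apply tendsto_integral_filter_of_dominated_convergence (fun x => g x ^ 2)
      · filter_upwards [hm] with i hi using hi.norm.pow 2
      · filter_upwards [hb] with i hi
        filter_upwards [hi] with x hx
        rw [Real.norm_of_nonneg (by positivity)]
        exact pow_le_pow_left₀ (norm_nonneg _) hx 2
      · exact hg.integrable_sq
      · filter_upwards [hl] with x hx
        simpa using hx.norm.pow 2
    simp only [integral_zero, lintegral_zero] at hI ⊢
    have h0 := ENNReal.tendsto_ofReal hI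
    rw [ENNReal.ofReal_zero] at h0
    refine h0.congr' ?_
    filter_upwards [hm, hb] with i hi hbi
    have hfi : Integrable (fun x => ‖f i x‖ ^ 2) := by
      refine hg.integrable_sq.mono' (hi.norm.pow 2) ?_
      filter_upwards [hbi] with x hx
      rw [Real.norm_of_nonneg (by positivity)]
      exact pow_le_pow_left₀ (norm_nonneg _) hx 2
    rw [ofReal_integral_eq_lintegral_ofReal hfi (ae_of_all _ fun x => by positivity)]
    congr 1; ext x
    rw [ENNReal.ofReal_pow (norm_nonneg _), ofReal_norm]
  simp only [lintegral_zero] at h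
  have h2 := (ENNReal.continuous_rpow_const (y := 1 / 2)).tendsto 0 |>.comp h
  have e : (0 : ℝ≥0∞) ^ (1 / 2 : ℝ) = 0 := by simp
  rw [e] at h2
  refine h2.congr fun i => ?_
  simp only [Function.comp]
  rw [← eLpNorm_two_sq, ← ENNReal.rpow_natCast, ← ENNReal.rpow_mul]
  simp

/-- A convolution theorem in which the symbol, not the kernel, is assumed integrable. This matters
because `regKernel` decays only like |y|⁻² and is not integrable. -/
lemma integral_fourierInv_mul_sub {M ρ : Plane → ℂ} (hM : Integrable M) (hρ : Integrable ρ) (x : Plane) :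
    ∫ y, 𝓕⁻ M y * ρ (x - y) = 𝓕⁻ (fun ξ => M ξ * 𝓕 ρ ξ) x := by
  rw [integral_fourierInv_mul (hρ.comp_sub_left x) hM, Real.fourierInv_eq]
  congr 1; ext ξ
  have h : ∫ y, Real.fourierChar (inner ℝ y ξ) • ρ (x - y)
      = (Real.fourierChar (inner ℝ ξ x) : ℂ) * ∫ y, Real.fourierChar (-inner ℝ y ξ) • ρ y := by
    rw [← integral_const_mul, ← integral_sub_left_eq_self _ volume x]
    congr 1; ext y
    simp only [Circle.smul_def, sub_sub_cancel, inner_sub_left, smul_eq_mul]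
    rw [sub_eq_add_neg, AddChar.map_add_eq_mul, real_inner_comm x ξ, Circle.coe_mul]
    ring
  rw [Real.fourierInv_eq, h, Real.fourier_eq]
  simp only [Circle.smul_def, smul_eq_mul]
  ring

lemma memLp_two_of_bounded {f : Plane → ℂ} (h1 : Integrable f) {C : ℝ} (hC : ∀ x, ‖f x‖ ≤ C) :
    MemLp f 2 volume := by
  refine (memLp_two_iff_integrable_sq_norm h1.1).2 ?_
  refine (h1.norm.bdd_mul (c := C) h1.1.norm (ae_of_all _ fun x => by simpa using hC x)).congr
    (ae_of_all _ fun x => ?_)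
  simp; ring

/-- Convolution with a bounded integrable kernel acts on `L¹ ∩ L²` as a Fourier multiplier. -/
lemma convolution_bounded {k ρ : Plane → ℂ} (hk : Integrable k) (hρ : Integrable ρ) {C : ℝ}
    (hC : ∀ x, ‖k x‖ ≤ C) :
    MemLp (fun x => ∫ y, k y * ρ (x - y)) 2 volume ∧ Integrable (fun x => ∫ y, k y * ρ (x - y)) ∧
      ∀ ξ, 𝓕 (fun x => ∫ y, k y * ρ (x - y)) ξ = 𝓕 k ξ * 𝓕 ρ ξ := by
  have e : (fun x => ∫ y, k y * ρ (x - y)) = MeasureTheory.convolution k ρ (ContinuousLinearMap.lsmul ℂ ℂ) volume := by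
    ext x; simp [MeasureTheory.convolution]
  have hi : Integrable (fun x => ∫ y, k y * ρ (x - y)) := by
    rw [e]; exact hk.integrable_convolution _ hρ
  refine ⟨memLp_two_of_bounded (C := C * ∫ y, ‖ρ y‖) hi fun x => ?_, hi, fun ξ => ?_⟩
  · rw [← integral_sub_left_eq_self (fun y => ‖ρ y‖) volume x, ← integral_const_mul]
    refine norm_integral_le_of_norm_le ((hρ.comp_sub_left x).norm.const_mul C) (ae_of_all _ fun y => ?_)
    rw [norm_mul]
    exact mul_le_mul_of_nonneg_right (hC y) (norm_nonneg _)
  · rw [e]; exact Real.fourier_smul_convolution_eq hk hρ ξ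

/-! ### The error kernel -/

/-- The difference of the sharp and the Gaussian truncation of the dipolar kernel. -/
def errKernel (ε : ℝ) (y : Plane) : ℝ := {y : Plane | ε < ‖y‖}.indicator U2D y - regKernel (ε ^ 2) y

lemma measurable_U2D : Measurable U2D := by unfold U2D; fun_prop

lemma measurable_regKernel (δ : ℝ) : Measurable (regKernel δ) := by
  unfold regKernel; have := measurable_U2D; fun_prop

lemma measurable_errKernel (ε : ℝ) : Measurable (errKernel ε) :=
  (measurable_U2D.indicator (measurableSet_lt measurable_const measurable_norm)).sub (measurable_regKernel _)

lemma abs_U2D_le (y : Plane) : |U2D y| ≤ 1 / (2 * Real.pi * ‖y‖ ^ 2) := by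
  by_cases h : y = 0
  · simp [h, U2D]
  have h0 : 0 < ‖y‖ := norm_pos_iff.2 h
  have hpi := Real.pi_pos
  rw [U2D_eq, abs_div, abs_neg, abs_of_pos (by positivity : 0 < 2 * Real.pi * ‖y‖ ^ 4),
    div_le_div_iff₀ (by positivity) (by positivity)]
  calc _ ≤ ‖y‖ ^ 2 * (2 * Real.pi * ‖y‖ ^ 2) := by gcongr; exact abs_quadHarm_le y
    _ = _ := by ring

lemma U2D_smul {t : ℝ} (ht : 0 < t) (y : Plane) : U2D (t • y) = (t ^ 2)⁻¹ * U2D y := by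
  simp only [U2D_eq, quadHarm, norm_smul, Real.norm_of_nonneg ht.le, PiLp.smul_apply, smul_eq_mul]
  by_cases h : y = 0
  · simp [h]
  have h0 : 0 < ‖y‖ := norm_pos_iff.2 h
  have hpi := Real.pi_pos
  field_simp

/-- The kernel is homogeneous of degree -2, and the regularization parameter is ε² so that both
truncations scale with the radius. -/
lemma errKernel_scale {ε : ℝ} (hε : 0 < ε) (y : Plane) :
    errKernel ε y = (ε ^ 2)⁻¹ * errKernel 1 (ε⁻¹ • y) := by
  have h1 : U2D y = (ε ^ 2)⁻¹ * U2D (ε⁻¹ • y) := by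
    rw [U2D_smul (inv_pos.2 hε)]; field_simp
  have h2 : ‖ε⁻¹ • y‖ ^ 2 = ‖y‖ ^ 2 / ε ^ 2 := by
    rw [norm_smul, norm_inv, Real.norm_of_nonneg hε.le, mul_pow, inv_pow, div_eq_inv_mul]
  have h3 : ε < ‖y‖ ↔ 1 < ‖ε⁻¹ • y‖ := by
    rw [norm_smul, norm_inv, Real.norm_of_nonneg hε.le, lt_inv_mul_iff₀ hε, mul_one]
  simp only [errKernel, regKernel, h2, one_pow, div_one, Set.indicator, Set.mem_ofPred_eq, ← h3]
  split_ifs <;> rw [h1] <;> ring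

/-- Put x = |y|². Outside the unit disc the error is U(1 + x)e^{-x}. Inside, the factor 1 - (1 +
x)e^{-x} lies between 0 and x², which cancels the singularity 1/x of U. -/
lemma abs_errKernel_one_le (y : Plane) : |errKernel 1 y| ≤ 3 * Real.exp (-1 * ‖y‖ ^ 2) := by
  have hU := abs_U2D_le y
  have hpi := Real.pi_gt_three
  set x := ‖y‖ ^ 2 with hx
  have hx0 : 0 ≤ x := by positivity
  have hexp := Real.exp_pos (-x)
  have e1 : -1 * x = -x := by ring
  rw [e1]
  simp only [errKernel, regKernel, one_pow, div_one, Set.indicator, Set.mem_ofPred_eq, ← hx]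
  split_ifs with h
  · have hx1 : 1 < x := by rw [hx]; nlinarith
    have : U2D y - U2D y * (1 - (1 + x) * Real.exp (-x)) = U2D y * ((1 + x) * Real.exp (-x)) := by ring
    rw [this, abs_mul, abs_of_pos (by positivity : 0 < (1 + x) * Real.exp (-x)), ← mul_assoc]
    apply mul_le_mul_of_nonneg_right _ hexp.le
    calc |U2D y| * (1 + x) ≤ 1 / (2 * Real.pi * x) * (1 + x) := by gcongr
      _ ≤ 3 := by
        rw [one_div, inv_mul_le_iff₀ (by positivity)]; nlinarith
  · have hx1 : x ≤ 1 := by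
      rw [hx]; have := norm_nonneg y; nlinarith [not_lt.1 h]
    have hl : 1 - x ≤ Real.exp (-x) := by linarith [Real.add_one_le_exp (-x)]
    have hnn : 0 ≤ 1 - (1 + x) * Real.exp (-x) := by
      have := Real.add_one_le_exp x
      have h2 : Real.exp x * Real.exp (-x) = 1 := by rw [← Real.exp_add]; simp
      nlinarith
    have hle : 1 - (1 + x) * Real.exp (-x) ≤ x ^ 2 := by nlinarith
    rw [zero_sub, abs_neg, abs_mul, abs_of_nonneg hnn]
    have h1 : |U2D y| * (1 - (1 + x) * Real.exp (-x)) ≤ 1 := by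
      by_cases hx00 : x = 0
      · rw [hx00]; simp
      have hxp : 0 < x := lt_of_le_of_ne hx0 (Ne.symm hx00)
      calc _ ≤ 1 / (2 * Real.pi * x) * x ^ 2 := by gcongr
        _ ≤ 1 := by
          rw [one_div, inv_mul_le_iff₀ (by positivity)]; nlinarith
    have h2 : Real.exp (-1) ≤ Real.exp (-x) := Real.exp_le_exp.2 (by linarith)
    have h3 : 1 / 3 ≤ Real.exp (-1) := by
      rw [Real.exp_neg, one_div]
      exact inv_anti₀ (Real.exp_pos 1) Real.exp_one_lt_three.le
    linarith

lemma integrable_errKernel_one : Integrable (errKernel 1) :=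
  ((integrable_gaussian (b := 1) one_pos).const_mul 3).mono' (measurable_errKernel 1).aestronglyMeasurable
    (ae_of_all _ fun y => abs_errKernel_one_le y)

/-- The exchange of the two coordinates. -/
def swapEquiv : Plane ≃ₗᵢ[ℝ] Plane := LinearIsometryEquiv.piLpCongrLeft 2 ℝ ℝ (Equiv.swap 0 1)

lemma errKernel_swap (y : Plane) : errKernel 1 (swapEquiv y) = -errKernel 1 y := by
  have h0 : swapEquiv y 0 = y 1 := by simp [swapEquiv, LinearIsometryEquiv.piLpCongrLeft_apply, Equiv.piCongrLeft']
  have h1 : swapEquiv y 1 = y 0 := by simp [swapEquiv, LinearIsometryEquiv.piLpCongrLeft_apply, Equiv.piCongrLeft']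
  have hU : U2D (swapEquiv y) = -U2D y := by
    simp only [U2D_eq, quadHarm, h0, h1, LinearIsometryEquiv.norm_map]; ring
  simp only [errKernel, regKernel, Set.indicator, Set.mem_ofPred_eq, LinearIsometryEquiv.norm_map, hU]
  split_ifs <;> ring

/-- Exchanging the coordinates reverses the sign of the kernel. Mean zero is what makes the error
vanish in the limit instead of leaving a multiple of the density. -/
lemma integral_errKernel_one : ∫ y, errKernel 1 y = 0 := by
  have h := swapEquiv.measurePreserving.integral_comp swapEquiv.toHomeomorph.measurableEmbedding (errKernel 1)
  have h2 : ∫ y, errKernel 1 (swapEquiv y) = -∫ y, errKernel 1 y := by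
    rw [← integral_neg]; congr 1; ext y; exact errKernel_swap y
  linarith [h.symm.trans h2]

lemma integrable_errKernel {ε : ℝ} (hε : 0 < ε) : Integrable (errKernel ε) := by
  have : errKernel ε = fun y => (ε ^ 2)⁻¹ * errKernel 1 (ε⁻¹ • y) := by ext y; exact errKernel_scale hε y
  rw [this]
  exact (integrable_errKernel_one.comp_smul (inv_ne_zero hε.ne')).const_mul _

lemma abs_errKernel_le {ε : ℝ} (hε : 0 < ε) (y : Plane) : |errKernel ε y| ≤ (ε ^ 2)⁻¹ * 3 := by
  rw [errKernel_scale hε, abs_mul, abs_of_pos (by positivity)]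
  apply mul_le_mul_of_nonneg_left _ (by positivity)
  refine (abs_errKernel_one_le _).trans ?_
  have : Real.exp (-1 * ‖ε⁻¹ • y‖ ^ 2) ≤ 1 := Real.exp_le_one_iff.2 (by have := sq_nonneg ‖ε⁻¹ • y‖; linarith)
  linarith

/-- The kernels are L¹-normalized dilations of one another, so as ε → 0 the transform is read closer
and closer to the origin. -/
lemma fourier_errKernel {ε : ℝ} (hε : 0 < ε) (ξ : Plane) :
    𝓕 (fun y => (errKernel ε y : ℂ)) ξ = 𝓕 (fun y => (errKernel 1 y : ℂ)) (ε • ξ) := by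
  rw [Real.fourier_eq, Real.fourier_eq]
  have h := Measure.integral_comp_inv_smul_of_nonneg (volume : Measure Plane)
    (fun y => Real.fourierChar (-inner ℝ y (ε • ξ)) • (errKernel 1 y : ℂ)) hε.le
  have hd : Module.finrank ℝ Plane = 2 := by simp
  rw [hd] at h
  have h2 : ∫ y, Real.fourierChar (-inner ℝ y (ε • ξ)) • (errKernel 1 y : ℂ)
      = (ε ^ 2)⁻¹ • ∫ y, Real.fourierChar (-inner ℝ (ε⁻¹ • y) (ε • ξ)) • (errKernel 1 (ε⁻¹ • y) : ℂ) := by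
    rw [h, smul_smul, inv_mul_cancel₀ (by positivity), one_smul]
  rw [h2, ← integral_smul]
  congr 1; ext y
  rw [errKernel_scale hε, inner_smul_left, inner_smul_right]
  simp only [Circle.smul_def, Complex.real_smul, smul_eq_mul, conj_trivial]
  rw [inv_mul_cancel_left₀ hε.ne']
  push_cast; ring


/-! ### The principal value convolution as a Fourier multiplier -/

/-- The regularized symbol, bundled. -/
def regSym (δ : ℝ) (hδ : 0 < δ) : Symbol where
  toFun := regSymbol δ
  measurable := measurable_regSymbol δ
  bound := 1 / 2
  le_bound ξ := by
    refine (abs_regSymbol_le δ ξ).trans ?_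
    have : Real.exp (-(Real.pi ^ 2 * δ) * ‖ξ‖ ^ 2) ≤ 1 := by
      apply Real.exp_le_one_iff.2
      have : 0 ≤ (Real.pi ^ 2 * δ) * ‖ξ‖ ^ 2 := by positivity
      linarith
    linarith

lemma op_ae_of_integrable (σ : Symbol) (hσ : Integrable σ.toFun) {f : Plane → ℂ} (h1 : Integrable f)
    (h2 : MemLp f 2 volume) :
    σ.op (h2.toLp f) =ᵐ[volume] 𝓕⁻ (fun ξ => (σ.toFun ξ : ℂ) * 𝓕 f ξ) := by
  have hm : MemLp (fun ξ => (σ.toFun ξ : ℂ) * 𝓕 f ξ) 2 volume := σ.memLp_mul (memLp_fourier h1 h2)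
  have hi : Integrable (fun ξ => (σ.toFun ξ : ℂ) * 𝓕 f ξ) := by
    refine hσ.ofReal.mul_bdd (c := ∫ y, ‖f y‖) (continuous_fourier h1).aestronglyMeasurable
      (ae_of_all _ fun ξ => norm_fourier_le ξ)
  have e : σ.mul (𝓕 (h2.toLp f)) = hm.toLp _ := by
    apply Lp.ext
    filter_upwards [σ.mul_ae (𝓕 (h2.toLp f)), hm.coeFn_toLp, fourier_toLp_ae_eq h1 h2] with x a b c
    rw [a, b, c]
  rw [σ.op_apply, e]
  exact fourierInv_toLp_ae_eq hi hm

lemma eLpNorm_op_sub_op (σ τ : Symbol) {f : Plane → ℂ} (h1 : Integrable f) (h2 : MemLp f 2 volume) :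
    eLpNorm (fun x => σ.op (h2.toLp f) x - τ.op (h2.toLp f) x) 2 volume
      = eLpNorm (fun ξ => ((σ.toFun ξ - τ.toFun ξ : ℝ) : ℂ) * 𝓕 f ξ) 2 volume := by
  have e : σ.op (h2.toLp f) - τ.op (h2.toLp f) = 𝓕⁻ (σ.mul (𝓕 (h2.toLp f)) - τ.mul (𝓕 (h2.toLp f))) :=
    ((Lp.fourierTransformₗᵢ Plane ℂ).symm.map_sub _ _).symm
  have hn : ‖σ.op (h2.toLp f) - τ.op (h2.toLp f)‖ = ‖σ.mul (𝓕 (h2.toLp f)) - τ.mul (𝓕 (h2.toLp f))‖ := by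
    rw [e]; exact (Lp.fourierTransformₗᵢ Plane ℂ).symm.norm_map _
  have h := congrArg (fun x : ℝ => ENNReal.ofReal x) hn
  simp only [Lp.norm_def, ENNReal.ofReal_toReal (Lp.eLpNorm_ne_top _)] at h
  rw [eLpNorm_congr_ae (Lp.coeFn_sub _ _), eLpNorm_congr_ae (Lp.coeFn_sub _ _)] at h
  refine h.trans (eLpNorm_congr_ae ?_)
  filter_upwards [σ.mul_ae (𝓕 (h2.toLp f)), τ.mul_ae (𝓕 (h2.toLp f)), fourier_toLp_ae_eq h1 h2] with ξ a b c
  rw [Pi.sub_apply, a, b, c]; push_cast; ring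

/-- The sharp truncation is the Gaussian regularization, with explicit transform, plus a bounded
integrable error kernel. -/
lemma truncConv_eq {ρ : Plane → ℝ} (h1 : Integrable ρ) {ε : ℝ} (hε : 0 < ε) (x : Plane) :
    (truncConv ε ρ x : ℂ) = 𝓕⁻ (fun ξ => (regSymbol (ε ^ 2) ξ : ℂ) * 𝓕 (fun x => (ρ x : ℂ)) ξ) x
      + ∫ y, (errKernel ε y : ℂ) * (ρ (x - y) : ℂ) := by
  have hδ : 0 < ε ^ 2 := by positivity
  have hρx := h1.comp_sub_left x
  have h1c : Integrable (fun x => (ρ x : ℂ)) := h1.ofReal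
  have hM : Integrable (fun ξ => (regSymbol (ε ^ 2) ξ : ℂ)) := (integrable_regSymbol hδ).ofReal
  rw [← integral_fourierInv_mul_sub hM h1c]
  simp_rw [fourierInv_regSymbol hδ]
  have hreg : ∀ y, |regKernel (ε ^ 2) y| ≤ ∫ ξ, |regSymbol (ε ^ 2) ξ| := by
    intro y
    have := norm_fourierInv_le (f := fun ξ => (regSymbol (ε ^ 2) ξ : ℂ)) y
    rw [fourierInv_regSymbol hδ] at this
    simpa using this
  have i1 : Integrable (fun y => (regKernel (ε ^ 2) y : ℂ) * (ρ (x - y) : ℂ)) :=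
    hρx.ofReal.bdd_mul (c := ∫ ξ, |regSymbol (ε ^ 2) ξ|)
      (measurable_regKernel _).complex_ofReal.aestronglyMeasurable
      (ae_of_all _ fun y => by simpa using hreg y)
  have i2 : Integrable (fun y => (errKernel ε y : ℂ) * (ρ (x - y) : ℂ)) :=
    hρx.ofReal.bdd_mul (c := (ε ^ 2)⁻¹ * 3) (measurable_errKernel _).complex_ofReal.aestronglyMeasurable
      (ae_of_all _ fun y => by simpa using abs_errKernel_le hε y)
  rw [← integral_add i1 i2, truncConv, ← integral_indicator (measurableSet_lt measurable_const measurable_norm),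
    ← integral_complex_ofReal]
  congr 1; ext y
  simp only [errKernel, Set.indicator, Set.mem_ofPred_eq]
  split_ifs <;> push_cast <;> ring

/-- The `L²` limit of the truncated convolutions. -/
def pvLimit {ρ : Plane → ℝ} (h2 : MemLp ρ 2 volume) (x : Plane) : ℝ :=
  (dipSymbol.op (h2.ofReal.toLp (fun x => (ρ x : ℂ))) x).re

lemma memLp_pvLimit {ρ : Plane → ℝ} (h2 : MemLp ρ 2 volume) : MemLp (pvLimit h2) 2 volume :=
  (Lp.memLp (dipSymbol.op (h2.ofReal.toLp (fun x => (ρ x : ℂ))))).re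

lemma eLpNorm_truncConv_sub_le {ρ : Plane → ℝ} (h1 : Integrable ρ) (h2 : MemLp ρ 2 volume)
    {ε : ℝ} (hε : 0 < ε) :
    eLpNorm (fun x => truncConv ε ρ x - pvLimit h2 x) 2 volume ≤
      eLpNorm (fun ξ => ((regSymbol (ε ^ 2) ξ - dipSymbol.toFun ξ : ℝ) : ℂ) * 𝓕 (fun x => (ρ x : ℂ)) ξ) 2 volume
        + eLpNorm (fun ξ => 𝓕 (fun y => (errKernel 1 y : ℂ)) (ε • ξ) * 𝓕 (fun x => (ρ x : ℂ)) ξ) 2 volume := by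
  have hδ : 0 < ε ^ 2 := by positivity
  have h1c : Integrable (fun x => (ρ x : ℂ)) := h1.ofReal
  have h2c : MemLp (fun x => (ρ x : ℂ)) 2 volume := h2.ofReal
  set R : L2 := h2c.toLp _
  obtain ⟨c1, c2, c3⟩ := convolution_bounded (k := fun y => (errKernel ε y : ℂ)) (integrable_errKernel hε).ofReal h1c
    (C := (ε ^ 2)⁻¹ * 3) (fun y => by simpa using abs_errKernel_le hε y)
  have s1 : eLpNorm (fun x => truncConv ε ρ x - pvLimit h2 x) 2 volume ≤
      eLpNorm (fun x => ((regSym _ hδ).op R x - dipSymbol.op R x) + ∫ y, (errKernel ε y : ℂ) * (ρ (x - y) : ℂ)) 2 volume := by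
    apply eLpNorm_mono_ae
    filter_upwards [op_ae_of_integrable (regSym _ hδ) (integrable_regSymbol hδ) h1c h2c] with x hx
    have e : ((regSym _ hδ).op R x - dipSymbol.op R x) + ∫ y, (errKernel ε y : ℂ) * (ρ (x - y) : ℂ)
        = (truncConv ε ρ x : ℂ) - dipSymbol.op R x := by
      rw [truncConv_eq h1 hε x]
      simp only [R]
      rw [hx]
      simp only [regSym]; ring
    rw [e]
    have e2 : truncConv ε ρ x - pvLimit h2 x = ((truncConv ε ρ x : ℂ) - dipSymbol.op R x).re := by
      simp [pvLimit, R]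
    rw [e2]
    exact Complex.abs_re_le_norm _
  refine s1.trans ((eLpNorm_add_le ((Lp.aestronglyMeasurable _).sub (Lp.aestronglyMeasurable _)) c1.1 (by norm_num)).trans ?_)
  apply add_le_add
  · exact (eLpNorm_op_sub_op (regSym _ hδ) dipSymbol h1c h2c).le
  · rw [← eLpNorm_fourier c2 c1]
    apply le_of_eq
    congr 1; ext ξ
    rw [c3, fourier_errKernel hε]

lemma aestronglyMeasurable_truncConv {ρ : Plane → ℝ} (h1 : Integrable ρ) {ε : ℝ} (hε : 0 < ε) : AEStronglyMeasurable (truncConv ε ρ) volume := by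
  have hδ : 0 < ε ^ 2 := by positivity
  have h1c : Integrable (fun x => (ρ x : ℂ)) := h1.ofReal
  obtain ⟨c1, c2, c3⟩ := convolution_bounded (k := fun y => (errKernel ε y : ℂ)) (integrable_errKernel hε).ofReal h1c
    (C := (ε ^ 2)⁻¹ * 3) (fun y => by simpa using abs_errKernel_le hε y)
  have hi : Integrable (fun ξ => (regSymbol (ε ^ 2) ξ : ℂ) * 𝓕 (fun x => (ρ x : ℂ)) ξ) :=
    (integrable_regSymbol hδ).ofReal.mul_bdd (c := ∫ y, ‖(ρ y : ℂ)‖) (continuous_fourier h1c).aestronglyMeasurable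
      (ae_of_all _ fun ξ => norm_fourier_le ξ)
  have h := ((continuous_fourierInv hi).aestronglyMeasurable.add c1.1).re
  refine h.congr (ae_of_all _ fun x => ?_)
  have := truncConv_eq h1 hε x
  simp only [Pi.add_apply]
  rw [← this]; simp

/-- On the Fourier side the regularized symbol tends to the dipolar one, and the transform of
`errKernel 1` at εξ tends to its value zero at the origin. Both multipliers are bounded uniformly in
ε, so dominated convergence applies. -/
theorem isPVConv_pvLimit {ρ : Plane → ℝ} (h1 : Integrable ρ) (h2 : MemLp ρ 2 volume) : IsPVConv ρ (pvLimit h2) := by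
  refine ⟨memLp_pvLimit h2, ?_⟩
  have h1c : Integrable (fun x => (ρ x : ℂ)) := h1.ofReal
  have h2c : MemLp (fun x => (ρ x : ℂ)) 2 volume := h2.ofReal
  have hF := memLp_fourier h1c h2c
  have hpos : ∀ᶠ ε : ℝ in 𝓝[>] 0, 0 < ε := self_mem_nhdsWithin
  have t1 : Tendsto (fun ε : ℝ => eLpNorm (fun ξ => ((regSymbol (ε ^ 2) ξ - dipSymbol.toFun ξ : ℝ) : ℂ) * 𝓕 (fun x => (ρ x : ℂ)) ξ) 2 volume) (𝓝[>] 0) (𝓝 0) := by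
    apply tendsto_eLpNorm_two_of_dominated (g := fun ξ => ‖𝓕 (fun x => (ρ x : ℂ)) ξ‖) hF.norm
    · filter_upwards with ε
      exact ((measurable_regSymbol _).sub dipSymbol.measurable).complex_ofReal.aestronglyMeasurable.mul hF.1
    · filter_upwards [hpos] with ε hε
      filter_upwards with ξ
      rw [norm_mul, Complex.norm_real]
      apply mul_le_of_le_one_left (norm_nonneg _)
      refine (norm_sub_le _ _).trans ?_
      have a := (regSym (ε ^ 2) (by positivity)).le_bound ξ
      have b := dipSymbol.le_bound ξ
      simp only [regSym, dipSymbol, Real.norm_eq_abs] at a b ⊢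
      linarith
    · filter_upwards with ξ
      have hc : Continuous (fun ε : ℝ => ((regSymbol (ε ^ 2) ξ - dipSymbol.toFun ξ : ℝ) : ℂ) * 𝓕 (fun x => (ρ x : ℂ)) ξ) := by
        unfold regSymbol; fun_prop
      have := (hc.tendsto 0).mono_left (nhdsWithin_le_nhds (s := Set.Ioi 0))
      simpa [regSymbol] using this
  have hk : Integrable (fun y => (errKernel 1 y : ℂ)) := integrable_errKernel_one.ofReal
  have t2 : Tendsto (fun ε : ℝ => eLpNorm (fun ξ => 𝓕 (fun y => (errKernel 1 y : ℂ)) (ε • ξ) * 𝓕 (fun x => (ρ x : ℂ)) ξ) 2 volume) (𝓝[>] 0) (𝓝 0) := by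
    apply tendsto_eLpNorm_two_of_dominated (g := fun ξ => (∫ y, ‖(errKernel 1 y : ℂ)‖) * ‖𝓕 (fun x => (ρ x : ℂ)) ξ‖) (hF.norm.const_mul _)
    · filter_upwards with ε
      exact ((continuous_fourier hk).comp (continuous_const_smul ε)).aestronglyMeasurable.mul hF.1
    · filter_upwards with ε
      filter_upwards with ξ
      rw [norm_mul]
      exact mul_le_mul_of_nonneg_right (norm_fourier_le _) (norm_nonneg _)
    · filter_upwards with ξ
      have hc : Continuous (fun ε : ℝ => 𝓕 (fun y => (errKernel 1 y : ℂ)) (ε • ξ) * 𝓕 (fun x => (ρ x : ℂ)) ξ) :=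
        ((continuous_fourier hk).comp (by fun_prop)).mul continuous_const
      have h0 := (hc.tendsto 0).mono_left (nhdsWithin_le_nhds (s := Set.Ioi 0))
      have e0 : 𝓕 (fun y => (errKernel 1 y : ℂ)) ((0:ℝ) • ξ) = 0 := by
        rw [zero_smul, Real.fourier_eq]
        simp only [inner_zero_right, neg_zero, AddChar.map_zero_eq_one, one_smul]
        rw [integral_complex_ofReal, integral_errKernel_one]; simp
      simp only [e0, zero_mul] at h0
      exact h0
  have t3 := t1.add t2
  rw [add_zero] at t3
  refine tendsto_of_tendsto_of_tendsto_of_le_of_le' tendsto_const_nhds t3 (Eventually.of_forall fun _ => zero_le) ?_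
  filter_upwards [hpos] with ε hε using eLpNorm_truncConv_sub_le h1 h2 hε

/-- Uniqueness of L² limits makes the choice in `pvConv` harmless; the triangle inequality uses that
truncated convolutions are measurable. -/
lemma IsPVConv.ae_eq {ρ : Plane → ℝ} (h1 : Integrable ρ) {w w' : Plane → ℝ} (hw : IsPVConv ρ w) (hw' : IsPVConv ρ w') : w =ᵐ[volume] w' := by
  have t := hw.2.add hw'.2
  rw [add_zero] at t
  have hle : ∀ᶠ ε : ℝ in 𝓝[>] 0, eLpNorm (w - w') 2 volume ≤
      eLpNorm (fun x => truncConv ε ρ x - w x) 2 volume + eLpNorm (fun x => truncConv ε ρ x - w' x) 2 volume := by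
    filter_upwards [self_mem_nhdsWithin] with ε hε
    have hm := aestronglyMeasurable_truncConv h1 (Set.mem_Ioi.1 hε)
    have e : w - w' = (fun x => truncConv ε ρ x - w' x) - (fun x => truncConv ε ρ x - w x) := by
      ext x; simp
    rw [e, add_comm]
    exact eLpNorm_sub_le (hm.sub hw'.1.1) (hm.sub hw.1.1) (by norm_num)
  have h0 : eLpNorm (w - w') 2 volume = 0 := le_antisymm (ge_of_tendsto t hle) zero_le
  have := (eLpNorm_eq_zero_iff (hw.1.1.sub hw'.1.1) (by norm_num)).1 h0
  filter_upwards [this] with x hx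
  simpa [sub_eq_zero] using hx

lemma pvConv_ae_eq {ρ : Plane → ℝ} (h1 : Integrable ρ) (h2 : MemLp ρ 2 volume) : pvConv ρ =ᵐ[volume] pvLimit h2 := by
  have hex : ∃ w, IsPVConv ρ w := ⟨_, isPVConv_pvLimit h1 h2⟩
  have : IsPVConv ρ (pvConv ρ) := by
    rw [pvConv, dif_pos hex]; exact hex.choose_spec
  exact IsPVConv.ae_eq h1 this (isPVConv_pvLimit h1 h2)

lemma integral_re_op_mul {ρ : Plane → ℝ} (σ : Symbol) {R : L2} (hR : R =ᵐ[volume] fun x => (ρ x : ℂ)) :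
    ∫ x, (σ.op R x).re * ρ x = σ.quad R := by
  rw [Symbol.quad, L2.inner_def]
  have hi : Integrable (fun x => inner ℂ (R x) (σ.op R x)) := L2.integrable_inner R (σ.op R)
  rw [← integral_re hi]
  apply integral_congr_ae
  filter_upwards [hR] with x hx
  rw [hx]
  simp [RCLike.inner_apply]

theorem interaction_eq (a b : ℝ) (u : H1) :
    interaction a b u = a * ‖u.densLp‖ ^ 2 + b * dipSymbol.quad u.densLp := by
  rw [interaction, u.norm_sq_densLp]
  congr 2
  rw [← integral_re_op_mul dipSymbol u.densLp_ae]
  apply integral_congr_ae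
  filter_upwards [pvConv_ae_eq u.integrable_density u.memLp_density] with x hx
  rw [hx]; rfl

/-- The symbol `a + b Û`. -/
def intSymbol (a b : ℝ) : Symbol where
  toFun ξ := a + b * dipSymbol.toFun ξ
  measurable := measurable_const.add (dipSymbol.measurable.const_mul b)
  bound := |a| + |b| * (1 / 2)
  le_bound ξ := by
    refine (abs_add_le _ _).trans ?_
    rw [abs_mul]
    gcongr
    exact dipSymbol.le_bound ξ

theorem interaction_eq_quad (a b : ℝ) (u : H1) : interaction a b u = (intSymbol a b).quad u.densLp := by
  rw [interaction_eq, Symbol.quad_eq, Symbol.quad_eq, ← integral_norm_sq_fourier, ← integral_const_mul,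
    ← integral_const_mul, ← integral_add ((integrable_norm_sq (Lp.memLp _)).const_mul a)
      ((dipSymbol.integrable_quad _).const_mul b)]
  congr 1; ext ξ
  simp only [intSymbol]; ring


/-! ### The screened kernel as a superposition of Gaussians -/

/-- The weight of the Gaussian superposition. -/
def gaussWeight (s : ℝ) : ℝ := 1 / (2 * √(1 + Real.pi * s))

/-- The normalized Gaussian with Fourier transform `exp(-π² s |ξ|²)`. -/
def heat (s : ℝ) (x : Plane) : ℝ := Real.exp (-(1 / s) * ‖x‖ ^ 2) / (Real.pi * s)

/-- The substitution s ↦ 1/s turns the integral into Γ(1/2). -/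
lemma integral_inv_sqrt {A : ℝ} (hA : 0 < A) :
    IntegrableOn (fun s : ℝ => Real.exp (-(A / s)) / (s * √s)) (Set.Ioi 0) ∧
      ∫ s in Set.Ioi (0:ℝ), Real.exp (-(A / s)) / (s * √s) = √Real.pi / √A := by
  have hcongr : ∀ s ∈ Set.Ioi (0:ℝ), (|(-1:ℝ)| * s ^ ((-1:ℝ) - 1)) • ((s ^ (-1:ℝ)) ^ ((1/2:ℝ) - 1) * Real.exp (-(A * s ^ (-1:ℝ))))
      = Real.exp (-(A / s)) / (s * √s) := by
    intro s hs
    have hs0 : 0 < s := hs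
    have e1 : s ^ ((-1:ℝ) - 1) = (s ^ 2)⁻¹ := by
      rw [show (-1:ℝ) - 1 = -(2:ℕ) by norm_num, Real.rpow_neg hs0.le, Real.rpow_natCast]
    have e2 : (s ^ (-1:ℝ)) ^ ((1/2:ℝ) - 1) = √s := by
      rw [← Real.rpow_mul hs0.le, Real.sqrt_eq_rpow]; norm_num
    have e3 : s ^ (-1:ℝ) = s⁻¹ := Real.rpow_neg_one s
    rw [e2, e1, e3]
    have hq : √s * √s = s := Real.mul_self_sqrt hs0.le
    have hq0 : 0 < √s := Real.sqrt_pos.2 hs0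
    simp only [abs_neg, abs_one, smul_eq_mul, ← div_eq_mul_inv]
    field_simp
    rw [Real.sq_sqrt hs0.le]
  have hint : IntegrableOn (fun t : ℝ => t ^ ((1/2:ℝ) - 1) * Real.exp (-(A * t))) (Set.Ioi 0) := by
    have := integrableOn_rpow_mul_exp_neg_mul_rpow (s := (1/2:ℝ) - 1) (p := 1) (by norm_num) (by norm_num) hA
    refine this.congr_fun (fun t ht => ?_) measurableSet_Ioi
    simp
  constructor
  · have := (integrableOn_Ioi_comp_rpow_iff (fun t : ℝ => t ^ ((1/2:ℝ) - 1) * Real.exp (-(A * t))) (p := -1) (by norm_num)).2 hint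
    exact this.congr_fun hcongr measurableSet_Ioi
  · rw [← setIntegral_congr_fun measurableSet_Ioi hcongr,
      integral_comp_rpow_Ioi (fun t : ℝ => t ^ ((1/2:ℝ) - 1) * Real.exp (-(A * t))) (p := -1) (by norm_num),
      Real.integral_rpow_mul_exp_neg_mul_Ioi (by norm_num) hA, Real.Gamma_one_half_eq, ← Real.sqrt_eq_rpow,
      Real.sqrt_div (by norm_num)]
    simp; ring

/-- Insert the formula of `integral_inv_sqrt` for 1/√A with A = |x|² + t²/(2π), exchange the
integrals and evaluate the Gaussian integral in t. The coefficient of t² there is (1 + πs)/(2πs),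
the origin of the weight. Domination by 1/|x| uses x ≠ 0. -/
lemma K_eq_integral {x : Plane} (hx : x ≠ 0) :
    K x = ∫ s in Set.Ioi (0:ℝ), gaussWeight s * heat s x := by
  have hr : 0 < ‖x‖ := norm_pos_iff.2 hx
  have hpi := Real.pi_pos
  let A : ℝ → ℝ := fun t => ‖x‖ ^ 2 + t ^ 2 / (2 * Real.pi)
  have hA : ∀ t, 0 < A t := fun t => by positivity
  let H : ℝ → ℝ → ℝ := fun t s => Real.exp (-t ^ 2 / 2) * (Real.exp (-(A t / s)) / (s * √s))
  have hHm : Measurable (Function.uncurry H) := by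
    simp only [H, A, Function.uncurry_def]; fun_prop
  have hH0 : ∀ t, ∀ s ∈ Set.Ioi (0:ℝ), ‖H t s‖ = H t s := by
    intro t s hs
    have : 0 < s := hs
    rw [Real.norm_of_nonneg]; positivity
  have hI : ∀ t, ∫ s in Set.Ioi (0:ℝ), H t s = √Real.pi * (Real.exp (-t ^ 2 / 2) / √(A t)) := by
    intro t
    simp only [H]
    rw [integral_const_mul, (integral_inv_sqrt (hA t)).2]; ring
  have hprod : Integrable (Function.uncurry H) ((volume : Measure ℝ).prod (volume.restrict (Set.Ioi 0))) := by
    rw [integrable_prod_iff hHm.aestronglyMeasurable]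
    refine ⟨ae_of_all _ fun t => (integral_inv_sqrt (hA t)).1.const_mul (Real.exp (-t ^ 2 / 2)), ?_⟩
    have e : ∀ t, ∫ s in Set.Ioi (0:ℝ), ‖H t s‖ = √Real.pi * (Real.exp (-t ^ 2 / 2) / √(A t)) := by
      intro t
      rw [setIntegral_congr_fun measurableSet_Ioi (hH0 t), hI]
    simp only [Function.uncurry_apply_pair, e]
    refine Integrable.const_mul ?_ _
    have hg : Integrable (fun t : ℝ => Real.exp (-(1/2) * t ^ 2) / ‖x‖) :=
      (integrable_exp_neg_mul_sq (by norm_num)).div_const _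
    refine hg.mono' ?_ (ae_of_all _ fun t => ?_)
    · apply Measurable.aestronglyMeasurable; simp only [A]; fun_prop
    · have hsq : ‖x‖ ≤ √(A t) := by
        apply Real.le_sqrt_of_sq_le
        have : 0 ≤ t ^ 2 / (2 * Real.pi) := by positivity
        linarith
      rw [Real.norm_of_nonneg (by positivity), show -t ^ 2 / 2 = -(1/2) * t ^ 2 by ring]
      gcongr
  have hS : ∀ s ∈ Set.Ioi (0:ℝ), ∫ t, H t s = 2 * √2 * Real.pi ^ (3/2:ℝ) / √Real.pi⁻¹ * (gaussWeight s * heat s x) := by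
    intro s hs
    have hs0 : 0 < s := hs
    have e : ∀ t, H t s = (Real.exp (-(1 / s) * ‖x‖ ^ 2) / (s * √s)) * Real.exp (-((1 + Real.pi * s) / (2 * Real.pi * s)) * t ^ 2) := by
      intro t
      simp only [H, A]
      have : Real.exp (-(1 / s) * ‖x‖ ^ 2) / (s * √s) * Real.exp (-((1 + Real.pi * s) / (2 * Real.pi * s)) * t ^ 2)
          = (Real.exp (-(1 / s) * ‖x‖ ^ 2) * Real.exp (-((1 + Real.pi * s) / (2 * Real.pi * s)) * t ^ 2)) / (s * √s) := by ring
      rw [this, mul_div_assoc', ← Real.exp_add, ← Real.exp_add]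
      congr 2
      field_simp
      ring
    simp_rw [e]
    rw [integral_const_mul, integral_gaussian]
    have e32 : Real.pi ^ (3/2:ℝ) = Real.pi * √Real.pi := by
      rw [show (3/2:ℝ) = 1 + 1/2 by norm_num, Real.rpow_add hpi, Real.rpow_one, Real.sqrt_eq_rpow]
    have e4 : Real.pi / ((1 + Real.pi * s) / (2 * Real.pi * s)) = (2 * Real.pi ^ 2 * s) / (1 + Real.pi * s) := by
      field_simp
    rw [e4, Real.sqrt_div (by positivity), Real.sqrt_mul (by positivity), Real.sqrt_mul (by positivity),
      Real.sqrt_sq hpi.le, gaussWeight, heat, e32, Real.sqrt_inv]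
    have h1 : 0 < √s := Real.sqrt_pos.2 hs0
    have h2 : 0 < √(1 + Real.pi * s) := Real.sqrt_pos.2 (by positivity)
    have h3 : 0 < √Real.pi := Real.sqrt_pos.2 hpi
    have h4 : √Real.pi ^ 2 = Real.pi := Real.sq_sqrt hpi.le
    field_simp
    rw [h4]
  have key : √Real.pi * ∫ t : ℝ, Real.exp (-t ^ 2 / 2) / √(A t)
      = 2 * √2 * Real.pi ^ (3/2:ℝ) / √Real.pi⁻¹ * ∫ s in Set.Ioi (0:ℝ), gaussWeight s * heat s x := by
    rw [← integral_const_mul, ← integral_const_mul]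
    simp_rw [← hI]
    rw [integral_integral_swap hprod, setIntegral_congr_fun measurableSet_Ioi hS]
  have h3 : 0 < √Real.pi := Real.sqrt_pos.2 hpi
  have h5 : 0 < Real.pi ^ (3/2:ℝ) := by positivity
  have h6 : (0:ℝ) < √2 := by positivity
  rw [Real.sqrt_inv, div_inv_eq_mul] at key
  rw [K]
  change (2 * √2 * Real.pi ^ (3/2:ℝ))⁻¹ * ∫ t : ℝ, Real.exp (-t ^ 2 / 2) / √(A t) = _
  rw [inv_mul_eq_iff_eq_mul₀ (by positivity)]
  apply mul_left_cancel₀ h3.ne'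
  rw [key]; ring


/-! ### Integrating the Gaussian superposition -/

lemma gaussWeight_nonneg (s : ℝ) : 0 ≤ gaussWeight s := by unfold gaussWeight; positivity

/-- Of the three bounds on the weight, this one serves for small s and for the upper bound on the
symbol, the s^{-1/2} decay for large s, and the linear bound near s = 0 for the high-frequency
asymptotics. -/
lemma gaussWeight_le_half {s : ℝ} (hs : 0 ≤ s) : gaussWeight s ≤ 1 / 2 := by
  unfold gaussWeight
  have : 1 ≤ √(1 + Real.pi * s) := by
    rw [Real.one_le_sqrt]; have := mul_nonneg Real.pi_pos.le hs; linarith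
  gcongr; linarith

lemma gaussWeight_le_rpow {s : ℝ} (hs : 0 < s) : gaussWeight s ≤ s ^ (-(1/2) : ℝ) := by
  unfold gaussWeight
  rw [Real.rpow_neg hs.le, ← Real.sqrt_eq_rpow, ← one_div]
  have h1 : √s ≤ √(1 + Real.pi * s) := by
    apply Real.sqrt_le_sqrt; nlinarith [Real.pi_gt_three]
  have h2 : 0 < √s := Real.sqrt_pos.2 hs
  apply one_div_le_one_div_of_le h2; linarith

lemma half_sub_gaussWeight_le {s : ℝ} (hs : 0 ≤ s) : 1 / 2 - gaussWeight s ≤ Real.pi / 4 * s := by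
  unfold gaussWeight
  set r := √(1 + Real.pi * s) with hr
  have hps := mul_nonneg Real.pi_pos.le hs
  have h1 : 1 ≤ r := by rw [hr, Real.one_le_sqrt]; linarith
  have h2 : r ^ 2 = 1 + Real.pi * s := Real.sq_sqrt (by linarith)
  have h3 : 1 / 2 - 1 / (2 * r) = (r - 1) / (2 * r) := by field_simp
  rw [h3, div_le_iff₀ (by linarith)]
  nlinarith [mul_nonneg hps (by linarith : 0 ≤ r - 1)]

lemma measurable_gaussWeight : Measurable gaussWeight := by unfold gaussWeight; fun_prop

lemma measurable_heat : Measurable (Function.uncurry heat) := by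
  unfold heat Function.uncurry; fun_prop

lemma heat_nonneg {s : ℝ} (hs : 0 < s) (x : Plane) : 0 ≤ heat s x := by
  unfold heat; have := Real.pi_pos; positivity

lemma heat_le {s : ℝ} (hs : 0 < s) (x : Plane) : heat s x ≤ 1 / (Real.pi * s) := by
  unfold heat
  have := Real.pi_pos
  gcongr
  rw [Real.exp_le_one_iff]
  have : 0 ≤ 1 / s * ‖x‖ ^ 2 := by positivity
  linarith

lemma integrable_heat {s : ℝ} (hs : 0 < s) : Integrable (heat s) :=
  (integrable_gaussian (one_div_pos.2 hs)).div_const _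

lemma integral_heat {s : ℝ} (hs : 0 < s) : ∫ x, heat s x = 1 := by
  unfold heat
  rw [integral_div, integral_gaussian_plane (one_div_pos.2 hs)]
  have := Real.pi_pos
  field_simp

lemma fourier_heat {s : ℝ} (hs : 0 < s) (ξ : Plane) :
    𝓕 (fun x => (heat s x : ℂ)) ξ = (Real.exp (-(Real.pi ^ 2 * ‖ξ‖ ^ 2) * s) : ℝ) := by
  have e : (fun x => (heat s x : ℂ)) = fun x => ((1 / (Real.pi * s) : ℝ) : ℂ) * cgauss (1 / s) x := by
    ext x; simp only [heat, cgauss]; push_cast; ring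
  have hpi := Real.pi_pos
  rw [e, fourier_const_mul, fourier_cgauss (one_div_pos.2 hs), ← Complex.ofReal_mul]
  congr 1
  rw [show -(Real.pi ^ 2 / (1 / s)) * ‖ξ‖ ^ 2 = -(Real.pi ^ 2 * ‖ξ‖ ^ 2) * s by field_simp]
  field_simp

section Triple
variable {ρ ψ : Plane → ℝ} {C : ℝ}

lemma integrable_heat_prod (h1 : Integrable ρ) (hψ : Integrable ψ) {s : ℝ} (hs : 0 < s) :
    Integrable (fun z : Plane × Plane => heat s (z.1 - z.2) * (ψ z.1 * ρ z.2)) (volume.prod volume) := by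
  refine (hψ.mul_prod h1).bdd_mul (c := 1 / (Real.pi * s)) ?_ ?_
  · have : Measurable (heat s) := measurable_heat.of_uncurry_left
    exact (this.comp (measurable_fst.sub measurable_snd)).aestronglyMeasurable
  · filter_upwards with z
    rw [Real.norm_of_nonneg (heat_nonneg hs _)]
    exact heat_le hs _

/-- Heat kernels have integral one and ψ is bounded: this bound is uniform in s and is used near
zero. -/
lemma integral_norm_heat_prod_le (h1 : Integrable ρ) (hψ : Integrable ψ) (hC : ∀ x, |ψ x| ≤ C) {s : ℝ} (hs : 0 < s) :
    ∫ z : Plane × Plane, ‖heat s (z.1 - z.2) * (ψ z.1 * ρ z.2)‖ ∂(volume.prod volume) ≤ C * ∫ y, ‖ρ y‖ := by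
  rw [integral_prod_symm _ (integrable_heat_prod h1 hψ hs).norm, ← integral_const_mul]
  refine integral_mono_of_nonneg (ae_of_all _ fun y => integral_nonneg fun x => norm_nonneg _) (h1.norm.const_mul C)
    (ae_of_all _ fun y => ?_)
  have hsub : Integrable (fun x => heat s (x - y)) := (integrable_heat hs).comp_sub_right y
  calc ∫ x, ‖heat s (x - y) * (ψ x * ρ y)‖ ≤ ∫ x, heat s (x - y) * (C * ‖ρ y‖) := by
        refine integral_mono_of_nonneg (ae_of_all _ fun x => norm_nonneg _) (hsub.mul_const _) (ae_of_all _ fun x => ?_)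
        simp only [norm_mul]
        rw [Real.norm_of_nonneg (heat_nonneg hs _)]
        have := hC x
        have := heat_nonneg hs (x - y)
        simp only [Real.norm_eq_abs]
        gcongr
    _ = C * ‖ρ y‖ := by
        rw [integral_mul_const, integral_sub_right_eq_self (heat s), integral_heat hs, one_mul]

/-- The supremum bound 1/(πs) of the heat kernel gives the decay used for large s. -/
lemma integral_norm_heat_prod_le' (h1 : Integrable ρ) (hψ : Integrable ψ) {s : ℝ} (hs : 0 < s) :
    ∫ z : Plane × Plane, ‖heat s (z.1 - z.2) * (ψ z.1 * ρ z.2)‖ ∂(volume.prod volume)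
      ≤ ((∫ x, ‖ψ x‖) * ∫ y, ‖ρ y‖) * s⁻¹ := by
  have hn : Integrable (fun z : Plane × Plane => ‖ψ z.1‖ * ‖ρ z.2‖) (volume.prod volume) := hψ.norm.mul_prod h1.norm
  calc _ ≤ ∫ z : Plane × Plane, s⁻¹ * (‖ψ z.1‖ * ‖ρ z.2‖) ∂(volume.prod volume) := by
        refine integral_mono_of_nonneg (ae_of_all _ fun x => norm_nonneg _) (hn.const_mul _) (ae_of_all _ fun z => ?_)
        simp only [norm_mul]
        rw [Real.norm_of_nonneg (heat_nonneg hs _)]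
        refine mul_le_mul_of_nonneg_right ((heat_le hs _).trans ?_) (by positivity)
        rw [← one_div]
        apply one_div_le_one_div_of_le hs
        nlinarith [Real.pi_gt_three]
    _ = _ := by
        rw [integral_const_mul, integral_prod_mul (fun x => ‖ψ x‖) (fun y => ‖ρ y‖)]; ring

/-- On (0, 1] the uniform bound suffices; beyond 1 the weight s^{-1/2} and the decay s⁻¹ combine to
an integrable power. Neither bound works on the whole half-line. -/
lemma integrable_triple (h1 : Integrable ρ) (hψ : Integrable ψ) (hC : ∀ x, |ψ x| ≤ C) :
    Integrable (fun z : (Plane × Plane) × ℝ => gaussWeight z.2 * (heat z.2 (z.1.1 - z.1.2) * (ψ z.1.1 * ρ z.1.2)))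
      ((volume.prod volume).prod (volume.restrict (Set.Ioi 0))) := by
  have hm : AEStronglyMeasurable (fun z : (Plane × Plane) × ℝ => gaussWeight z.2 * (heat z.2 (z.1.1 - z.1.2) * (ψ z.1.1 * ρ z.1.2)))
      (((volume : Measure Plane).prod (volume : Measure Plane)).prod (volume.restrict (Set.Ioi (0:ℝ)))) := by
    refine (measurable_gaussWeight.comp measurable_snd).aestronglyMeasurable.mul (.mul ?_ ?_)
    · exact (measurable_heat.comp (measurable_snd.prodMk
        ((measurable_fst.comp measurable_fst).sub (measurable_snd.comp measurable_fst)))).aestronglyMeasurable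
    · exact (hψ.mul_prod h1).aestronglyMeasurable.comp_fst
  rw [integrable_prod_iff' hm]
  refine ⟨?_, ?_⟩
  · filter_upwards [ae_restrict_mem measurableSet_Ioi] with s hs
    exact (integrable_heat_prod h1 hψ hs).const_mul _
  · have hm2 : AEStronglyMeasurable (fun s : ℝ => ∫ z : Plane × Plane, ‖gaussWeight s * (heat s (z.1 - z.2) * (ψ z.1 * ρ z.2))‖ ∂(volume.prod volume))
        (volume.restrict (Set.Ioi (0:ℝ))) := hm.norm.prod_swap.integral_prod_right'
    have e : ∀ s : ℝ, ∫ z : Plane × Plane, ‖gaussWeight s * (heat s (z.1 - z.2) * (ψ z.1 * ρ z.2))‖ ∂(volume.prod volume)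
        = gaussWeight s * ∫ z : Plane × Plane, ‖heat s (z.1 - z.2) * (ψ z.1 * ρ z.2)‖ ∂(volume.prod volume) := by
      intro s
      rw [← integral_const_mul]
      congr 1; ext z
      rw [norm_mul, Real.norm_of_nonneg (gaussWeight_nonneg s)]
    have hnn : ∀ s : ℝ, 0 ≤ ∫ z : Plane × Plane, ‖heat s (z.1 - z.2) * (ψ z.1 * ρ z.2)‖ ∂(volume.prod volume) :=
      fun s => integral_nonneg fun z => norm_nonneg _
    have hu : Set.Ioi (0:ℝ) = Set.Ioc 0 1 ∪ Set.Ioi 1 := (Set.Ioc_union_Ioi_eq_Ioi zero_le_one).symm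
    change IntegrableOn _ (Set.Ioi (0:ℝ)) volume
    rw [hu]
    refine IntegrableOn.union ?_ ?_
    · refine Integrable.mono' (g := fun _ => C * ∫ y, ‖ρ y‖) (integrableOn_const (by simp)) (hm2.mono_set Set.Ioc_subset_Ioi_self) ?_
      filter_upwards [ae_restrict_mem measurableSet_Ioc] with s hs
      rw [Real.norm_of_nonneg (integral_nonneg fun z => norm_nonneg _), e]
      have h2 := integral_norm_heat_prod_le h1 hψ hC hs.1
      have h3 := gaussWeight_le_half hs.1.le
      have h4 := hnn s
      have h5 := gaussWeight_nonneg s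
      nlinarith
    · have hi : IntegrableOn (fun s : ℝ => ((∫ x, ‖ψ x‖) * ∫ y, ‖ρ y‖) * s ^ (-(3/2) : ℝ)) (Set.Ioi 1) :=
        (integrableOn_Ioi_rpow_of_lt (by norm_num) one_pos).const_mul _
      refine Integrable.mono' hi (hm2.mono_set (Set.Ioi_subset_Ioi zero_le_one)) ?_
      filter_upwards [ae_restrict_mem measurableSet_Ioi] with s hs
      have hs0 : 0 < s := lt_trans one_pos hs
      rw [Real.norm_of_nonneg (integral_nonneg fun z => norm_nonneg _), e]
      have h2 := integral_norm_heat_prod_le' h1 hψ hs0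
      have h3 := gaussWeight_le_rpow hs0
      have h6 : s ^ (-(3/2) : ℝ) = s ^ (-(1/2) : ℝ) * s⁻¹ := by
        rw [← Real.rpow_neg_one s, ← Real.rpow_add hs0]; norm_num
      rw [h6]
      calc _ ≤ s ^ (-(1/2) : ℝ) * (((∫ x, ‖ψ x‖) * ∫ y, ‖ρ y‖) * s⁻¹) :=
            mul_le_mul h3 h2 (hnn s) (by positivity)
        _ = _ := by ring

/-- Fubini in three variables, with K replaced by its superposition off the null set x = y. -/
lemma integral_KConv_mul (h1 : Integrable ρ) (hψ : Integrable ψ) (hC : ∀ x, |ψ x| ≤ C) :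
    ∫ x, KConv ρ x * ψ x = ∫ s in Set.Ioi (0:ℝ), gaussWeight s * ∫ x, ψ x * ∫ y, heat s y * ρ (x - y) := by
  have hT := integrable_triple h1 hψ hC
  have hL := integral_prod _ hT
  have hR := integral_prod_symm _ hT
  rw [hR] at hL
  have hl : ∫ z : Plane × Plane, (∫ s in Set.Ioi (0:ℝ), gaussWeight s * (heat s (z.1 - z.2) * (ψ z.1 * ρ z.2))) ∂(volume.prod volume)
      = ∫ x, KConv ρ x * ψ x := by
    rw [integral_prod _ hT.integral_prod_left]
    congr 1; ext x
    rw [KConv, ← integral_mul_const]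
    refine integral_congr_ae ?_
    have : ∀ᵐ y : Plane, y ≠ x := by simp [ae_iff]
    filter_upwards [this] with y hy
    rw [K_eq_integral (sub_ne_zero.2 hy.symm), mul_assoc, ← integral_mul_const]
    congr 1; ext s; ring
  rw [← hl, ← hL]
  refine setIntegral_congr_fun measurableSet_Ioi fun s hs => ?_
  simp only
  rw [integral_const_mul, integral_prod _ (integrable_heat_prod h1 hψ hs)]
  congr 2; ext x
  have : ∫ y, heat s (x - y) * (ψ x * ρ y) = ∫ y, heat s y * (ψ x * ρ (x - y)) := by
    rw [← integral_sub_left_eq_self _ volume x]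
    simp
  rw [this, ← integral_const_mul]
  congr 1; ext y; ring

/-- For each fixed s the heat kernel is bounded and integrable, so Plancherel applies to its
convolution; K itself decays only like 1/|x| and is not integrable. -/
lemma integral_mul_heat_conv (h1 : Integrable ρ) (hψ : Integrable ψ) (hC : ∀ x, |ψ x| ≤ C) {s : ℝ} (hs : 0 < s) :
    ((∫ x, ψ x * ∫ y, heat s y * ρ (x - y) : ℝ) : ℂ) =
      ∫ ξ : Plane, (starRingEnd ℂ) (𝓕 (fun x => (ψ x : ℂ)) ξ) *
        ((Real.exp (-(Real.pi ^ 2 * ‖ξ‖ ^ 2) * s) : ℝ) * 𝓕 (fun x => (ρ x : ℂ)) ξ) := by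
  have hψ1 : Integrable (fun x => (ψ x : ℂ)) := hψ.ofReal
  have hψ2 : MemLp (fun x => (ψ x : ℂ)) 2 volume :=
    memLp_two_of_bounded hψ1 (C := C) fun x => by rw [Complex.norm_real]; exact hC x
  obtain ⟨hg2, hg1, hgF⟩ := convolution_bounded (k := fun x => (heat s x : ℂ)) (ρ := fun x => (ρ x : ℂ))
    (integrable_heat hs).ofReal h1.ofReal (C := 1 / (Real.pi * s)) (fun x => by
      rw [Complex.norm_real, Real.norm_of_nonneg (heat_nonneg hs x)]; exact heat_le hs x)
  have hp := Lp.inner_fourier_eq (hψ2.toLp _) (hg2.toLp _)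
  rw [L2.inner_def, L2.inner_def] at hp
  have hr : ∫ x, inner ℂ ((hψ2.toLp _ : L2) x) ((hg2.toLp _ : L2) x) = ((∫ x, ψ x * ∫ y, heat s y * ρ (x - y) : ℝ) : ℂ) := by
    rw [← integral_complex_ofReal]
    apply integral_congr_ae
    filter_upwards [hψ2.coeFn_toLp, hg2.coeFn_toLp] with x e1 e2
    rw [e1, e2, RCLike.inner_apply, Complex.ofReal_mul, ← integral_complex_ofReal]
    simp [mul_comm]
  rw [← hr, ← hp]
  apply integral_congr_ae
  filter_upwards [fourier_toLp_ae_eq hψ1 hψ2, fourier_toLp_ae_eq hg1 hg2] with ξ e1 e2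
  rw [e1, e2, hgF, fourier_heat hs, RCLike.inner_apply]
  ring

end Triple

/-! ### The dipolar potential as a Fourier multiplier -/

/-- The Fourier transform of the kernel `K`. -/
def kerSymbol (ξ : Plane) : ℝ :=
  ∫ s in Set.Ioi (0:ℝ), gaussWeight s * Real.exp (-(Real.pi ^ 2 * ‖ξ‖ ^ 2) * s)

lemma measurable_uncurry_kerSymbol :
    Measurable (Function.uncurry fun (ξ : Plane) (s : ℝ) => gaussWeight s * Real.exp (-(Real.pi ^ 2 * ‖ξ‖ ^ 2) * s)) := by
  have := measurable_gaussWeight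
  unfold Function.uncurry; fun_prop

lemma measurable_kerSymbol : Measurable kerSymbol :=
  (measurable_uncurry_kerSymbol.stronglyMeasurable.integral_prod_right (ν := volume.restrict (Set.Ioi 0))).measurable

lemma kerSymbol_nonneg (ξ : Plane) : 0 ≤ kerSymbol ξ :=
  integral_nonneg fun s => mul_nonneg (gaussWeight_nonneg s) (Real.exp_pos _).le

lemma integrableOn_kerSymbol {ξ : Plane} (hξ : ξ ≠ 0) :
    IntegrableOn (fun s => gaussWeight s * Real.exp (-(Real.pi ^ 2 * ‖ξ‖ ^ 2) * s)) (Set.Ioi 0) := by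
  have h0 : 0 < ‖ξ‖ := norm_pos_iff.2 hξ
  have hpi := Real.pi_pos
  refine Integrable.mono' ((integrableOn_exp_decay (a := Real.pi ^ 2 * ‖ξ‖ ^ 2) (by positivity) 0).const_mul (1/2))
    measurable_uncurry_kerSymbol.of_uncurry_left.aestronglyMeasurable ?_
  filter_upwards [ae_restrict_mem measurableSet_Ioi] with s hs
  rw [Real.norm_of_nonneg (mul_nonneg (gaussWeight_nonneg s) (Real.exp_pos _).le)]
  exact mul_le_mul_of_nonneg_right (gaussWeight_le_half (le_of_lt hs)) (Real.exp_pos _).le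

/-- With A = π²|ξ|², replacing the weight by its upper bound 1/2 leaves the integral 1/(2A). -/
lemma kerSymbol_mul_le (ξ : Plane) : 2 * Real.pi ^ 2 * ‖ξ‖ ^ 2 * kerSymbol ξ ≤ 1 := by
  by_cases hξ : ξ = 0
  · simp [hξ]
  have h0 : 0 < ‖ξ‖ := norm_pos_iff.2 hξ
  have hpi := Real.pi_pos
  have ha : 0 < Real.pi ^ 2 * ‖ξ‖ ^ 2 := by positivity
  have : kerSymbol ξ ≤ ∫ s in Set.Ioi (0:ℝ), 1 / 2 * Real.exp (-(Real.pi ^ 2 * ‖ξ‖ ^ 2) * s) := by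
    refine setIntegral_mono_on (integrableOn_kerSymbol hξ) ((integrableOn_exp_decay ha 0).const_mul _) measurableSet_Ioi fun s hs => ?_
    exact mul_le_mul_of_nonneg_right (gaussWeight_le_half (le_of_lt hs)) (Real.exp_pos _).le
  rw [integral_const_mul, integral_exp_decay ha] at this
  simp only [mul_zero, Real.exp_zero] at this
  calc _ ≤ 2 * Real.pi ^ 2 * ‖ξ‖ ^ 2 * (1 / 2 * (1 / (Real.pi ^ 2 * ‖ξ‖ ^ 2))) := by gcongr
    _ = 1 := by field_simp

/-- The weight falls short of 1/2 by at most πs/4, and the integral of s e^{-As} is A⁻². Together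
with the upper bound, the transform of K is 1/(2π²|ξ|²) up to a relative error of order |ξ|⁻². -/
lemma one_sub_kerSymbol_mul_le {ξ : Plane} (hξ : ξ ≠ 0) :
    1 - 2 * Real.pi ^ 2 * ‖ξ‖ ^ 2 * kerSymbol ξ ≤ 1 / (2 * Real.pi * ‖ξ‖ ^ 2) := by
  have h0 : 0 < ‖ξ‖ := norm_pos_iff.2 hξ
  have hpi := Real.pi_pos
  set a := Real.pi ^ 2 * ‖ξ‖ ^ 2 with hadef
  have ha : 0 < a := by positivity
  have hI1 := integrableOn_exp_decay ha 0
  have hI2 : IntegrableOn (fun s : ℝ => s ^ ((2:ℝ) - 1) * Real.exp (-(a * s))) (Set.Ioi 0) := by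
    have := integrableOn_rpow_mul_exp_neg_mul_rpow (s := (2:ℝ) - 1) (p := 1) (by norm_num) (by norm_num) ha
    refine this.congr_fun (fun t ht => ?_) measurableSet_Ioi
    simp
  have hV : ∫ s in Set.Ioi (0:ℝ), s ^ ((2:ℝ) - 1) * Real.exp (-(a * s)) = (1 / a) ^ 2 := by
    rw [Real.integral_rpow_mul_exp_neg_mul_Ioi (by norm_num) ha]
    have : Real.Gamma 2 = 1 := Real.Gamma_two
    rw [this, mul_one]; norm_cast
  have : ∫ s in Set.Ioi (0:ℝ), (1 / 2 * Real.exp (-a * s) - Real.pi / 4 * (s ^ ((2:ℝ) - 1) * Real.exp (-(a * s)))) ≤ kerSymbol ξ := by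
    refine setIntegral_mono_on ((hI1.const_mul _).sub (hI2.const_mul _)) (integrableOn_kerSymbol hξ) measurableSet_Ioi fun s hs => ?_
    have h1 := half_sub_gaussWeight_le (le_of_lt hs)
    have h2 := Real.exp_pos (-a * s)
    have h3 : s ^ ((2:ℝ) - 1) = s := by norm_num
    change _ ≤ gaussWeight s * Real.exp (-a * s)
    rw [h3, show -(a * s) = -a * s by ring]
    nlinarith
  rw [integral_sub (hI1.const_mul _) (hI2.const_mul _), integral_const_mul, integral_const_mul, hV, integral_exp_decay ha] at this
  simp only [mul_zero, Real.exp_zero] at this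
  calc _ ≤ 1 - 2 * a * (1 / 2 * (1 / a) - Real.pi / 4 * (1 / a) ^ 2) := by
        have h6 : 2 * a * (1 / 2 * (1 / a) - Real.pi / 4 * (1 / a) ^ 2) ≤ 2 * a * kerSymbol ξ := by gcongr
        rw [hadef] at h6 ⊢; linarith
    _ = 1 / (2 * Real.pi * ‖ξ‖ ^ 2) := by rw [hadef]; field_simp; ring

/-- The quadratic form of the differential operator defining the dipolar potential. -/
def potForm (n : ℝ) (ξ : Plane) : ℝ := (1 - 2 * n ^ 2) * ξ 0 ^ 2 - n ^ 2 * ξ 1 ^ 2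

/-- A bound for `potForm n` on the unit circle. -/
def potConst (n : ℝ) : ℝ := |1 - 2 * n ^ 2| + n ^ 2

lemma potConst_nonneg (n : ℝ) : 0 ≤ potConst n := by unfold potConst; positivity

lemma abs_potForm_le (n : ℝ) (ξ : Plane) : |potForm n ξ| ≤ potConst n * ‖ξ‖ ^ 2 := by
  rw [norm_sq_plane, potForm, potConst]
  have h0 := sq_nonneg (ξ 0)
  have h1 := sq_nonneg (ξ 1)
  have h2 := le_abs_self (1 - 2 * n ^ 2)
  have h3 := neg_abs_le (1 - 2 * n ^ 2)
  have h4 := abs_nonneg (1 - 2 * n ^ 2)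
  have h5 := sq_nonneg n
  rw [abs_le]; constructor <;> nlinarith [mul_nonneg h4 h0, mul_nonneg h4 h1, mul_nonneg h5 h0, mul_nonneg h5 h1]

lemma continuous_potForm (n : ℝ) : Continuous (potForm n) := by unfold potForm; fun_prop

/-- The symbol of the map sending a density to its dipolar potential. -/
def potSymbol (n : ℝ) : Symbol where
  toFun ξ := -(4 * Real.pi ^ 2 * potForm n ξ * kerSymbol ξ)
  measurable := (((continuous_potForm n).measurable.const_mul _).mul measurable_kerSymbol).neg
  bound := 2 * potConst n
  le_bound ξ := by
    have h1 := abs_potForm_le n ξ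
    have h2 := kerSymbol_mul_le ξ
    have h3 := kerSymbol_nonneg ξ
    rw [abs_neg, abs_mul, abs_mul, abs_of_nonneg (by positivity : 0 ≤ 4 * Real.pi ^ 2), abs_of_nonneg h3]
    calc _ ≤ 4 * Real.pi ^ 2 * (potConst n * ‖ξ‖ ^ 2) * kerSymbol ξ := by gcongr
      _ = 2 * potConst n * (2 * Real.pi ^ 2 * ‖ξ‖ ^ 2 * kerSymbol ξ) := by ring
      _ ≤ 2 * potConst n * 1 := mul_le_mul_of_nonneg_left h2 (by have := potConst_nonneg n; positivity)
      _ = _ := mul_one _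

lemma fourier_pderiv_of_isTest {φ : Plane → ℝ} (h : IsTest φ) (i : Fin 2) (ξ : Plane) :
    𝓕 (fun x => (pderiv i φ x : ℂ)) ξ = (2 * Real.pi * ξ i : ℝ) * Complex.I * 𝓕 (fun x => (φ x : ℂ)) ξ := by
  have hd : Differentiable ℝ φ := h.differentiable
  have e : ∀ x, fderiv ℝ (fun x => (φ x : ℂ)) x (EuclideanSpace.single i 1) = (pderiv i φ x : ℂ) := by
    intro x
    have h1 : HasFDerivAt (fun x => (φ x : ℂ)) (Complex.ofRealCLM.comp (fderiv ℝ φ x)) x :=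
      Complex.ofRealCLM.hasFDerivAt.comp x (hd x).hasFDerivAt
    rw [h1.fderiv]; rfl
  have h2 : Integrable (fun x => (φ x : ℂ)) := h.integrable.ofReal
  have h3 : Integrable (fun x => (pderiv i φ x : ℂ)) := (h.pderiv i).integrable.ofReal
  have := fourier_pderiv h2 (fun x => (Complex.ofRealCLM.hasFDerivAt.comp x (hd x).hasFDerivAt).differentiableAt) i
    (by simpa only [e] using h3) ξ
  simpa only [e] using this

/-- The differential operator defining the dipolar potential. -/
def potOp (n : ℝ) (φ : Plane → ℝ) (x : Plane) : ℝ :=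
  (1 - 2 * n ^ 2) * pderiv 0 (pderiv 0 φ) x - n ^ 2 * pderiv 1 (pderiv 1 φ) x

lemma IsTest.integrable_potOp {φ : Plane → ℝ} (h : IsTest φ) (n : ℝ) : Integrable (potOp n φ) :=
  (((h.pderiv 0).pderiv 0).integrable.const_mul _).sub (((h.pderiv 1).pderiv 1).integrable.const_mul _)

lemma IsTest.exists_bound_potOp {φ : Plane → ℝ} (h : IsTest φ) (n : ℝ) : ∃ C, ∀ x, |potOp n φ x| ≤ C := by
  obtain ⟨A, -, hA⟩ := ((h.pderiv 0).pderiv 0).exists_bound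
  obtain ⟨B, -, hB⟩ := ((h.pderiv 1).pderiv 1).exists_bound
  refine ⟨|1 - 2 * n ^ 2| * A + |n ^ 2| * B, fun x => ?_⟩
  refine (abs_sub _ _).trans ?_
  rw [abs_mul, abs_mul]
  exact add_le_add (mul_le_mul_of_nonneg_left (hA x) (abs_nonneg _)) (mul_le_mul_of_nonneg_left (hB x) (abs_nonneg _))

lemma fourier_potOp {φ : Plane → ℝ} (h : IsTest φ) (n : ℝ) (ξ : Plane) :
    𝓕 (fun x => (potOp n φ x : ℂ)) ξ = (-(4 * Real.pi ^ 2 * potForm n ξ) : ℝ) * 𝓕 (fun x => (φ x : ℂ)) ξ := by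
  have e : (fun x => (potOp n φ x : ℂ)) = fun x => ((1 - 2 * n ^ 2 : ℝ) : ℂ) * (pderiv 0 (pderiv 0 φ) x : ℂ)
      - ((n ^ 2 : ℝ) : ℂ) * (pderiv 1 (pderiv 1 φ) x : ℂ) := by
    ext x; simp [potOp]
  have i0 : Integrable (fun x => (pderiv 0 (pderiv 0 φ) x : ℂ)) := ((h.pderiv 0).pderiv 0).integrable.ofReal
  have i1 : Integrable (fun x => (pderiv 1 (pderiv 1 φ) x : ℂ)) := ((h.pderiv 1).pderiv 1).integrable.ofReal
  rw [e, fourier_sub_apply (i0.const_mul _) (i1.const_mul _), fourier_const_mul, fourier_const_mul,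
    fourier_pderiv_of_isTest (h.pderiv 0), fourier_pderiv_of_isTest (h.pderiv 1), fourier_pderiv_of_isTest h,
    fourier_pderiv_of_isTest h, potForm]
  have hI := Complex.I_sq
  push_cast
  linear_combination (4 * (Real.pi : ℂ) ^ 2 * ((1 - 2 * (n:ℂ) ^ 2) * (ξ 0 : ℂ) ^ 2 - (n:ℂ) ^ 2 * (ξ 1 : ℂ) ^ 2) * 𝓕 (fun x => (φ x : ℂ)) ξ) * hI

/-- The derivatives produce -4π² `potForm`, the integral over s of the Gaussian factors produces
`kerSymbol`, and the boundedness of the product of these two justifies Fubini. -/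
lemma integral_KConv_potOp {ρ : Plane → ℝ} (h1 : Integrable ρ) (h2 : MemLp ρ 2 volume) (n : ℝ)
    {φ : Plane → ℝ} (hφ : IsTest φ) :
    ((∫ x, KConv ρ x * potOp n φ x : ℝ) : ℂ) = ∫ ξ, ((potSymbol n).toFun ξ : ℂ) *
      ((starRingEnd ℂ) (𝓕 (fun x => (φ x : ℂ)) ξ) * 𝓕 (fun x => (ρ x : ℂ)) ξ) := by
  obtain ⟨C, hC⟩ := hφ.exists_bound_potOp n
  have hpi := Real.pi_pos
  have h1c : Integrable (fun x => (ρ x : ℂ)) := h1.ofReal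
  have h2c : MemLp (fun x => (ρ x : ℂ)) 2 volume := h2.ofReal
  have hφ1 : Integrable (fun x => (φ x : ℂ)) := hφ.integrable.ofReal
  have hφ2 : MemLp (fun x => (φ x : ℂ)) 2 volume := (hφ.memLp 2).ofReal
  set P : Plane → ℂ := fun ξ => (starRingEnd ℂ) (𝓕 (fun x => (φ x : ℂ)) ξ) * 𝓕 (fun x => (ρ x : ℂ)) ξ with hP
  have hPc : Continuous P := (Complex.continuous_conj.comp (continuous_fourier hφ1)).mul (continuous_fourier h1c)
  have hPi : Integrable P := by
    have := (memLp_fourier h1c h2c).integrable_mul (memLp_fourier hφ1 hφ2).star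
    refine this.congr (ae_of_all _ fun ξ => ?_)
    simp only [hP, Pi.mul_apply, Pi.star_apply, RCLike.star_def]; ring
  let F : Plane → ℝ → ℂ := fun ξ s => ((gaussWeight s * Real.exp (-(Real.pi ^ 2 * ‖ξ‖ ^ 2) * s) : ℝ) : ℂ) *
    ((-(4 * Real.pi ^ 2 * potForm n ξ) : ℝ) * P ξ)
  have hpotm := (continuous_potForm n).measurable
  have hFm : Measurable (Function.uncurry F) := by
    have := measurable_uncurry_kerSymbol
    have hPm := hPc.measurable
    refine (Complex.measurable_ofReal.comp this).mul (.mul ?_ (hPm.comp measurable_fst))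
    exact Complex.measurable_ofReal.comp (((hpotm.comp measurable_fst).const_mul _).neg)
  have hnorm : ∀ ξ s, ‖F ξ s‖ = gaussWeight s * Real.exp (-(Real.pi ^ 2 * ‖ξ‖ ^ 2) * s) *
      (4 * Real.pi ^ 2 * |potForm n ξ| * ‖P ξ‖) := by
    intro ξ s
    simp only [F]
    rw [norm_mul, norm_mul, Complex.norm_real, Complex.norm_real,
      Real.norm_of_nonneg (mul_nonneg (gaussWeight_nonneg s) (Real.exp_pos _).le), Real.norm_eq_abs, abs_neg, abs_mul,
      abs_of_nonneg (by positivity : 0 ≤ 4 * Real.pi ^ 2)]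
  have hF : Integrable (Function.uncurry F) ((volume : Measure Plane).prod (volume.restrict (Set.Ioi 0))) := by
    rw [integrable_prod_iff hFm.aestronglyMeasurable]
    refine ⟨?_, ?_⟩
    · filter_upwards [ae_ne_zero_plane] with ξ hξ
      have hk : IntegrableOn (fun s => ((gaussWeight s * Real.exp (-(Real.pi ^ 2 * ‖ξ‖ ^ 2) * s) : ℝ) : ℂ)) (Set.Ioi 0) :=
        (integrableOn_kerSymbol hξ).ofReal
      exact hk.mul_const ((-(4 * Real.pi ^ 2 * potForm n ξ) : ℝ) * P ξ)
    · simp only [Function.uncurry_apply_pair, hnorm]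
      simp_rw [integral_mul_const]
      refine (hPi.norm.const_mul (2 * potConst n)).mono' ?_ (ae_of_all _ fun ξ => ?_)
      · exact (measurable_kerSymbol.mul (((hpotm.abs).const_mul _).mul hPc.measurable.norm)).aestronglyMeasurable
      · change ‖kerSymbol ξ * (4 * Real.pi ^ 2 * |potForm n ξ| * ‖P ξ‖)‖ ≤ _
        have := (potSymbol n).le_bound ξ
        have h3 := kerSymbol_nonneg ξ
        simp only [potSymbol] at this
        rw [abs_neg, abs_mul, abs_mul, abs_of_nonneg (by positivity : 0 ≤ 4 * Real.pi ^ 2), abs_of_nonneg h3] at this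
        rw [Real.norm_of_nonneg (by positivity)]
        nlinarith [mul_le_mul_of_nonneg_right this (norm_nonneg (P ξ))]
  have hsw := integral_integral_swap hF
  rw [integral_KConv_mul h1 (hφ.integrable_potOp n) hC, ← integral_complex_ofReal]
  have hR : ∫ s in Set.Ioi (0:ℝ), ((gaussWeight s * ∫ x, potOp n φ x * ∫ y, heat s y * ρ (x - y) : ℝ) : ℂ)
      = ∫ s in Set.Ioi (0:ℝ), ∫ ξ, F ξ s := by
    refine setIntegral_congr_fun measurableSet_Ioi fun s hs => ?_
    rw [Complex.ofReal_mul, integral_mul_heat_conv h1 (hφ.integrable_potOp n) hC hs, ← integral_const_mul]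
    congr 1; ext ξ
    simp only [F, hP]
    rw [fourier_potOp hφ, map_mul, Complex.conj_ofReal]
    push_cast; ring
  rw [hR, ← hsw]
  congr 1; ext ξ
  simp only [F]
  rw [integral_mul_const, integral_complex_ofReal]
  change (kerSymbol ξ : ℂ) * _ = _
  simp only [potSymbol]
  push_cast; ring

/-- The dipolar potential of a density. -/
def potLimit (n : ℝ) {ρ : Plane → ℝ} (h2 : MemLp ρ 2 volume) (x : Plane) : ℝ :=
  ((potSymbol n).op (h2.ofReal.toLp (fun x => (ρ x : ℂ))) x).re

/-- Since φ lies in L², its pairing with the multiplier is computed on the Fourier side by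
`Symbol.inner_op`, where it coincides with the value found in `integral_KConv_potOp`. -/
theorem isDipolarPotential_potLimit (n : ℝ) {ρ : Plane → ℝ} (h1 : Integrable ρ) (h2 : MemLp ρ 2 volume) :
    IsDipolarPotential n ρ (potLimit n h2) := by
  refine ⟨(Lp.memLp ((potSymbol n).op (h2.ofReal.toLp (fun x => (ρ x : ℂ))))).re, fun φ hφ => ?_⟩
  have h1c : Integrable (fun x => (ρ x : ℂ)) := h1.ofReal
  have h2c : MemLp (fun x => (ρ x : ℂ)) 2 volume := h2.ofReal
  have hφ1 : Integrable (fun x => (φ x : ℂ)) := hφ.integrable.ofReal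
  have hφ2 : MemLp (fun x => (φ x : ℂ)) 2 volume := (hφ.memLp 2).ofReal
  have e := (potSymbol n).inner_op (hφ2.toLp _) (h2c.toLp _)
  have e2 : ∫ ξ, ((potSymbol n).toFun ξ : ℂ) * ((starRingEnd ℂ) ((𝓕 (hφ2.toLp _) : L2) ξ) * (𝓕 (h2c.toLp _) : L2) ξ)
      = ((∫ x, KConv ρ x * potOp n φ x : ℝ) : ℂ) := by
    rw [integral_KConv_potOp h1 h2 n hφ]
    apply integral_congr_ae
    filter_upwards [fourier_toLp_ae_eq hφ1 hφ2, fourier_toLp_ae_eq h1c h2c] with ξ a b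
    rw [a, b]
  rw [e2, L2.inner_def] at e
  have hi : Integrable (fun x => inner ℂ ((hφ2.toLp _ : L2) x) ((potSymbol n).op (h2c.toLp _) x)) := L2.integrable_inner _ _
  have e3 := congrArg Complex.re e
  rw [Complex.ofReal_re] at e3
  change ∫ x, potLimit n h2 x * φ x = ∫ x, KConv ρ x * potOp n φ x
  rw [← e3]
  have : (∫ x, inner ℂ ((hφ2.toLp _ : L2) x) ((potSymbol n).op (h2c.toLp _) x)).re
      = ∫ x, (inner ℂ ((hφ2.toLp _ : L2) x) ((potSymbol n).op (h2c.toLp _) x)).re := (integral_re hi).symm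
  rw [this]
  apply integral_congr_ae
  filter_upwards [hφ2.coeFn_toLp] with x hx
  rw [hx, RCLike.inner_apply, Complex.conj_ofReal, Complex.re_mul_ofReal]
  rfl

lemma IsDipolarPotential.ae_eq {n : ℝ} {ρ Φ Φ' : Plane → ℝ} (h : IsDipolarPotential n ρ Φ)
    (h' : IsDipolarPotential n ρ Φ') : Φ =ᵐ[volume] Φ' := by
  apply ae_eq_of_integral_contDiff_smul_eq (h.1.locallyIntegrable (by norm_num)) (h'.1.locallyIntegrable (by norm_num))
  intro g hg hc
  have := (h.2 g ⟨hg, hc⟩).trans (h'.2 g ⟨hg, hc⟩).symm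
  simpa only [smul_eq_mul, mul_comm] using this

lemma dipolarPotential_ae_eq (n : ℝ) {ρ : Plane → ℝ} (h1 : Integrable ρ) (h2 : MemLp ρ 2 volume) :
    dipolarPotential n ρ =ᵐ[volume] potLimit n h2 := by
  have hex : ∃ Φ, IsDipolarPotential n ρ Φ := ⟨_, isDipolarPotential_potLimit n h1 h2⟩
  have : IsDipolarPotential n ρ (dipolarPotential n ρ) := by
    rw [dipolarPotential, dif_pos hex]; exact hex.choose_spec
  exact this.ae_eq (isDipolarPotential_potLimit n h1 h2)

lemma integral_density_mul_dipolarPotential (n : ℝ) (u : H1) :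
    ∫ x, u.density x * dipolarPotential n u.density x = (potSymbol n).quad u.densLp := by
  rw [← integral_re_op_mul (potSymbol n) u.densLp_ae]
  apply integral_congr_ae
  filter_upwards [dipolarPotential_ae_eq n u.integrable_density u.memLp_density] with x hx
  rw [hx, mul_comm]; rfl

/-- The symbol of the interaction energy in the physical energy functional. -/
def energySymbol (β lam n : ℝ) : Symbol where
  toFun ξ := -(β - lam + 3 * n ^ 2 * lam) + 3 * lam / 2 * (potSymbol n).toFun ξ
  measurable := ((potSymbol n).measurable.const_mul _).const_add _
  bound := |-(β - lam + 3 * n ^ 2 * lam)| + |3 * lam / 2| * (potSymbol n).bound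
  le_bound ξ := by
    refine (abs_add_le _ _).trans ?_
    rw [abs_mul]
    exact add_le_add le_rfl (mul_le_mul_of_nonneg_left ((potSymbol n).le_bound ξ) (abs_nonneg _))

theorem energy_eq (V : Plane → ℝ) (β lam n : ℝ) (u : H1) :
    energy V β lam n u = 1 / 2 * u.dirichlet + (∫ x, V x * ‖u.toFun x‖ ^ 2)
      - 1 / 2 * (energySymbol β lam n).quad u.densLp := by
  have hE : (energySymbol β lam n).quad u.densLp = -(β - lam + 3 * n ^ 2 * lam) * u.quartic
      + 3 * lam / 2 * (potSymbol n).quad u.densLp := by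
    rw [Symbol.quad_eq, Symbol.quad_eq, ← H1.norm_sq_densLp, ← integral_norm_sq_fourier, ← integral_const_mul, ← integral_const_mul,
      ← integral_add ((integrable_norm_sq (Lp.memLp _)).const_mul _) (((potSymbol n).integrable_quad _).const_mul _)]
    congr 1; ext ξ
    simp only [energySymbol]; ring
  rw [energy, integral_density_mul_dipolarPotential, hE]; ring

/-- If 2π²|ξ|² `kerSymbol` were equal to 1, the symbol of the energy would be exactly a + b
`dipSymbol`: this is where the effective parameters come from. The deviation is a bounded angular
factor times the defect in `one_sub_kerSymbol_mul_le`. -/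
lemma abs_energySymbol_sub_le (β lam n : ℝ) {ξ : Plane} (hξ : ξ ≠ 0) :
    |(energySymbol β lam n).toFun ξ - (intSymbol (aParam β lam n) (bParam lam n)).toFun ξ|
      ≤ 3 * |lam| / 2 * potConst n / (Real.pi * ‖ξ‖ ^ 2) := by
  have h0 : 0 < ‖ξ‖ := norm_pos_iff.2 hξ
  have hpi := Real.pi_pos
  have hn := norm_sq_plane ξ
  have e : (energySymbol β lam n).toFun ξ - (intSymbol (aParam β lam n) (bParam lam n)).toFun ξ
      = 3 * lam * (potForm n ξ / ‖ξ‖ ^ 2) * (1 - 2 * Real.pi ^ 2 * ‖ξ‖ ^ 2 * kerSymbol ξ) := by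
    simp only [energySymbol, intSymbol, dipSymbol, potSymbol, aParam, bParam, potForm, quadHarm]
    field_simp
    rw [hn]; ring
  have h1 := one_sub_kerSymbol_mul_le hξ
  have h2 := kerSymbol_mul_le ξ
  rw [e, abs_mul, abs_mul, abs_mul, abs_div, abs_of_nonneg (by linarith : 0 ≤ 1 - 2 * Real.pi ^ 2 * ‖ξ‖ ^ 2 * kerSymbol ξ),
    abs_of_pos (by positivity : 0 < ‖ξ‖ ^ 2), abs_of_pos (by norm_num : (0:ℝ) < 3)]
  have h3 : |potForm n ξ| / ‖ξ‖ ^ 2 ≤ potConst n := by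
    rw [div_le_iff₀ (by positivity)]; exact abs_potForm_le n ξ
  calc _ ≤ 3 * |lam| * potConst n * (1 / (2 * Real.pi * ‖ξ‖ ^ 2)) := by
        have := potConst_nonneg n
        gcongr
    _ = _ := by field_simp


/-! ### Weak compactness -/

/-- Weak convergence of a sequence in `L²`. -/
def WeakTendsto (f : ℕ → L2) (g : L2) : Prop :=
  ∀ h : L2, Tendsto (fun n => inner ℂ h (f n)) atTop (𝓝 (inner ℂ h g))

lemma WeakTendsto.comp {f : ℕ → L2} {g : L2} (h : WeakTendsto f g) {φ : ℕ → ℕ} (hφ : StrictMono φ) :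
    WeakTendsto (fun n => f (φ n)) g := fun k => (h k).comp hφ.tendsto_atTop

lemma WeakTendsto.sub_self {f : ℕ → L2} {g : L2} (h : WeakTendsto f g) : WeakTendsto (fun n => f n - g) 0 := by
  intro k
  simp only [inner_sub_right, inner_zero_right]
  simpa using (h k).sub_const (inner ℂ k g)

/-- Sequential Banach–Alaoglu, transported by the Riesz isometry; a conjugation restores the order
of the inner product. -/
lemma exists_weakTendsto_subseq {f : ℕ → L2} {C : ℝ} (hb : ∀ n, ‖f n‖ ≤ C) :
    ∃ (g : L2) (φ : ℕ → ℕ), StrictMono φ ∧ WeakTendsto (fun n => f (φ n)) g := by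
  -- Makes the separability of L² available, on which sequential compactness rests.
  have : Fact ((2:ℝ≥0∞) ≠ ⊤) := ⟨by norm_num⟩
  have hc := WeakDual.isSeqCompact_closedBall ℂ L2 (0 : StrongDual ℂ L2) C
  obtain ⟨a, -, φ, hφ, ht⟩ := hc (x := fun n => StrongDual.toWeakDual (InnerProductSpace.toDual ℂ L2 (f n)))
    (fun n => by simpa using hb n)
  obtain ⟨g, hg⟩ := (InnerProductSpace.toDual ℂ L2).surjective (WeakDual.toStrongDual a)
  refine ⟨g, φ, hφ, fun k => ?_⟩
  have h1 := ((WeakDual.eval_continuous (𝕜 := ℂ) k).tendsto a).comp ht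
  have h2 : a k = inner ℂ g k := by
    rw [← InnerProductSpace.toDual_apply_apply (𝕜 := ℂ), hg]; rfl
  have h3 : Tendsto (fun n => inner ℂ (f (φ n)) k) atTop (𝓝 (inner ℂ g k)) := by
    rw [← h2]; exact h1
  have h4 := (Complex.continuous_conj.tendsto _).comp h3
  simpa [Function.comp_def, inner_conj_symm] using h4

/-- After expanding the square only a cross term with the fixed g depends on n: the Hilbert space
form of the Brezis–Lieb lemma. -/
lemma WeakTendsto.tendsto_norm_sq_sub {f : ℕ → L2} {g : L2} (h : WeakTendsto f g) :
    Tendsto (fun n => ‖f n‖ ^ 2 - ‖f n - g‖ ^ 2) atTop (𝓝 (‖g‖ ^ 2)) := by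
  have h1 : Tendsto (fun n => RCLike.re (inner ℂ g (f n))) atTop (𝓝 (RCLike.re (inner ℂ g g))) :=
    (RCLike.continuous_re.tendsto _).comp (h g)
  rw [inner_self_eq_norm_sq] at h1
  have h2 : Tendsto (fun n => 2 * RCLike.re (inner ℂ g (f n)) - ‖g‖ ^ 2) atTop (𝓝 (2 * ‖g‖ ^ 2 - ‖g‖ ^ 2)) :=
    (h1.const_mul 2).sub_const _
  convert h2 using 1
  · ext n
    rw [norm_sub_rev, norm_sub_sq (𝕜 := ℂ)]; ring
  · congr 1; ring

namespace H1

lemma integral_pderiv_smul_eq_inner {φ : Plane → ℝ} (h : IsTest φ) (i : Fin 2) (f : L2) :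
    ∫ x, pderiv i φ x • f x = inner ℂ ((((h.pderiv i).memLp 2).ofReal (K := ℂ)).toLp _) f := by
  rw [L2.inner_def]
  apply integral_congr_ae
  filter_upwards [(((h.pderiv i).memLp 2).ofReal (K := ℂ)).coeFn_toLp] with x hx
  rw [hx, RCLike.inner_apply]; simp [mul_comm]

lemma integral_smul_eq_inner {φ : Plane → ℝ} (h : IsTest φ) (f : L2) :
    ∫ x, φ x • f x = inner ℂ (((h.memLp 2).ofReal (K := ℂ)).toLp _) f := by
  rw [L2.inner_def]
  apply integral_congr_ae
  filter_upwards [((h.memLp 2).ofReal (K := ℂ)).coeFn_toLp] with x hx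
  rw [hx, RCLike.inner_apply]; simp [mul_comm]

/-- The element of `H¹` with given function and gradient in `L²`. -/
def ofLp (f : L2) (g : Fin 2 → L2) (h : ∀ i, IsWeakPartial i f (g i)) : H1 where
  toFun := f
  grad i := g i
  memLp := Lp.memLp f
  memLp_grad i := Lp.memLp (g i)
  isWeakPartial := h

lemma ofLp_lp (f : L2) (g : Fin 2 → L2) (h : ∀ i, IsWeakPartial i f (g i)) : (ofLp f g h).lp = f :=
  Lp.toLp_coeFn f _

lemma ofLp_glp (f : L2) (g : Fin 2 → L2) (h : ∀ i, IsWeakPartial i f (g i)) (i : Fin 2) : (ofLp f g h).glp i = g i :=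
  Lp.toLp_coeFn (g i) _

lemma isWeakPartial_lp (u : H1) (i : Fin 2) : IsWeakPartial i u.lp (u.glp i) := by
  intro φ hφ
  have e1 : ∫ x, pderiv i φ x • u.lp x = ∫ x, pderiv i φ x • u.toFun x :=
    integral_congr_ae (by filter_upwards [u.lp_ae] with x hx; rw [hx])
  have e2 : ∫ x, φ x • u.glp i x = ∫ x, φ x • u.grad i x :=
    integral_congr_ae (by filter_upwards [u.glp_ae i] with x hx; rw [hx])
  rw [e1, e2]; exact u.isWeakPartial i φ hφ

/-- Weak convergence in `H¹`. -/
def WeakTo (u : ℕ → H1) (w : H1) : Prop :=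
  WeakTendsto (fun n => (u n).lp) w.lp ∧ ∀ i, WeakTendsto (fun n => (u n).glp i) (w.glp i)

/-- Extract successively for the function and its two partial derivatives. The weak derivative
relation consists of pairings with fixed L² functions, so it survives the weak limit. -/
theorem exists_weakTo_subseq {u : ℕ → H1} {C : ℝ} (hM : ∀ n, (u n).mass ≤ C) (hD : ∀ n, (u n).dirichlet ≤ C) :
    ∃ (w : H1) (φ : ℕ → ℕ), StrictMono φ ∧ WeakTo (fun n => u (φ n)) w := by
  have hb : ∀ n, ‖(u n).lp‖ ≤ √C := fun n => Real.le_sqrt_of_sq_le (by rw [← mass_eq]; exact hM n)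
  have hg : ∀ i n, ‖(u n).glp i‖ ≤ √C := fun i n => by
    refine Real.le_sqrt_of_sq_le (le_trans ?_ (hD n))
    rw [dirichlet_eq]
    exact Finset.single_le_sum (f := fun i => ‖(u n).glp i‖ ^ 2) (fun j _ => by positivity) (Finset.mem_univ i)
  obtain ⟨f, φ, hφ, hf⟩ := exists_weakTendsto_subseq hb
  obtain ⟨g0, φ0, hφ0, hg0⟩ := exists_weakTendsto_subseq (fun n => hg 0 (φ n))
  obtain ⟨g1, φ1, hφ1, hg1⟩ := exists_weakTendsto_subseq (fun n => hg 1 (φ (φ0 n)))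
  have hψ : StrictMono (fun n => φ (φ0 (φ1 n))) := hφ.comp (hφ0.comp hφ1)
  have w1 : WeakTendsto (fun n => (u (φ (φ0 (φ1 n)))).lp) f := hf.comp (hφ0.comp hφ1)
  have w2 : ∀ i, WeakTendsto (fun n => (u (φ (φ0 (φ1 n)))).glp i) (![g0, g1] i) := by
    intro i; fin_cases i
    · exact hg0.comp hφ1
    · exact hg1
  have hw : ∀ i, IsWeakPartial i f (![g0, g1] i) := by
    intro i χ hχ
    rw [integral_pderiv_smul_eq_inner hχ, integral_smul_eq_inner hχ]
    refine tendsto_nhds_unique (w1 _) ?_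
    refine ((w2 i _).neg).congr fun n => ?_
    rw [← integral_pderiv_smul_eq_inner hχ, ← integral_smul_eq_inner hχ]
    exact ((isWeakPartial_lp _ i) χ hχ).symm
  refine ⟨ofLp f ![g0, g1] hw, _, hψ, ?_, ?_⟩
  · rw [ofLp_lp]; exact w1
  · intro i; rw [ofLp_glp]; exact w2 i

lemma WeakTo.tendsto_mass_sub {u : ℕ → H1} {w : H1} (h : WeakTo u w) :
    Tendsto (fun n => (u n).mass - ((u n).sub w).mass) atTop (𝓝 w.mass) := by
  simp only [mass_eq, sub_lp]; exact h.1.tendsto_norm_sq_sub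

lemma WeakTo.tendsto_dirichlet_sub {u : ℕ → H1} {w : H1} (h : WeakTo u w) :
    Tendsto (fun n => (u n).dirichlet - ((u n).sub w).dirichlet) atTop (𝓝 w.dirichlet) := by
  simp only [dirichlet_eq, sub_glp, ← Finset.sum_sub_distrib]
  exact tendsto_finsetSum _ fun i _ => (h.2 i).tendsto_norm_sq_sub

/-! ### Local compactness -/

/-- Beyond frequency R one has 1 ≤ |ξ|²/R²; the factor 4π² of the Dirichlet energy is at least one
and is dropped. -/
lemma norm_sub_ballSymbol_op_sq_le (u : H1) {R : ℝ} (hR : 0 < R) :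
    ‖u.lp - (ballSymbol R).op u.lp‖ ^ 2 ≤ u.dirichlet / R ^ 2 := by
  have hpi := Real.pi_pos
  rw [← Lp.norm_fourier_eq, norm_sq_lp]
  have h1 : ∫ ξ, ‖(𝓕 (u.lp - (ballSymbol R).op u.lp) : L2) ξ‖ ^ 2 ≤ ∫ ξ : Plane, (R ^ 2)⁻¹ * (‖ξ‖ ^ 2 * ‖(𝓕 u.lp : L2) ξ‖ ^ 2) := by
    refine integral_mono_ae (integrable_norm_sq (Lp.memLp _)) (u.integrable_norm_sq_mul.const_mul _) ?_
    filter_upwards [norm_fourier_sub_ballSymbol_op R u.lp] with ξ hξ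
    by_cases hb : ξ ∈ Metric.ball (0 : Plane) R
    · rw [Set.indicator_of_notMem (by simpa using hb)] at hξ
      rw [enorm_eq_zero] at hξ
      rw [hξ, norm_zero, zero_pow two_ne_zero]; positivity
    · rw [Set.indicator_of_mem (by simpa using hb)] at hξ
      have h2 : ‖(𝓕 (u.lp - (ballSymbol R).op u.lp) : L2) ξ‖ = ‖(𝓕 u.lp : L2) ξ‖ := by
        have := congrArg ENNReal.toReal hξ; simpa using this
      have h3 : R ≤ ‖ξ‖ := by simpa using hb
      rw [h2, ← mul_assoc]
      have : 1 ≤ (R ^ 2)⁻¹ * ‖ξ‖ ^ 2 := by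
        rw [inv_mul_eq_div, one_le_div (by positivity)]; gcongr
      nlinarith [sq_nonneg ‖(𝓕 u.lp : L2) ξ‖]
  rw [integral_const_mul] at h1
  refine h1.trans ?_
  rw [u.dirichlet_eq_integral, div_eq_inv_mul]
  have hI : 0 ≤ ∫ ξ : Plane, ‖ξ‖ ^ 2 * ‖(𝓕 u.lp : L2) ξ‖ ^ 2 := integral_nonneg fun ξ => by positivity
  have : (1:ℝ) ≤ 4 * Real.pi ^ 2 := by nlinarith [Real.pi_gt_three]
  gcongr
  nlinarith

end H1

/-- A value of a band-limited function is an inner product with a fixed L² function, the inverse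
transform of a character cut to the ball. Weak convergence thus becomes pointwise convergence. -/
lemma tendsto_ballSymbol_op {f : ℕ → L2} (hf : WeakTendsto f 0) (R : ℝ) :
    ∃ g : ℕ → Plane → ℂ, (∀ n, (ballSymbol R).op (f n) =ᵐ[volume] g n) ∧ ∀ x, Tendsto (fun n => g n x) atTop (𝓝 0) := by
  refine ⟨fun n => 𝓕⁻ ((Metric.ball (0 : Plane) R).indicator (𝓕 (f n) : L2)), fun n => ballSymbol_op_ae R (f n), fun x => ?_⟩
  let k : Plane → ℂ := (Metric.ball (0 : Plane) R).indicator (fun ξ => (Real.fourierChar (-(inner ℝ ξ x)) : ℂ))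
  have hkm : Measurable k := Measurable.indicator (by fun_prop) measurableSet_ball
  have hk : MemLp k 2 volume := by
    have h1 : MemLp ((Metric.ball (0 : Plane) R).indicator (fun _ => (1:ℝ))) 2 volume :=
      memLp_indicator_const 2 measurableSet_ball 1 (Or.inr measure_ball_lt_top.ne)
    refine h1.mono hkm.aestronglyMeasurable (ae_of_all _ fun ξ => ?_)
    simp only [k, Set.indicator]; split_ifs
    · rw [Circle.norm_coe]; simp
    · simp
  have e : ∀ n, 𝓕⁻ ((Metric.ball (0 : Plane) R).indicator (𝓕 (f n) : L2)) x = inner ℂ (𝓕⁻ (hk.toLp k) : L2) (f n) := by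
    intro n
    rw [← Lp.inner_fourier_eq, fourier_fourierInv_eq, L2.inner_def, Real.fourierInv_eq]
    apply integral_congr_ae
    filter_upwards [hk.coeFn_toLp] with ξ hξ
    rw [hξ, RCLike.inner_apply]
    simp only [k, Set.indicator]
    split_ifs
    · rw [Circle.smul_def, smul_eq_mul, mul_comm]
      congr 1
      rw [← Circle.coe_inv_eq_conj, ← AddChar.map_neg_eq_inv, neg_neg]
    · simp
  simp_rw [e]
  simpa using hf (𝓕⁻ (hk.toLp k))

namespace H1

/-- Rellich's theorem by frequency splitting: the high part is uniformly small in L² by the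
Dirichlet bound, while the low part is uniformly bounded and tends to zero pointwise, so dominated
convergence applies on the ball. -/
theorem tendsto_integral_ball_density {v : ℕ → H1} {C : ℝ} (hM : ∀ n, (v n).mass ≤ C)
    (hD : ∀ n, (v n).dirichlet ≤ C) (hv : WeakTendsto (fun n => (v n).lp) 0) (r : ℝ) :
    Tendsto (fun n => ∫ x in Metric.ball (0 : Plane) r, (v n).density x) atTop (𝓝 0) := by
  have hC0 : 0 ≤ C := (mass_nonneg _).trans (hM 0)
  rw [Metric.tendsto_atTop]
  intro ε hε
  obtain ⟨R, hR, hRε⟩ : ∃ R : ℝ, 0 < R ∧ 2 * (C / R ^ 2) < ε / 2 := by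
    refine ⟨√(4 * C / ε + 1), by positivity, ?_⟩
    rw [Real.sq_sqrt (by positivity), ← mul_div_assoc, div_lt_iff₀ (by positivity)]
    field_simp; linarith
  obtain ⟨g, hg, hgt⟩ := tendsto_ballSymbol_op hv R
  have hbound : ∀ n, ∀ᵐ x, ‖g n x‖ ^ 2 ≤ 2 * Real.pi * R * √(C * C) := by
    intro n
    have hκ : ∫ ξ : Plane, ‖ξ‖ * ‖(𝓕 (v n).lp : L2) ξ‖ ^ 2 ≤ √(C * C) := by
      have h1 := (v n).integral_norm_mul_le
      have h2 : (v n).dirichlet * (v n).mass ≤ C * C :=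
        mul_le_mul (hD n) (hM n) (mass_nonneg _) hC0
      have h3 : 0 ≤ ∫ ξ : Plane, ‖ξ‖ * ‖(𝓕 (v n).lp : L2) ξ‖ ^ 2 := integral_nonneg fun ξ => by positivity
      apply Real.le_sqrt_of_sq_le
      have h5 : (1:ℝ) ≤ (2 * Real.pi) ^ 2 := by nlinarith [Real.pi_gt_three]
      rw [mul_pow] at h1
      nlinarith [sq_nonneg (∫ ξ : Plane, ‖ξ‖ * ‖(𝓕 (v n).lp : L2) ξ‖ ^ 2)]
    filter_upwards [norm_ballSymbol_op_le (v n).lp hR.le (v n).integrable_norm_mul hκ, hg n] with x h1 h2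
    rw [← h2]
    calc _ ≤ (√(2 * Real.pi * R * √(C * C))) ^ 2 := by gcongr
      _ = _ := Real.sq_sqrt (by have := Real.pi_pos; positivity)
  have hgi : ∀ n, MemLp (g n) 2 volume := fun n => (memLp_congr_ae (hg n)).1 (Lp.memLp _)
  have hlim : Tendsto (fun n => ∫ x in Metric.ball (0 : Plane) r, ‖g n x‖ ^ 2) atTop (𝓝 0) := by
    have : (0:ℝ) = ∫ x in Metric.ball (0 : Plane) r, (0:ℝ) := by simp
    rw [this]
    refine tendsto_integral_of_dominated_convergence (fun _ => 2 * Real.pi * R * √(C * C))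
      (fun n => (integrable_norm_sq (hgi n)).1.restrict) (integrableOn_const measure_ball_lt_top.ne) (fun n => ?_) ?_
    · filter_upwards [ae_restrict_of_ae (hbound n)] with x hx
      rwa [Real.norm_of_nonneg (by positivity)]
    · filter_upwards with x
      have := ((hgt x).norm).pow 2
      simpa using this
  obtain ⟨N, hN⟩ := Metric.tendsto_atTop.1 hlim (ε / 4) (by positivity)
  refine ⟨N, fun n hn => ?_⟩
  have hN' := hN n hn
  rw [Real.dist_eq, sub_zero, abs_of_nonneg (integral_nonneg fun x => sq_nonneg _)] at hN' ⊢
  · have hd : ∫ x, ‖(v n).lp x - (ballSymbol R).op (v n).lp x‖ ^ 2 ≤ C / R ^ 2 := by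
      have h1 := (v n).norm_sub_ballSymbol_op_sq_le hR
      rw [norm_sq_lp] at h1
      have h2 : ∫ x, ‖(v n).lp x - (ballSymbol R).op (v n).lp x‖ ^ 2 = ∫ x, ‖((v n).lp - (ballSymbol R).op (v n).lp : L2) x‖ ^ 2 := by
        apply integral_congr_ae
        filter_upwards [Lp.coeFn_sub (v n).lp ((ballSymbol R).op (v n).lp)] with x hx
        rw [hx]; rfl
      rw [h2]
      exact h1.trans (by gcongr; exact hD n)
    have hi1 : Integrable (fun x => ‖(v n).lp x - (ballSymbol R).op (v n).lp x‖ ^ 2) :=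
      integrable_norm_sq ((Lp.memLp _).sub (Lp.memLp _))
    have hi2 := integrable_norm_sq (hgi n)
    calc ∫ x in Metric.ball (0 : Plane) r, (v n).density x
        ≤ ∫ x in Metric.ball (0 : Plane) r, (2 * ‖(v n).lp x - (ballSymbol R).op (v n).lp x‖ ^ 2 + 2 * ‖g n x‖ ^ 2) := by
          refine integral_mono_ae (v n).integrable_density.integrableOn
            ((hi1.const_mul 2).add (hi2.const_mul 2)).integrableOn ?_
          filter_upwards [ae_restrict_of_ae (hg n), ae_restrict_of_ae (v n).lp_ae] with x h1 h2
          rw [← h1, H1.density, ← h2]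
          have := norm_add_le ((v n).lp x - (ballSymbol R).op (v n).lp x) ((ballSymbol R).op (v n).lp x)
          rw [sub_add_cancel] at this
          nlinarith [sq_nonneg (‖(v n).lp x - (ballSymbol R).op (v n).lp x‖ - ‖(ballSymbol R).op (v n).lp x‖), norm_nonneg ((v n).lp x)]
      _ = 2 * (∫ x in Metric.ball (0 : Plane) r, ‖(v n).lp x - (ballSymbol R).op (v n).lp x‖ ^ 2)
          + 2 * ∫ x in Metric.ball (0 : Plane) r, ‖g n x‖ ^ 2 := by
          rw [integral_add (hi1.const_mul 2).integrableOn (hi2.const_mul 2).integrableOn, integral_const_mul, integral_const_mul]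
      _ < ε := by
          have := setIntegral_le_integral (s := Metric.ball (0 : Plane) r) hi1 (ae_of_all _ fun x => by positivity)
          linarith

end H1

/-! ### Asymptotic splitting of the interaction under weak convergence -/

namespace H1

lemma sub_mass_le (u w : H1) : (u.sub w).mass ≤ 2 * u.mass + 2 * w.mass := by
  simp only [mass_eq, sub_lp]
  have := norm_sub_le u.lp w.lp
  nlinarith [sq_nonneg (‖u.lp‖ - ‖w.lp‖), norm_nonneg (u.lp - w.lp)]

lemma sub_dirichlet_le (u w : H1) : (u.sub w).dirichlet ≤ 2 * u.dirichlet + 2 * w.dirichlet := by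
  simp only [dirichlet_eq, sub_glp, Finset.mul_sum, ← Finset.sum_add_distrib]
  refine Finset.sum_le_sum fun i _ => ?_
  have := norm_sub_le (u.glp i) (w.glp i)
  nlinarith [sq_nonneg (‖u.glp i‖ - ‖w.glp i‖), norm_nonneg (u.glp i - w.glp i)]

lemma density_nonneg (u : H1) (x : Plane) : 0 ≤ u.density x := sq_nonneg _

lemma integral_density_sq (u : H1) : ∫ x, u.density x ^ 2 = u.quartic := by
  rw [quartic]; congr 1; ext x; rw [density]; ring

lemma abs_integral_mul_density_le (u : H1) {f : Plane → ℝ} (hf : MemLp f 2 volume) :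
    |∫ x, f x * u.density x| ≤ √(∫ x, f x ^ 2) * √u.quartic := by
  rw [← integral_density_sq]; exact abs_integral_mul_le hf u.memLp_density

lemma quartic_le_of_le {u : H1} {C : ℝ} (hM : u.mass ≤ C) (hD : u.dirichlet ≤ C) : u.quartic ≤ 6 * (C * C) := by
  refine u.quartic_le.trans ?_
  have := mul_le_mul hD hM u.mass_nonneg (u.dirichlet_nonneg.trans hD)
  linarith

/-- Approximate f in L² by a continuous compactly supported function. The error is controlled by the
uniform bound on the quartic term, the main part by local compactness. -/
theorem tendsto_integral_mul_density {v : ℕ → H1} {C : ℝ} (hM : ∀ n, (v n).mass ≤ C)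
    (hD : ∀ n, (v n).dirichlet ≤ C) (hv : WeakTendsto (fun n => (v n).lp) 0)
    {f : Plane → ℝ} (hf : MemLp f 2 volume) :
    Tendsto (fun n => ∫ x, f x * (v n).density x) atTop (𝓝 0) := by
  rw [Metric.tendsto_atTop]
  intro ε hε
  set q := √(6 * (C * C)) with hq
  have hq0 : 0 ≤ q := Real.sqrt_nonneg _
  have hf' : MemLp f (ENNReal.ofReal 2) volume := by simpa using hf
  obtain ⟨g, hgc, hgl, hgcont, hgm⟩ := hf'.exists_hasCompactSupport_integral_rpow_sub_le (by norm_num : (0:ℝ) < 2)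
    (ε := (ε / (4 * (q + 1))) ^ 2) (by positivity)
  have hg2 : MemLp g 2 volume := by simpa using hgm
  obtain ⟨A, hA⟩ := hgcont.bounded_above_of_compact_support hgc
  have hA0 : 0 ≤ A := (norm_nonneg _).trans (hA 0)
  obtain ⟨r, hr⟩ := hgc.isCompact.isBounded.subset_ball (0 : Plane)
  obtain ⟨N, hN⟩ := Metric.tendsto_atTop.1 (tendsto_integral_ball_density hM hD hv r) (ε / (4 * (A + 1))) (by positivity)
  refine ⟨N, fun n hn => ?_⟩
  have hN' := hN n hn
  rw [Real.dist_eq, sub_zero] at hN' ⊢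
  rw [abs_of_nonneg (integral_nonneg fun x => density_nonneg _ _)] at hN'
  have hi1 : Integrable (fun x => (f x - g x) * (v n).density x) := (hf.sub hg2).integrable_mul (v n).memLp_density
  have hi2 : Integrable (fun x => g x * (v n).density x) := hg2.integrable_mul (v n).memLp_density
  have e : ∫ x, f x * (v n).density x = (∫ x, (f x - g x) * (v n).density x) + ∫ x, g x * (v n).density x := by
    rw [← integral_add hi1 hi2]; congr 1; ext x; ring
  have b1 : |∫ x, (f x - g x) * (v n).density x| ≤ ε / 4 := by
    refine ((v n).abs_integral_mul_density_le (hf.sub hg2)).trans ?_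
    have h1 : √(∫ x, (f - g) x ^ 2) ≤ ε / (4 * (q + 1)) := by
      apply Real.sqrt_le_iff.2 ⟨by positivity, ?_⟩
      refine le_trans (le_of_eq ?_) hgl
      congr 1; ext x
      rw [Pi.sub_apply, Real.norm_eq_abs, show (2:ℝ) = (2:ℕ) by norm_num, Real.rpow_natCast, sq_abs]
    have h2 : √(v n).quartic ≤ q := Real.sqrt_le_sqrt (quartic_le_of_le (hM n) (hD n))
    calc _ ≤ ε / (4 * (q + 1)) * q := mul_le_mul h1 h2 (Real.sqrt_nonneg _) (by positivity)
      _ ≤ ε / 4 := by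
        rw [div_mul_eq_mul_div, div_le_div_iff₀ (by positivity) (by positivity)]; nlinarith
  have b2 : |∫ x, g x * (v n).density x| ≤ ε / 4 := by
    have h1 : ∀ x, ‖g x * (v n).density x‖ ≤ A * (Metric.ball (0 : Plane) r).indicator (v n).density x := by
      intro x
      by_cases hx : x ∈ Metric.ball (0 : Plane) r
      · rw [Set.indicator_of_mem hx, norm_mul, Real.norm_of_nonneg ((v n).density_nonneg x)]
        exact mul_le_mul_of_nonneg_right (hA x) ((v n).density_nonneg x)
      · rw [Set.indicator_of_notMem hx, image_eq_zero_of_notMem_tsupport (fun h => hx (hr h))]; simp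
    have h2 := norm_integral_le_of_norm_le (((v n).integrable_density.indicator measurableSet_ball).const_mul A) (ae_of_all _ h1)
    rw [integral_const_mul, integral_indicator measurableSet_ball, Real.norm_eq_abs] at h2
    refine h2.trans ?_
    calc A * ∫ x in Metric.ball (0 : Plane) r, (v n).density x ≤ A * (ε / (4 * (A + 1))) := by gcongr
      _ ≤ ε / 4 := by
        rw [mul_div_assoc', div_le_div_iff₀ (by positivity) (by positivity)]; nlinarith
  rw [e]
  exact (abs_add_le _ _).trans_lt (by linarith)

lemma weakTendsto_densLp {v : ℕ → H1} {C : ℝ} (hM : ∀ n, (v n).mass ≤ C)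
    (hD : ∀ n, (v n).dirichlet ≤ C) (hv : WeakTendsto (fun n => (v n).lp) 0) :
    WeakTendsto (fun n => (v n).densLp) 0 := by
  intro h
  rw [inner_zero_right]
  refine squeeze_zero_norm (fun n => ?_) (tendsto_integral_mul_density hM hD hv (Lp.memLp h).norm)
  rw [L2.inner_def]
  refine (norm_integral_le_integral_norm _).trans (le_of_eq ?_)
  apply integral_congr_ae
  filter_upwards [(v n).densLp_ae] with x hx
  rw [hx, RCLike.inner_apply, norm_mul, RCLike.norm_conj, Complex.norm_real, Real.norm_of_nonneg ((v n).density_nonneg x), mul_comm]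

/-- The difference |a + b|² - |a|² - |b|² is 2 Re⟨a, b⟩, with square at most 4|a|²|b|²: additivity
of the density fails only where the two parts overlap. -/
lemma norm_densLp_sub_sub_sq_le (u w : H1) :
    ‖u.densLp - (w.densLp + (u.sub w).densLp)‖ ^ 2 ≤ 4 * ∫ x, w.density x * (u.sub w).density x := by
  rw [norm_sq_lp, ← integral_const_mul]
  have hi : Integrable (fun x => w.density x * (u.sub w).density x) := w.memLp_density.integrable_mul (u.sub w).memLp_density
  refine integral_mono_ae (integrable_norm_sq (Lp.memLp _)) (hi.const_mul 4) ?_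
  filter_upwards [Lp.coeFn_sub u.densLp (w.densLp + (u.sub w).densLp), Lp.coeFn_add w.densLp (u.sub w).densLp,
    u.densLp_ae, w.densLp_ae, (u.sub w).densLp_ae] with x h1 h2 h3 h4 h5
  rw [h1, Pi.sub_apply, h2, Pi.add_apply, h3, h4, h5, ← Complex.ofReal_add, ← Complex.ofReal_sub, Complex.norm_real, Real.norm_eq_abs, sq_abs]
  simp only [density, sub]
  set a := w.toFun x
  set b := u.toFun x - w.toFun x with hb
  have hu : u.toFun x = a + b := by simp [a, hb]
  have h6 := norm_add_sq (𝕜 := ℂ) a b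
  have h7 := norm_inner_le_norm (𝕜 := ℂ) a b
  have h8 := (RCLike.abs_re_le_norm (inner ℂ a b)).trans h7
  rw [hu, h6]
  have h9 : RCLike.re (inner ℂ a b) ^ 2 ≤ (‖a‖ * ‖b‖) ^ 2 := by
    rw [← sq_abs]; gcongr
  nlinarith

end H1

lemma Symbol.quad_zero (σ : Symbol) : σ.quad 0 = 0 := by simp [Symbol.quad]

namespace H1

/-- A Brezis–Lieb splitting for a nonlocal form. The density of uₙ is that of w plus that of the
remainder, up to r n → 0 in L². The cross term vanishes because the operator acts on the fixed
density of w while the remainder densities tend weakly to zero. -/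
theorem WeakTo.tendsto_quad_sub {u : ℕ → H1} {w : H1} (h : WeakTo u w) {C : ℝ} (hM : ∀ n, (u n).mass ≤ C)
    (hD : ∀ n, (u n).dirichlet ≤ C) (σ : Symbol) :
    Tendsto (fun n => σ.quad (u n).densLp - σ.quad ((u n).sub w).densLp) atTop (𝓝 (σ.quad w.densLp)) := by
  obtain ⟨C', hM', hD'⟩ : ∃ C', (∀ n, ((u n).sub w).mass ≤ C') ∧ (∀ n, ((u n).sub w).dirichlet ≤ C') := by
    refine ⟨2 * C + 2 * w.mass + 2 * w.dirichlet, fun n => ?_, fun n => ?_⟩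
    · have := (u n).sub_mass_le w; have := hM n; have := w.dirichlet_nonneg; linarith
    · have := (u n).sub_dirichlet_le w; have := hD n; have := w.mass_nonneg; linarith
  have hv : WeakTendsto (fun n => ((u n).sub w).lp) 0 := by
    simp only [sub_lp]; exact h.1.sub_self
  let r : ℕ → L2 := fun n => (u n).densLp - (w.densLp + ((u n).sub w).densLp)
  have hr : Tendsto r atTop (𝓝 0) := by
    have h1 := (tendsto_integral_mul_density hM' hD' hv w.memLp_density).const_mul 4
    rw [mul_zero] at h1
    have h2 : Tendsto (fun n => ‖r n‖ ^ 2) atTop (𝓝 0) :=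
      squeeze_zero (fun n => sq_nonneg _) (fun n => (u n).norm_densLp_sub_sub_sq_le w) h1
    have h3 := (Real.continuous_sqrt.tendsto 0).comp h2
    rw [tendsto_zero_iff_norm_tendsto_zero]
    simpa [Function.comp_def] using h3
  have hcross : Tendsto (fun n => RCLike.re (inner ℂ ((u n).sub w).densLp (σ.op w.densLp))) atTop (𝓝 0) := by
    have h1 := (RCLike.continuous_re.tendsto _).comp (weakTendsto_densLp hM' hD' hv (σ.op w.densLp))
    rw [inner_zero_right, map_zero] at h1
    refine h1.congr fun n => ?_
    simp only [Function.comp_apply]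
    rw [← inner_conj_symm, RCLike.conj_re]
  have hrq : Tendsto (fun n => σ.quad (r n)) atTop (𝓝 0) := by
    have := (σ.continuous_quad.tendsto 0).comp hr
    rwa [σ.quad_zero] at this
  have hrc : Tendsto (fun n => RCLike.re (inner ℂ (r n) (σ.op (w.densLp + ((u n).sub w).densLp)))) atTop (𝓝 0) := by
    have hb : ∀ n, ‖σ.op (w.densLp + ((u n).sub w).densLp)‖ ≤ ‖σ.op‖ * (‖w.densLp‖ + √(6 * (C' * C'))) := by
      intro n
      refine (σ.op.le_opNorm _).trans (mul_le_mul_of_nonneg_left ((norm_add_le _ _).trans ?_) (norm_nonneg _))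
      refine add_le_add le_rfl (Real.le_sqrt_of_sq_le ?_)
      rw [norm_sq_densLp]; exact quartic_le_of_le (hM' n) (hD' n)
    have h1 : Tendsto (fun n => ‖r n‖ * (‖σ.op‖ * (‖w.densLp‖ + √(6 * (C' * C'))))) atTop (𝓝 0) := by
      simpa using hr.norm.mul_const (‖σ.op‖ * (‖w.densLp‖ + √(6 * (C' * C'))))
    refine squeeze_zero_norm (fun n => ?_) h1
    refine (RCLike.abs_re_le_norm _).trans ((norm_inner_le_norm _ _).trans ?_)
    exact mul_le_mul_of_nonneg_left (hb n) (norm_nonneg _)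
  have key : ∀ n, σ.quad (u n).densLp - σ.quad ((u n).sub w).densLp
      = σ.quad w.densLp + (2 * RCLike.re (inner ℂ ((u n).sub w).densLp (σ.op w.densLp)) + σ.quad (r n)
        + 2 * RCLike.re (inner ℂ (r n) (σ.op (w.densLp + ((u n).sub w).densLp)))) := by
    intro n
    have e : (u n).densLp = (w.densLp + ((u n).sub w).densLp) + r n := by simp [r]
    conv_lhs => rw [e]
    rw [σ.quad_add, σ.quad_add]; ring
  simp only [key]
  have := (((hcross.const_mul 2).add hrq).add (hrc.const_mul 2)).const_add (σ.quad w.densLp)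
  simpa using this

/-! ### Comparison of symbols that agree at high frequency -/

lemma integral_norm_sq_fourier_density (u : H1) : ∫ ξ, ‖𝓕 (fun x => (u.density x : ℂ)) ξ‖ ^ 2 = u.quartic := by
  rw [← norm_sq_densLp, ← integral_norm_sq_fourier]
  apply integral_congr_ae
  filter_upwards [u.fourier_densLp_ae] with ξ hξ
  rw [hξ]

lemma integrable_norm_sq_fourier_density (u : H1) : Integrable (fun ξ => ‖𝓕 (fun x => (u.density x : ℂ)) ξ‖ ^ 2) :=
  integrable_norm_sq ((memLp_congr_ae u.fourier_densLp_ae).1 (Lp.memLp _))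

end H1

/-- Two symbols that agree at infinity give interactions that differ by a small multiple of the
quartic term and a multiple of the squared mass. -/
theorem exists_abs_quad_sub_le (σ τ : Symbol) {c : ℝ}
    (h : ∀ ξ : Plane, ξ ≠ 0 → |σ.toFun ξ - τ.toFun ξ| ≤ c / ‖ξ‖ ^ 2) {ε : ℝ} (hε : 0 < ε) :
    ∃ C, 0 ≤ C ∧ ∀ u : H1, |σ.quad u.densLp - τ.quad u.densLp| ≤ ε * u.quartic + C * u.mass ^ 2 := by
  set B := σ.bound + τ.bound with hB
  have hB0 : 0 ≤ B := add_nonneg σ.bound_nonneg τ.bound_nonneg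
  -- Outside the ball of this radius the symbols differ by at most ε; inside, the transform of the
  -- density is bounded by the mass.
  set R := √(|c| / ε + 1)
  have hR : 0 < R := by positivity
  have hR2 : R ^ 2 = |c| / ε + 1 := Real.sq_sqrt (by positivity)
  refine ⟨B * (volume : Measure Plane).real (Metric.ball 0 R), by positivity, fun u => ?_⟩
  set F := fun ξ => ‖𝓕 (fun x => (u.density x : ℂ)) ξ‖ ^ 2 with hF
  have hFi : Integrable F := u.integrable_norm_sq_fourier_density
  have hsi : ∀ σ : Symbol, Integrable (fun ξ => σ.toFun ξ * F ξ) := fun σ =>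
    hFi.bdd_mul (c := σ.bound) σ.measurable.aestronglyMeasurable (ae_of_all _ σ.le_bound)
  have hind : Integrable ((Metric.ball (0 : Plane) R).indicator (fun _ => B * u.mass ^ 2)) :=
    (integrable_indicator_iff measurableSet_ball).2 (integrableOn_const measure_ball_lt_top.ne)
  rw [u.quad_eq_fourier_density, u.quad_eq_fourier_density, ← integral_sub (hsi σ) (hsi τ)]
  have hpt : ∀ᵐ ξ, ‖σ.toFun ξ * F ξ - τ.toFun ξ * F ξ‖ ≤ ε * F ξ + (Metric.ball (0 : Plane) R).indicator (fun _ => B * u.mass ^ 2) ξ := by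
    filter_upwards [ae_ne_zero_plane] with ξ hξ
    have hF0 : 0 ≤ F ξ := sq_nonneg _
    have h0 : 0 < ‖ξ‖ := norm_pos_iff.2 hξ
    rw [← sub_mul, norm_mul, Real.norm_of_nonneg hF0, Real.norm_eq_abs]
    by_cases hb : ξ ∈ Metric.ball (0 : Plane) R
    · rw [Set.indicator_of_mem hb]
      have h1 : |σ.toFun ξ - τ.toFun ξ| ≤ B := (abs_sub _ _).trans (add_le_add (σ.le_bound ξ) (τ.le_bound ξ))
      have h2 : F ξ ≤ u.mass ^ 2 := by
        simp only [hF]; gcongr; exact u.norm_fourier_density_le ξ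
      have h3 := mul_le_mul h1 h2 hF0 hB0
      nlinarith
    · rw [Set.indicator_of_notMem hb, add_zero]
      refine mul_le_mul_of_nonneg_right ((h ξ hξ).trans ?_) hF0
      have h3 : R ≤ ‖ξ‖ := by simpa using hb
      rw [div_le_iff₀ (by positivity)]
      have h4 : R ^ 2 ≤ ‖ξ‖ ^ 2 := by gcongr
      have h5 : c ≤ ε * R ^ 2 := by
        rw [hR2, mul_add, mul_div_cancel₀ _ hε.ne']; linarith [le_abs_self c]
      nlinarith
  have := norm_integral_le_of_norm_le ((hFi.const_mul ε).add hind) hpt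
  rw [integral_add' (hFi.const_mul ε) hind, integral_const_mul, integral_indicator measurableSet_ball, setIntegral_const,
    u.integral_norm_sq_fourier_density, Real.norm_eq_abs] at this
  refine this.trans (le_of_eq ?_)
  rw [smul_eq_mul]; ring

theorem exists_abs_energySymbol_quad_sub_le (β lam n : ℝ) {ε : ℝ} (hε : 0 < ε) :
    ∃ C, 0 ≤ C ∧ ∀ u : H1, |(energySymbol β lam n).quad u.densLp
      - interaction (aParam β lam n) (bParam lam n) u| ≤ ε * u.quartic + C * u.mass ^ 2 := by
  obtain ⟨C, hC, h⟩ := exists_abs_quad_sub_le (energySymbol β lam n) (intSymbol (aParam β lam n) (bParam lam n))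
    (c := 3 * |lam| / 2 * potConst n / Real.pi) (fun ξ hξ => by
      rw [div_div]; exact abs_energySymbol_sub_le β lam n hξ) hε
  exact ⟨C, hC, fun u => by rw [interaction_eq_quad]; exact h u⟩


/-! ### The optimal constant -/

lemma interaction_le_quartic (a b : ℝ) (u : H1) : interaction a b u ≤ (intSymbol a b).bound * u.quartic := by
  rw [interaction_eq_quad, ← H1.norm_sq_densLp]
  exact Symbol.quad_le _ _ fun ξ => (le_abs_self _).trans ((intSymbol a b).le_bound ξ)

lemma isGNConst_bound (a b : ℝ) : IsGNConst a b (6 * (intSymbol a b).bound) := by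
  intro u
  refine (interaction_le_quartic a b u).trans ?_
  have := mul_le_mul_of_nonneg_left u.quartic_le (intSymbol a b).bound_nonneg
  linarith

namespace H1

/-- The symbol has degree zero, so only the amplitude and the Jacobian contribute. -/
lemma interaction_rescale_iso (u : H1) (a b c : ℝ) {t : ℝ} (ht : 0 < t) (y : Plane) :
    interaction a b (u.rescale c (fun _ => t) (fun _ => ht) y) = c ^ 4 * (t * t)⁻¹ * interaction a b u := by
  rw [interaction_eq_quad, interaction_eq_quad, quad_rescale, quad_eq_fourier_density]
  congr 2; ext ξ
  have e : diagEquiv (fun _ => t) (fun _ => ht) ξ = t • ξ := by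
    ext i; simp [diagEquiv_apply]
  have : (intSymbol a b).toFun (t • ξ) = (intSymbol a b).toFun ξ := by
    simp only [intSymbol, dipSymbol, quadHarm, norm_smul, PiLp.smul_apply, smul_eq_mul, Real.norm_of_nonneg ht.le]
    by_cases h : ξ = 0
    · simp [h]
    have h0 : 0 < ‖ξ‖ := norm_pos_iff.2 h
    field_simp
  rw [e, this]

lemma quartic_rescale_iso (u : H1) (c : ℝ) {t : ℝ} (ht : 0 < t) (y : Plane) :
    (u.rescale c (fun _ => t) (fun _ => ht) y).quartic = c ^ 4 * (t * t)⁻¹ * u.quartic := by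
  have h := integral_comp_diagAffine (fun _ => t) (fun _ => ht) y (fun x => ‖u.toFun x‖ ^ 4)
  have e : ∀ x, ‖(u.rescale c (fun _ => t) (fun _ => ht) y).toFun x‖ ^ 4
      = c ^ 4 * ‖u.toFun (diagAffine (fun _ => t) (fun _ => ht) y x)‖ ^ 4 := by
    intro x
    have := u.rescale_density c (fun _ => t) (fun _ => ht) y x
    simp only [density] at this
    calc _ = (‖(u.rescale c (fun _ => t) (fun _ => ht) y).toFun x‖ ^ 2) ^ 2 := by ring
      _ = _ := by rw [this]; ring
  unfold quartic
  simp_rw [e]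
  rw [integral_const_mul, h, smul_eq_mul]; ring

/-- A real test function as an element of `H¹`. -/
def ofTest (φ : Plane → ℝ) (h : IsTest φ) : H1 where
  toFun x := φ x
  grad i x := pderiv i φ x
  memLp := (h.memLp 2).ofReal
  memLp_grad i := ((h.pderiv i).memLp 2).ofReal
  isWeakPartial i := by
    intro ψ hψ
    have h1 := integral_mul_fderiv_eq_neg_fderiv_mul_of_integrable (μ := volume) (f := φ) (g := ψ)
      (v := EuclideanSpace.single i 1) (hψ.mul (h.pderiv i).1 |>.integrable.congr (ae_of_all _ fun x => mul_comm _ _))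
      (h.mul (hψ.pderiv i).1).integrable (h.mul hψ.1).integrable
      (fun x _ => h.differentiable x) (fun x _ => hψ.differentiable x)
    have e1 : ∀ x, pderiv i ψ x • (φ x : ℂ) = ((φ x * fderiv ℝ ψ x (EuclideanSpace.single i 1) : ℝ) : ℂ) := by
      intro x; rw [Complex.real_smul, pderiv]; push_cast; ring
    have e2 : ∀ x, ψ x • (pderiv i φ x : ℂ) = ((fderiv ℝ φ x (EuclideanSpace.single i 1) * ψ x : ℝ) : ℂ) := by
      intro x; rw [Complex.real_smul, pderiv]; push_cast; ring
    simp_rw [e1, e2]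
    rw [integral_complex_ofReal, integral_complex_ofReal, h1, Complex.ofReal_neg]

lemma ofTest_bump_quartic_pos : 0 < (ofTest bump isTest_bump).quartic := by
  have : ∀ x, ‖(ofTest bump isTest_bump).toFun x‖ ^ 4 = (bump x) ^ 4 := by
    intro x; simp [ofTest, abs_of_nonneg bump.nonneg]
  unfold quartic
  simp_rw [this]
  refine Continuous.integral_pos_of_hasCompactSupport_nonneg_nonzero (x := 0) (isTest_bump.continuous.pow 4) ?_
    (fun x => by positivity) ?_
  · exact isTest_bump.2.comp_left (g := fun t : ℝ => t ^ 4) (by simp)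
  · have : bump 0 = 1 := bump.one_of_mem_closedBall (by simp [bump])
    rw [this]; norm_num

lemma ofTest_bump_mass_pos : 0 < (ofTest bump isTest_bump).mass := by
  have h1 := (ofTest bump isTest_bump).quartic_le
  have h2 := ofTest_bump_quartic_pos
  by_contra h
  have h3 : (ofTest bump isTest_bump).mass = 0 := le_antisymm (not_lt.1 h) (mass_nonneg _)
  rw [h3] at h1; linarith

end H1

/-! ### Positivity of the interaction by anisotropic stretching -/

lemma tendsto_stretch {A B : ℝ} (hA : 0 < A) (hB : 0 ≤ B) :
    Tendsto (fun n : ℕ => (((n + 1 : ℝ)) ^ 2 * A - B) / (2 * (((n + 1 : ℝ)) ^ 2 * A + B))) atTop (𝓝 (1 / 2)) := by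
  have h1 : Tendsto (fun n : ℕ => ((n + 1 : ℝ)) ^ 2 * A + B) atTop atTop := by
    apply tendsto_atTop_add_const_right
    apply Tendsto.atTop_mul_const hA
    exact (tendsto_pow_atTop two_ne_zero).comp (tendsto_atTop_add_const_right _ _ tendsto_natCast_atTop_atTop)
  have h2 : Tendsto (fun n : ℕ => 1 / 2 - B / (((n + 1 : ℝ)) ^ 2 * A + B)) atTop (𝓝 (1 / 2 - 0)) :=
    (h1.const_div_atTop B).const_sub _
  rw [sub_zero] at h2
  refine h2.congr fun n => ?_
  have : 0 < ((n + 1 : ℝ)) ^ 2 * A + B := by positivity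
  field_simp; ring

lemma ae_apply_ne_zero (i : Fin 2) : ∀ᵐ ξ : Plane, ξ i ≠ 0 := by
  have h := Measure.addHaar_submodule (volume : Measure Plane) (LinearMap.ker (EuclideanSpace.proj i : Plane →L[ℝ] ℝ).toLinearMap) (by
    intro h
    have : (EuclideanSpace.single i (1:ℝ) : Plane) ∈ LinearMap.ker (EuclideanSpace.proj i : Plane →L[ℝ] ℝ).toLinearMap := by
      rw [h]; trivial
    simp at this)
  rw [ae_iff]
  convert h using 2
  ext ξ; simp

/-- The vector of scaling factors that stretches the `i`-th coordinate only. -/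
def stretch (i : Fin 2) (n : ℕ) (j : Fin 2) : ℝ := if j = i then n + 1 else 1

lemma stretch_pos (i : Fin 2) (n : ℕ) (j : Fin 2) : 0 < stretch i n j := by
  unfold stretch; split_ifs <;> positivity

/-- By `H1.quad_rescale`, stretching a bump evaluates the symbol at stretched frequencies. By
dominated convergence these forms tend to d times the quartic term, so a large enough stretch has
positive interaction. -/
lemma exists_interaction_pos_of_tendsto {a b d : ℝ} (hd : 0 < d) (i : Fin 2)
    (hs : ∀ᵐ ξ, Tendsto (fun n => (intSymbol a b).toFun (diagEquiv (stretch i n) (stretch_pos i n) ξ)) atTop (𝓝 d)) :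
    ∃ u : H1, 0 < interaction a b u := by
  set u := H1.ofTest bump isTest_bump with hu
  have hq : 0 < u.quartic := H1.ofTest_bump_quartic_pos
  have hF := u.integrable_norm_sq_fourier_density
  have ht : Tendsto (fun n => ∫ ξ, (intSymbol a b).toFun (diagEquiv (stretch i n) (stretch_pos i n) ξ) * ‖𝓕 (fun x => (u.density x : ℂ)) ξ‖ ^ 2)
      atTop (𝓝 (∫ ξ, d * ‖𝓕 (fun x => (u.density x : ℂ)) ξ‖ ^ 2)) := by
    refine tendsto_integral_of_dominated_convergence (fun ξ => (intSymbol a b).bound * ‖𝓕 (fun x => (u.density x : ℂ)) ξ‖ ^ 2) ?_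
      (hF.const_mul _) ?_ ?_
    · intro n
      exact ((intSymbol a b).measurable.comp (diagEquiv (stretch i n) (stretch_pos i n)).continuous.measurable).aestronglyMeasurable.mul hF.1
    · intro n
      filter_upwards with ξ
      rw [norm_mul, Real.norm_of_nonneg (sq_nonneg ‖𝓕 (fun x => (u.density x : ℂ)) ξ‖)]
      exact mul_le_mul_of_nonneg_right ((intSymbol a b).le_bound _) (sq_nonneg _)
    · filter_upwards [hs] with ξ hξ using hξ.mul_const _
  rw [integral_const_mul, u.integral_norm_sq_fourier_density] at ht
  obtain ⟨n, hn⟩ := (ht.eventually (lt_mem_nhds (mul_pos hd hq))).exists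
  refine ⟨u.rescale 1 (stretch i n) (stretch_pos i n) 0, ?_⟩
  rw [interaction_eq_quad, H1.quad_rescale]
  have h0 := stretch_pos i n 0
  have h1 := stretch_pos i n 1
  positivity

/-- The values a + b/2 and a - b/2 are those of the symbol on the first and second axis. Stretching
along an axis drives almost every frequency towards it in direction. -/
theorem exists_interaction_pos {a b : ℝ} (h : 0 < a + b / 2 ∨ 0 < a - b / 2) : ∃ u : H1, 0 < interaction a b u := by
  rcases h with h | h
  · refine exists_interaction_pos_of_tendsto h 0 ?_
    filter_upwards [ae_apply_ne_zero 0] with ξ hξ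
    have := (((tendsto_stretch (A := ξ 0 ^ 2) (B := ξ 1 ^ 2) (by positivity) (by positivity)).const_mul b).const_add a)
    rw [mul_one_div] at this
    refine this.congr fun n => ?_
    simp [intSymbol, dipSymbol, quadHarm, norm_sq_plane, diagEquiv_apply, stretch, mul_pow]
  · refine exists_interaction_pos_of_tendsto h 1 ?_
    filter_upwards [ae_apply_ne_zero 1] with ξ hξ
    have := (((tendsto_stretch (A := ξ 1 ^ 2) (B := ξ 0 ^ 2) (by positivity) (by positivity)).const_mul (-b)).const_add a)
    rw [mul_one_div, neg_div, ← sub_eq_add_neg] at this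
    refine this.congr fun n => ?_
    simp only [intSymbol, dipSymbol, quadHarm, norm_sq_plane, diagEquiv_apply, stretch, mul_pow]
    simp only [if_true, zero_ne_one, if_false, one_pow, one_mul]
    rw [neg_mul, ← mul_neg, ← neg_div, neg_sub]
    congr 4; ring

/-- The Rayleigh quotient is bounded by every admissible constant. -/
lemma div_le_of_isGNConst {a b C : ℝ} (hC : IsGNConst a b C) {u : H1} (hu : 0 < u.dirichlet * u.mass) :
    interaction a b u / (u.dirichlet * u.mass) ≤ C := by
  rw [div_le_iff₀ hu]; exact hC u

lemma dirichlet_mul_mass_pos_of_interaction_pos {a b : ℝ} {u : H1} (h : 0 < interaction a b u) :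
    0 < u.dirichlet * u.mass := by
  have h1 := isGNConst_bound a b u
  by_contra h2
  have h3 : u.dirichlet * u.mass = 0 := le_antisymm (not_lt.1 h2) (mul_nonneg u.dirichlet_nonneg u.mass_nonneg)
  rw [h3] at h1; linarith

/-- A function with positive interaction bounds all admissible constants below by its positive
Rayleigh quotient. Each single inequality is closed in the constant, hence passes to the infimum;
when mass times Dirichlet energy is zero, any one admissible constant already gives it. -/
theorem isLeast_gnConst {a b : ℝ} (h : 0 < a + b / 2 ∨ 0 < a - b / 2) :
    0 < gnConst a b ∧ IsLeast {C : ℝ | IsGNConst a b C} (gnConst a b) := by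
  obtain ⟨w, hw⟩ := exists_interaction_pos h
  have hw' := dirichlet_mul_mass_pos_of_interaction_pos hw
  have hne : {C : ℝ | IsGNConst a b C}.Nonempty := ⟨_, isGNConst_bound a b⟩
  have hbdd : BddBelow {C : ℝ | IsGNConst a b C} := ⟨_, fun C hC => div_le_of_isGNConst hC hw'⟩
  refine ⟨(div_pos hw hw').trans_le (le_csInf hne fun C hC => div_le_of_isGNConst hC hw'), ?_, fun C hC => csInf_le hbdd hC⟩
  intro u
  rcases (mul_nonneg u.dirichlet_nonneg u.mass_nonneg).eq_or_lt with h0 | h0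
  · have := isGNConst_bound a b u
    rw [← h0] at this ⊢; simpa using this
  · rw [← div_le_iff₀ h0]
    exact le_csInf hne fun C hC => div_le_of_isGNConst hC h0

/-! ### Nonvanishing -/

/-- The shear (x, y) ↦ (x, x + y) preserves measure. This turns local inequalities around y into a
global one on integrating over y. -/
lemma integral_integral_mul_add {f k : Plane → ℝ} (hf : Integrable f) (hk : Integrable k) :
    Integrable (fun y => ∫ x, f x * k (x + y)) ∧ ∫ y, ∫ x, f x * k (x + y) = (∫ x, f x) * ∫ x, k x := by
  have h1 : Integrable (fun z : Plane × Plane => f z.1 * k (z.1 + z.2)) (volume.prod volume) :=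
    (measurePreserving_prod_add (volume : Measure Plane) (volume : Measure Plane)).integrable_comp_of_integrable (hf.mul_prod hk)
  refine ⟨h1.integral_prod_right, ?_⟩
  rw [← integral_prod_symm _ h1, integral_prod _ h1, ← integral_mul_const]
  congr 1; ext x
  simp only
  rw [integral_const_mul, integral_add_left_eq_self]

namespace H1

/-- The translate `x ↦ u (x + y)`. -/
def translate (u : H1) (y : Plane) : H1 := u.rescale 1 (fun _ => 1) (fun _ => one_pos) y

lemma translate_density (u : H1) (y x : Plane) : (u.translate y).density x = u.density (x + y) := by
  rw [translate, rescale_density]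
  have : diagAffine (fun _ => 1) (fun _ => one_pos) y x = x + y := by
    rw [diagAffine_apply]; congr 1; ext i; simp [diagEquiv_apply]
  rw [this]; ring

lemma translate_norm_grad (u : H1) (y x : Plane) (i : Fin 2) : ‖(u.translate y).grad i x‖ = ‖u.grad i (x + y)‖ := by
  have : diagAffine (fun _ => 1) (fun _ => one_pos) y x = x + y := by
    rw [diagAffine_apply]; congr 1; ext i; simp [diagEquiv_apply]
  simp [translate, rescale, this]

lemma translate_mass (u : H1) (y : Plane) : (u.translate y).mass = u.mass := by
  rw [translate, rescale_mass]; simp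

lemma translate_dirichlet (u : H1) (y : Plane) : (u.translate y).dirichlet = u.dirichlet := by
  rw [translate, rescale_dirichlet_iso _ _ _ _ one_pos]; simp

lemma translate_interaction (u : H1) (a b : ℝ) (y : Plane) : interaction a b (u.translate y) = interaction a b u := by
  rw [translate, interaction_rescale_iso _ _ _ _ one_pos]; simp

/-- The squared gradient of the unit cutoff. -/
def cutGradSq (x : Plane) : ℝ := ∑ i, pderiv i (cut 1) x ^ 2

lemma continuous_cutGradSq : Continuous cutGradSq :=
  continuous_finsetSum _ fun i _ => ((isTest_cut one_pos).pderiv i).continuous.pow 2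

lemma integrable_cutGradSq : Integrable cutGradSq := by
  have h : ∀ i, Integrable (fun x => pderiv i (cut 1) x ^ 2) := fun i => by
    have ht := (isTest_cut one_pos).pderiv i
    have := (ht.mul ht.1).integrable
    simpa only [← sq] using this
  unfold cutGradSq
  simp only [Fin.sum_univ_two]
  exact (h 0).add (h 1)

lemma exists_cutGradSq_bound : ∃ B, ∀ x, |cutGradSq x| ≤ B := by
  obtain ⟨B0, -, hB0⟩ := ((isTest_cut one_pos).pderiv 0).exists_bound
  obtain ⟨B1, -, hB1⟩ := ((isTest_cut one_pos).pderiv 1).exists_bound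
  refine ⟨B0 ^ 2 + B1 ^ 2, fun x => ?_⟩
  simp only [cutGradSq, Fin.sum_univ_two]
  rw [abs_of_nonneg (by positivity), ← sq_abs (pderiv 0 (cut 1) x), ← sq_abs (pderiv 1 (cut 1) x)]
  gcongr
  · exact hB0 x
  · exact hB1 x

lemma integrable_cut_pow {k : ℕ} (hk : k ≠ 0) : Integrable (fun x => cut 1 x ^ k) :=
  ((isTest_cut one_pos).continuous.pow k).integrable_of_hasCompactSupport
    ((isTest_cut one_pos).2.comp_left (g := fun t : ℝ => t ^ k) (by simp [hk]))

/-- The squared norm of the weak gradient. -/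
def gradSq (u : H1) (x : Plane) : ℝ := ∑ i, ‖u.grad i x‖ ^ 2

lemma integrable_gradSq (u : H1) : Integrable u.gradSq :=
  integrable_finsetSum _ fun i _ => integrable_norm_sq (u.memLp_grad i)

/-- The localization of `u` to the ball of radius two around `y`, moved to the origin. -/
def localize (u : H1) (y : Plane) : H1 := (u.translate y).mulTest (cut 1) (isTest_cut one_pos)

lemma localize_quartic (u : H1) (y : Plane) :
    (u.localize y).quartic = ∫ x, cut 1 x ^ 4 * ‖u.toFun (x + y)‖ ^ 4 := by
  unfold quartic
  congr 1; ext x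
  have := u.translate_density y x
  simp only [density] at this
  have e1 : ‖(u.localize y).toFun x‖ = |cut 1 x| * ‖(u.translate y).toFun x‖ := by simp [localize, mulTest]
  calc _ = (|cut 1 x| ^ 2) ^ 2 * (‖(u.translate y).toFun x‖ ^ 2) ^ 2 := by rw [e1]; ring
    _ = cut 1 x ^ 4 * (‖u.toFun (x + y)‖ ^ 2) ^ 2 := by rw [this, sq_abs]; ring
    _ = _ := by ring

lemma localize_mass_le (u : H1) (y : Plane) :
    (u.localize y).mass ≤ ∫ x in Metric.ball (0 : Plane) 2, (u.translate y).density x := by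
  rw [← integral_indicator measurableSet_ball]
  refine integral_mono (u.localize y).integrable_density ((u.translate y).integrable_density.indicator measurableSet_ball) fun x => ?_
  have e1 : (u.localize y).density x = cut 1 x ^ 2 * (u.translate y).density x := by simp [localize, mulTest, density, mul_pow]
  change (u.localize y).density x ≤ _
  rw [e1]
  by_cases hx : x ∈ Metric.ball (0 : Plane) 2
  · rw [Set.indicator_of_mem hx]
    have h1 := cut_nonneg 1 x
    have h2 := cut_le_one 1 x
    have h3 : cut 1 x ^ 2 ≤ 1 := by nlinarith
    exact mul_le_of_le_one_left ((u.translate y).density_nonneg x) h3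
  · rw [cut_eq_zero one_pos (by simpa using hx), Set.indicator_of_notMem hx]; simp

lemma localize_dirichlet_le (u : H1) (y : Plane) :
    (u.localize y).dirichlet ≤ 2 * ((∫ x, cut 1 x ^ 2 * u.gradSq (x + y)) + ∫ x, cutGradSq x * u.density (x + y)) := by
  obtain ⟨B, hB⟩ := exists_cutGradSq_bound
  have i1 : Integrable (fun x => cut 1 x ^ 2 * u.gradSq (x + y)) := by
    refine (u.integrable_gradSq.comp_add_right y).bdd_mul (c := 1) ((isTest_cut one_pos).continuous.pow 2).aestronglyMeasurable
      (ae_of_all _ fun x => ?_)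
    have h1 := cut_nonneg 1 x
    have h2 := cut_le_one 1 x
    rw [Real.norm_of_nonneg (by positivity)]; nlinarith
  have i2 : Integrable (fun x => cutGradSq x * u.density (x + y)) :=
    (u.integrable_density.comp_add_right y).bdd_mul continuous_cutGradSq.aestronglyMeasurable (ae_of_all _ hB)
  rw [← integral_add i1 i2, ← integral_const_mul]
  refine integral_mono (u.localize y).integrable_gradSq ((i1.add i2).const_mul 2) fun x => ?_
  simp only [gradSq, cutGradSq]
  rw [Finset.mul_sum, Finset.sum_mul, ← Finset.sum_add_distrib, Finset.mul_sum]
  refine Finset.sum_le_sum fun i _ => ?_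
  rw [← u.translate_density y x, ← u.translate_norm_grad y x i]
  have h1 : ‖(u.localize y).grad i x‖ ≤ |cut 1 x| * ‖(u.translate y).grad i x‖ + |pderiv i (cut 1) x| * ‖(u.translate y).toFun x‖ := by
    refine (norm_add_le _ _).trans (le_of_eq ?_)
    rw [norm_smul, norm_smul]; rfl
  rw [← sq_abs (cut 1 x), ← sq_abs (pderiv i (cut 1) x)]
  simp only [density]
  have h2 := norm_nonneg ((u.localize y).grad i x)
  nlinarith [sq_nonneg (|cut 1 x| * ‖(u.translate y).grad i x‖ - |pderiv i (cut 1) x| * ‖(u.translate y).toFun x‖)]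

/-- Apply `H1.quartic_le` to u localized around y, where the mass factor is at most δ, then
integrate over y. The 12 is the constant 6 times the 2 from squaring the product rule. -/
lemma integral_cut_mul_quartic_le {u : H1} {δ : ℝ}
    (hδ : ∀ y, ∫ x in Metric.ball (0 : Plane) 2, (u.translate y).density x ≤ δ) :
    (∫ x, cut 1 x ^ 4) * u.quartic ≤
      12 * δ * ((∫ x, cut 1 x ^ 2) * u.dirichlet + (∫ x, cutGradSq x) * u.mass) := by
  have hδ0 : 0 ≤ δ := (u.localize 0).mass_nonneg.trans ((u.localize_mass_le 0).trans (hδ 0))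
  obtain ⟨j4, k4⟩ := integral_integral_mul_add (integrable_cut_pow (k := 4) (by norm_num)) u.integrable_pow_four
  obtain ⟨j2, k2⟩ := integral_integral_mul_add (integrable_cut_pow (k := 2) (by norm_num)) u.integrable_gradSq
  obtain ⟨jη, kη⟩ := integral_integral_mul_add integrable_cutGradSq u.integrable_density
  have hloc : ∀ y, ∫ x, cut 1 x ^ 4 * ‖u.toFun (x + y)‖ ^ 4 ≤
      12 * δ * ((∫ x, cut 1 x ^ 2 * u.gradSq (x + y)) + ∫ x, cutGradSq x * u.density (x + y)) := by
    intro y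
    have d1 := u.localize_dirichlet_le y
    have d0 := (u.localize y).dirichlet_nonneg
    rw [← localize_quartic]
    refine (u.localize y).quartic_le.trans ?_
    have := mul_le_mul d1 ((u.localize_mass_le y).trans (hδ y)) (u.localize y).mass_nonneg (d0.trans d1)
    linarith
  have hfin := integral_mono j4 ((j2.add jη).const_mul (12 * δ)) hloc
  rw [k4] at hfin
  refine hfin.trans (le_of_eq ?_)
  rw [integral_const_mul, integral_add' j2 jη, k2, kη]; rfl

/-- Lions-type nonvanishing: if every ball carried mass below δ, the averaged local inequality would
push the quartic term below c. -/
theorem exists_ball_mass_ge {c C : ℝ} (hc : 0 < c) : ∃ δ, 0 < δ ∧ ∀ u : H1, u.mass ≤ C → u.dirichlet ≤ C →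
    c ≤ u.quartic → ∃ y, δ ≤ ∫ x in Metric.ball (0 : Plane) 2, (u.translate y).density x := by
  set A2 := ∫ x, cut 1 x ^ 2 with hA2
  set A4 := ∫ x, cut 1 x ^ 4 with hA4
  set H := ∫ x, cutGradSq x with hH
  have hA2' : 0 ≤ A2 := integral_nonneg fun x => sq_nonneg _
  have hH' : 0 ≤ H := integral_nonneg fun x => Finset.sum_nonneg fun i _ => sq_nonneg _
  have hA4' : 0 < A4 := Continuous.integral_pos_of_hasCompactSupport_nonneg_nonzero (x := 0) ((isTest_cut one_pos).continuous.pow 4)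
    ((isTest_cut one_pos).2.comp_left (g := fun t : ℝ => t ^ 4) (by simp)) (fun x => by positivity) (by
      rw [cut_eq_one one_pos (by simp)]; norm_num)
  set T := 12 * (A2 + H) * |C| with hT
  have hT0 : 0 ≤ T := by positivity
  -- The argument yields A4 * c ≤ δ * T; the added 1 makes this contradict δ * (T + 1) = A4 * c.
  refine ⟨A4 * c / (T + 1), by positivity, fun u hM hD hq => ?_⟩
  by_contra! hcon
  set δ := A4 * c / (T + 1) with hδ
  have hδ0 : 0 < δ := by positivity
  have hC0 : 0 ≤ C := u.mass_nonneg.trans hM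
  have h4 := integral_cut_mul_quartic_le fun y => (hcon y).le
  have h5 : A2 * u.dirichlet + H * u.mass ≤ (A2 + H) * |C| := by
    rw [abs_of_nonneg hC0]; nlinarith
  have h6 : A4 * c ≤ δ * T := by
    calc A4 * c ≤ A4 * u.quartic := by gcongr
      _ ≤ 12 * δ * (A2 * u.dirichlet + H * u.mass) := h4
      _ ≤ 12 * δ * ((A2 + H) * |C|) := by gcongr
      _ = δ * T := by rw [hT]; ring
  have h7 : δ * (T + 1) = A4 * c := by rw [hδ]; field_simp
  linarith

end H1

/-! ### Existence of an optimizer -/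

namespace H1

/-- Rescaling to unit mass and unit Dirichlet energy. -/
lemma exists_normalized (u : H1) (hD : 0 < u.dirichlet) (hM : 0 < u.mass) :
    ∃ w : H1, w.mass = 1 ∧ w.dirichlet = 1 ∧
      ∀ a b, interaction a b w = interaction a b u / (u.dirichlet * u.mass) := by
  -- Amplitude c and dilation t multiply the mass by c²/t² and the Dirichlet energy by c²; c² = 1/D
  -- and t² = M/D normalize both.
  set t := √(u.mass / u.dirichlet) with ht
  have ht0 : 0 < t := Real.sqrt_pos.2 (div_pos hM hD)
  have ht2 : t * t = u.mass / u.dirichlet := Real.mul_self_sqrt (div_pos hM hD).le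
  set c := (√u.dirichlet)⁻¹ with hc
  have hc2 : c ^ 2 = (u.dirichlet)⁻¹ := by rw [hc, inv_pow, Real.sq_sqrt hD.le]
  refine ⟨u.rescale c (fun _ => t) (fun _ => ht0) 0, ?_, ?_, fun a b => ?_⟩
  · rw [rescale_mass, ht2, hc2]; field_simp
  · rw [rescale_dirichlet_iso _ _ _ _ ht0, hc2]; field_simp
  · rw [interaction_rescale_iso _ _ _ _ ht0, show c ^ 4 = (c ^ 2) ^ 2 by ring, ht2, hc2]; field_simp

lemma setIntegral_density_le (u w : H1) (s : Set Plane) :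
    ∫ x in s, u.density x ≤ 2 * (∫ x in s, w.density x) + 2 * ∫ x in s, (u.sub w).density x := by
  have i1 := w.integrable_density.integrableOn (s := s) |>.const_mul 2
  have i2 := (u.sub w).integrable_density.integrableOn (s := s) |>.const_mul 2
  rw [← integral_const_mul, ← integral_const_mul, ← integral_add i1 i2]
  refine integral_mono u.integrable_density.integrableOn (i1.add i2) fun x => ?_
  simp only [density, sub]
  have := norm_add_le (w.toFun x) (u.toFun x - w.toFun x)
  rw [add_sub_cancel] at this
  nlinarith [sq_nonneg (‖w.toFun x‖ - ‖u.toFun x - w.toFun x‖), norm_nonneg (u.toFun x)]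

lemma WeakTo.tendsto_interaction_sub {u : ℕ → H1} {w : H1} (h : WeakTo u w) {C : ℝ} (hM : ∀ n, (u n).mass ≤ C)
    (hD : ∀ n, (u n).dirichlet ≤ C) (a b : ℝ) :
    Tendsto (fun n => interaction a b (u n) - interaction a b ((u n).sub w)) atTop (𝓝 (interaction a b w)) := by
  simp only [interaction_eq_quad]
  exact h.tendsto_quad_sub hM hD _

lemma WeakTo.tendsto_integral_ball_density_sub {u : ℕ → H1} {w : H1} (h : WeakTo u w) {C : ℝ} (hM : ∀ n, (u n).mass ≤ C)
    (hD : ∀ n, (u n).dirichlet ≤ C) (r : ℝ) :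
    Tendsto (fun n => ∫ x in Metric.ball (0 : Plane) r, ((u n).sub w).density x) atTop (𝓝 0) := by
  have hv : WeakTendsto (fun n => ((u n).sub w).lp) 0 := by
    simp only [sub_lp]; exact h.1.sub_self
  refine tendsto_integral_ball_density (C := 2 * C + 2 * w.mass + 2 * w.dirichlet) (fun n => ?_) (fun n => ?_) hv r
  · have := (u n).sub_mass_le w; have := hM n; have := w.dirichlet_nonneg; linarith
  · have := (u n).sub_dirichlet_le w; have := hD n; have := w.mass_nonneg; linarith

end H1

open H1 in
-- Strict superadditivity of the product of mass and Dirichlet energy excludes dichotomy: for the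
-- normalized sequence a nonzero weak limit must carry all of both.
theorem exists_optimizer {a b : ℝ} (h : 0 < a + b / 2 ∨ 0 < a - b / 2) :
    ∃ u : H1, 0 < u.mass ∧ interaction a b u = gnConst a b * (u.dirichlet * u.mass) := by
  obtain ⟨hC, hleast⟩ := isLeast_gnConst h
  set C := gnConst a b with hCdef
  have hGN : IsGNConst a b C := hleast.1
  -- With n + 2 in the denominator all values exceed C/2, which keeps the quartic term away from
  -- zero.
  have hseq : ∀ n : ℕ, ∃ u : H1, u.mass = 1 ∧ u.dirichlet = 1 ∧ C - C / (n + 2) < interaction a b u := by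
    intro n
    have hlt : C - C / (n + 2) < C := by have : 0 < C / ((n:ℝ) + 2) := by positivity
                                         linarith
    have hnot : ¬ IsGNConst a b (C - C / (n + 2)) := fun hc => absurd (hleast.2 hc) (not_le.2 hlt)
    simp only [IsGNConst, not_forall, not_le] at hnot
    obtain ⟨u, hu⟩ := hnot
    have hpos : 0 < u.dirichlet * u.mass := by
      by_contra h2
      have h3 : u.dirichlet * u.mass = 0 := le_antisymm (not_lt.1 h2) (mul_nonneg u.dirichlet_nonneg u.mass_nonneg)
      have h4 := hGN u
      rw [h3] at h4 hu; linarith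
    obtain ⟨hD, hM⟩ : 0 < u.dirichlet ∧ 0 < u.mass :=
      ⟨pos_of_mul_pos_left hpos u.mass_nonneg, pos_of_mul_pos_right hpos u.dirichlet_nonneg⟩
    obtain ⟨w, h1, h2, h3⟩ := u.exists_normalized hD hM
    exact ⟨w, h1, h2, by rw [h3, lt_div_iff₀ hpos]; exact hu⟩
  choose u hM hD hF using hseq
  set B := (intSymbol a b).bound with hB
  have hB0 : 0 ≤ B := (intSymbol a b).bound_nonneg
  have hq : ∀ n, C / 2 / (B + 1) ≤ (u n).quartic := by
    intro n
    have h1 := interaction_le_quartic a b (u n)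
    have h2 : C / ((n:ℝ) + 2) ≤ C / 2 := by gcongr; have : (0:ℝ) ≤ n := by positivity
                                            linarith
    have h3 := hF n
    have h4 := (u n).quartic_nonneg
    rw [div_le_iff₀ (by linarith)]
    nlinarith
  obtain ⟨δ, hδ, hloc⟩ := exists_ball_mass_ge (c := C / 2 / (B + 1)) (C := 1) (by positivity)
  choose y hy using fun n => hloc (u n) (hM n).le (hD n).le (hq n)
  let ut : ℕ → H1 := fun n => (u n).translate (y n)
  have htM : ∀ n, (ut n).mass = 1 := fun n => by simp only [ut]; rw [translate_mass, hM]
  have htD : ∀ n, (ut n).dirichlet = 1 := fun n => by simp only [ut]; rw [translate_dirichlet, hD]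
  have htF : ∀ n, C - C / (n + 2) < interaction a b (ut n) := fun n => by simp only [ut]; rw [translate_interaction]; exact hF n
  have htF' : ∀ n, interaction a b (ut n) ≤ C := fun n => by
    have := hGN (ut n); rwa [htM, htD, mul_one, mul_one] at this
  have hlim : Tendsto (fun n => interaction a b (ut n)) atTop (𝓝 C) := by
    have h1 : Tendsto (fun n : ℕ => C - C / ((n:ℝ) + 2)) atTop (𝓝 (C - 0)) :=
      ((tendsto_atTop_add_const_right _ _ tendsto_natCast_atTop_atTop).const_div_atTop C).const_sub _
    rw [sub_zero] at h1
    exact tendsto_of_tendsto_of_tendsto_of_le_of_le h1 tendsto_const_nhds (fun n => (htF n).le) htF'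
  obtain ⟨w, φ, hφ, hw⟩ := exists_weakTo_subseq (fun n => (htM n).le) (fun n => (htD n).le)
  have hM1 : ∀ n, (ut (φ n)).mass ≤ 1 := fun n => (htM _).le
  have hD1 : ∀ n, (ut (φ n)).dirichlet ≤ 1 := fun n => (htD _).le
  -- Local strong convergence: the mass δ kept by the ball of radius 2 passes to w up to a factor 2.
  have hwM : 0 < w.mass := by
    have h1 := (hw.tendsto_integral_ball_density_sub hM1 hD1 2).const_mul 2 |>.const_add (2 * ∫ x in Metric.ball (0 : Plane) 2, w.density x)
    have h2 := ge_of_tendsto' h1 fun n => (hy (φ n)).trans (setIntegral_density_le _ w _)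
    rw [mul_zero, add_zero] at h2
    have h3 : ∫ x in Metric.ball (0 : Plane) 2, w.density x ≤ w.mass :=
      setIntegral_le_integral w.integrable_density (ae_of_all _ w.density_nonneg)
    linarith
  have tM : Tendsto (fun n => ((ut (φ n)).sub w).mass) atTop (𝓝 (1 - w.mass)) := by
    have := hw.tendsto_mass_sub.const_sub 1
    refine this.congr fun n => ?_
    rw [htM]; ring
  have tD : Tendsto (fun n => ((ut (φ n)).sub w).dirichlet) atTop (𝓝 (1 - w.dirichlet)) := by
    have := hw.tendsto_dirichlet_sub.const_sub 1
    refine this.congr fun n => ?_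
    rw [htD]; ring
  have tF : Tendsto (fun n => interaction a b ((ut (φ n)).sub w)) atTop (𝓝 (C - interaction a b w)) := by
    have := (hlim.comp hφ.tendsto_atTop).sub (hw.tendsto_interaction_sub hM1 hD1 a b)
    refine this.congr fun n => ?_
    simp only [Function.comp_apply]; ring
  -- The inequality for the remainders, in the limit where all three functionals have split.
  have k1 : C - interaction a b w ≤ C * ((1 - w.dirichlet) * (1 - w.mass)) :=
    le_of_tendsto_of_tendsto' tF ((tD.mul tM).const_mul C) fun n => hGN _
  have k2 := hGN w
  have k3 : 0 ≤ 1 - w.mass := ge_of_tendsto' tM fun n => mass_nonneg _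
  have k4 : 0 ≤ 1 - w.dirichlet := ge_of_tendsto' tD fun n => dirichlet_nonneg _
  have k5 := w.dirichlet_nonneg
  -- Adding the inequality for w leaves this sum of nonnegative mixed terms, which must vanish.
  -- Positive mass then gives D = 1, and D = 1 gives M = 1.
  have k6 : w.dirichlet * (1 - w.mass) + w.mass * (1 - w.dirichlet) ≤ 0 := by
    have : C * (w.dirichlet * (1 - w.mass) + w.mass * (1 - w.dirichlet)) ≤ 0 := by nlinarith
    exact nonpos_of_mul_nonpos_right this hC
  have k7 : w.mass * (1 - w.dirichlet) ≤ 0 := by nlinarith [mul_nonneg k5 k3]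
  have k8 : w.dirichlet = 1 := by nlinarith
  have k9 : w.mass = 1 := by rw [k8] at k6; linarith
  refine ⟨w, hwM, le_antisymm k2 ?_⟩
  rw [k8, k9] at k1 ⊢
  linarith


/-! ### Existence of ground states -/

/-- The symbol is affine in `dipSymbol`, which ranges in [-1/2, 1/2], so it is nonpositive as soon
as its two end values are. -/
lemma isGNConst_zero {a b : ℝ} (h1 : a + b / 2 ≤ 0) (h2 : a - b / 2 ≤ 0) : IsGNConst a b 0 := by
  intro u
  rw [zero_mul, interaction_eq_quad]
  refine (Symbol.quad_le _ _ (c := 0) fun ξ => ?_).trans (by simp)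
  have h3 := abs_le.1 (dipSymbol.le_bound ξ)
  have h4 : dipSymbol.bound = 1 / 2 := rfl
  rw [h4] at h3
  simp only [intSymbol]
  nlinarith [h3.1, h3.2]

/-- Fatou's lemma, arranged to give integrability of the limit too, as admissibility of the
minimizer requires. -/
lemma integral_le_of_tendsto_ae {f : ℕ → Plane → ℝ} {g : Plane → ℝ} {L : ℝ} (hf : ∀ n, Integrable (f n))
    (h0 : ∀ n x, 0 ≤ f n x) (hg : AEStronglyMeasurable g volume)
    (hlim : ∀ᵐ x, Tendsto (fun n => f n x) atTop (𝓝 (g x))) (hL : Tendsto (fun n => ∫ x, f n x) atTop (𝓝 L)) :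
    Integrable g ∧ ∫ x, g x ≤ L := by
  have hg0 : 0 ≤ᵐ[volume] g := by
    filter_upwards [hlim] with x hx using ge_of_tendsto' hx fun n => h0 n x
  have hL0 : 0 ≤ L := ge_of_tendsto' hL fun n => integral_nonneg (h0 n)
  have hle : ∫⁻ x, ENNReal.ofReal (g x) ≤ ENNReal.ofReal L := by
    calc ∫⁻ x, ENNReal.ofReal (g x) = ∫⁻ x, liminf (fun n => ENNReal.ofReal (f n x)) atTop := by
          apply lintegral_congr_ae
          filter_upwards [hlim] with x hx
          exact ((ENNReal.continuous_ofReal.tendsto _).comp hx).liminf_eq.symm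
      _ ≤ liminf (fun n => ∫⁻ x, ENNReal.ofReal (f n x)) atTop :=
          lintegral_liminf_le' fun n => (hf n).1.aemeasurable.ennreal_ofReal
      _ = liminf (fun n => ENNReal.ofReal (∫ x, f n x)) atTop := by
          congr 1; ext n
          rw [ofReal_integral_eq_lintegral_ofReal (hf n) (ae_of_all _ (h0 n))]
      _ = ENNReal.ofReal L := ((ENNReal.continuous_ofReal.tendsto _).comp hL).liminf_eq
  have hi : Integrable g := by
    refine ⟨hg, ?_⟩
    rw [hasFiniteIntegral_iff_ofReal hg0]
    exact hle.trans_lt ENNReal.ofReal_lt_top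
  refine ⟨hi, ?_⟩
  rw [← ofReal_integral_eq_lintegral_ofReal hi hg0] at hle
  exact (ENNReal.ofReal_le_ofReal_iff hL0).1 hle

/-- On states supported in a fixed ball a continuous potential is bounded. -/
lemma exists_potential_bound {V : Plane → ℝ} (hV : Continuous V) (r : ℝ) : ∃ A, ∀ u : H1,
    (∀ x, r ≤ ‖x‖ → u.toFun x = 0) →
      Integrable (fun x => V x * ‖u.toFun x‖ ^ 2) ∧ ∫ x, V x * ‖u.toFun x‖ ^ 2 ≤ A * u.mass := by
  obtain ⟨A, hA⟩ := (isCompact_closedBall (0 : Plane) r).exists_bound_of_continuousOn hV.continuousOn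
  refine ⟨A, fun u hu => ?_⟩
  have hb : ∀ x, ‖V x * ‖u.toFun x‖ ^ 2‖ ≤ A * ‖u.toFun x‖ ^ 2 := by
    intro x
    by_cases hx : r ≤ ‖x‖
    · simp [hu x hx]
    · rw [norm_mul, Real.norm_of_nonneg (sq_nonneg ‖u.toFun x‖)]
      exact mul_le_mul_of_nonneg_right (hA x (by simpa using (not_le.1 hx).le)) (sq_nonneg _)
  have hi : Integrable (fun x => A * ‖u.toFun x‖ ^ 2) := u.integrable_density.const_mul A
  refine ⟨hi.mono' (hV.aestronglyMeasurable.mul u.integrable_density.1) (ae_of_all _ hb), ?_⟩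
  rw [H1.mass, ← integral_const_mul]
  exact (le_abs_self _).trans (norm_integral_le_of_norm_le hi (ae_of_all _ hb))

lemma exists_admissible {V : Plane → ℝ} (hV : Continuous V) : ∃ u, Admissible V u := by
  set v := H1.ofTest bump isTest_bump with hv
  have hm : 0 < v.mass := H1.ofTest_bump_mass_pos
  obtain ⟨A, hA⟩ := exists_potential_bound hV 2
  refine ⟨v.rescale (√v.mass)⁻¹ (fun _ => 1) (fun _ => one_pos) 0, (hA _ fun x hx => ?_).1, ?_⟩
  · have e : diagAffine (fun _ => 1) (fun _ => one_pos) 0 x = x := by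
      rw [diagAffine_apply, add_zero]; ext i; simp [diagEquiv_apply]
    have : bump x = 0 := bump.zero_of_le_dist (by simpa [bump] using hx)
    simp [H1.rescale, e, hv, H1.ofTest, this]
  · rw [H1.rescale_mass, inv_pow, Real.sq_sqrt hm.le]; field_simp

lemma IsTrap.exists_min {V : Plane → ℝ} (hV : IsTrap V) : ∃ c, ∀ x, 0 ≤ V x + c := by
  obtain ⟨x0, hx0⟩ := hV.1.continuous.exists_forall_le hV.2
  exact ⟨-V x0, fun x => by linarith [hx0 x]⟩

lemma IsTrap.exists_radius {V : Plane → ℝ} (hV : IsTrap V) (K : ℝ) : ∃ r : ℝ, ∀ x, r ≤ ‖x‖ → K ≤ V x := by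
  have h := hV.2.eventually (eventually_ge_atTop K)
  rw [← Metric.cobounded_eq_cocompact] at h
  obtain ⟨r, -, hr⟩ := (Filter.hasBasis_cobounded_norm (E := Plane)).eventually_iff.1 h
  exact ⟨r, fun x hx => hr hx⟩

lemma exists_energy_ge {κ β lam n : ℝ} (hκ : κ < 1) (hGN : IsGNConst (aParam β lam n) (bParam lam n) κ)
    (V : Plane → ℝ) : ∃ C, ∀ u : H1, u.mass = 1 →
      (1 - κ) / 4 * u.dirichlet + (∫ x, V x * ‖u.toFun x‖ ^ 2) - C ≤ energy V β lam n u := by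
  -- At unit mass the quartic term is at most six times the Dirichlet energy, so this ε costs (1 -
  -- κ)/4 of it, half of the (1 - κ)/2 that is available.
  obtain ⟨C, -, hC⟩ := exists_abs_energySymbol_quad_sub_le β lam n (ε := (1 - κ) / 12) (by linarith)
  refine ⟨C / 2, fun u hu => ?_⟩
  have h1 := (abs_le.1 (hC u)).2
  have h2 := hGN u
  have h3 := u.quartic_le
  rw [hu, mul_one] at h2 h3
  rw [hu] at h1
  rw [energy_eq]
  have h4 := mul_le_mul_of_nonneg_left h3 (by linarith : 0 ≤ (1 - κ) / 12)
  linarith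

namespace H1

/-- States that are trapped by a confining potential do not lose mass at infinity. -/
lemma WeakTo.mass_le_of_confined {u : ℕ → H1} {w : H1} (h : WeakTo u w) {C X m : ℝ} (hM : ∀ n, (u n).mass ≤ C)
    (hD : ∀ n, (u n).dirichlet ≤ C) {W : Plane → ℝ} (hW0 : ∀ x, 0 ≤ W x)
    (hW : ∀ K : ℝ, ∃ r : ℝ, ∀ x, r ≤ ‖x‖ → K ≤ W x) (hi : ∀ n, Integrable (fun x => W x * (u n).density x))
    (hX : ∀ n, ∫ x, W x * (u n).density x ≤ X)
    (hm : Tendsto (fun n => ((u n).sub w).mass) atTop (𝓝 m)) : m ≤ 0 := by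
  have hX0 : 0 ≤ X := (integral_nonneg fun x => mul_nonneg (hW0 x) ((u 0).density_nonneg x)).trans (hX 0)
  refine le_of_forall_pos_le_add fun ε hε => ?_
  rw [zero_add]
  -- Where W ≥ K the mass of each u n is at most X/K ≤ ε/4. The radius R below also puts the tail of
  -- w under ε/4, and the factors 2 bring the sum to ε.
  set K := 4 * X / ε + 1 with hK
  have hK0 : 0 < K := by positivity
  obtain ⟨r, hr⟩ := hW K
  have hcov := (aecover_ball (μ := (volume : Measure Plane)) (x := 0) (tendsto_id (α := ℝ) (x := atTop))).integral_tendsto_of_countably_generated w.integrable_density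
  have hev := (hcov.eventually (lt_mem_nhds (show (∫ x, w.density x) - ε / 4 < ∫ x, w.density x by linarith))).and (eventually_ge_atTop r)
  obtain ⟨R, hR1, hR2⟩ := hev.exists
  simp only [id] at hR1
  have hlim := (h.tendsto_integral_ball_density_sub hM hD R).add_const ε
  rw [zero_add] at hlim
  refine le_of_tendsto_of_tendsto' hm hlim fun n => ?_
  have hsplit : ((u n).sub w).mass = (∫ x in Metric.ball (0 : Plane) R, ((u n).sub w).density x) + ∫ x in (Metric.ball (0 : Plane) R)ᶜ, ((u n).sub w).density x :=
    (integral_add_compl measurableSet_ball ((u n).sub w).integrable_density).symm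
  have hw2 := integral_add_compl (measurableSet_ball (x := (0 : Plane)) (ε := R)) w.integrable_density
  have h1 : ∫ x in (Metric.ball (0 : Plane) R)ᶜ, ((u n).sub w).density x ≤
      2 * (∫ x in (Metric.ball (0 : Plane) R)ᶜ, (u n).density x) + 2 * ∫ x in (Metric.ball (0 : Plane) R)ᶜ, w.density x := by
    have i1 := (u n).integrable_density.integrableOn (s := (Metric.ball (0 : Plane) R)ᶜ) |>.const_mul 2
    have i2 := w.integrable_density.integrableOn (s := (Metric.ball (0 : Plane) R)ᶜ) |>.const_mul 2
    rw [← integral_const_mul, ← integral_const_mul, ← integral_add i1 i2]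
    refine integral_mono ((u n).sub w).integrable_density.integrableOn (i1.add i2) fun x => ?_
    simp only [density, sub]
    have := norm_sub_le ((u n).toFun x) (w.toFun x)
    nlinarith [sq_nonneg (‖(u n).toFun x‖ - ‖w.toFun x‖), norm_nonneg ((u n).toFun x - w.toFun x)]
  have h2 : K * ∫ x in (Metric.ball (0 : Plane) R)ᶜ, (u n).density x ≤ X := by
    rw [← integral_const_mul]
    calc _ ≤ ∫ x in (Metric.ball (0 : Plane) R)ᶜ, W x * (u n).density x := by
          refine setIntegral_mono_on ((u n).integrable_density.integrableOn.const_mul K) (hi n).integrableOn measurableSet_ball.compl fun x hx => ?_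
          refine mul_le_mul_of_nonneg_right (hr x (hR2.trans ?_)) ((u n).density_nonneg x)
          simpa using hx
      _ ≤ ∫ x, W x * (u n).density x :=
          setIntegral_le_integral (hi n) (ae_of_all _ fun x => mul_nonneg (hW0 x) ((u n).density_nonneg x))
      _ ≤ X := hX n
  have h3 : ∫ x in (Metric.ball (0 : Plane) R)ᶜ, (u n).density x ≤ ε / 4 := by
    have h4 : X ≤ K * (ε / 4) := by rw [hK]; field_simp; linarith
    exact le_of_mul_le_mul_left (h2.trans h4) hK0
  rw [hsplit]
  linarith

/-- When the remainders also vanish in L², `H1.quartic_le` with the Dirichlet bound makes their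
densities vanish in L², so the second part of the splitting disappears. -/
lemma WeakTo.tendsto_quad {u : ℕ → H1} {w : H1} (h : WeakTo u w) {B : ℝ} (hM : ∀ n, (u n).mass ≤ B)
    (hD : ∀ n, (u n).dirichlet ≤ B) (hm : Tendsto (fun n => ((u n).sub w).mass) atTop (𝓝 0)) (σ : Symbol) :
    Tendsto (fun n => σ.quad (u n).densLp) atTop (𝓝 (σ.quad w.densLp)) := by
  have tdv : Tendsto (fun k => ((u k).sub w).densLp) atTop (𝓝 0) := by
    rw [tendsto_zero_iff_norm_tendsto_zero]
    have h1 : Tendsto (fun k => √(6 * ((2 * B + 2 * w.dirichlet) * ((u k).sub w).mass))) atTop (𝓝 0) := by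
      have := (Real.continuous_sqrt.tendsto _).comp ((hm.const_mul (2 * B + 2 * w.dirichlet)).const_mul 6)
      rw [mul_zero, mul_zero, Real.sqrt_zero] at this
      exact this
    refine squeeze_zero (fun k => norm_nonneg _) (fun k => ?_) h1
    refine Real.le_sqrt_of_sq_le ?_
    rw [norm_sq_densLp]
    refine (quartic_le _).trans ?_
    have h2 := (u k).sub_dirichlet_le w
    have h3 := hD k
    have h4 := mul_le_mul_of_nonneg_right (h2.trans (by linarith : _ ≤ 2 * B + 2 * w.dirichlet)) ((u k).sub w).mass_nonneg
    linarith
  have h1 := (σ.continuous_quad.tendsto 0).comp tdv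
  rw [σ.quad_zero] at h1
  have h2 := (h.tendsto_quad_sub hM hD σ).add h1
  simpa using h2

end H1

open H1 in
-- The direct method. Coercivity bounds the Dirichlet energy and the shifted potential energy;
-- confinement makes the weak limit a strong one in L², and the interaction is continuous along the
-- sequence.
theorem exists_ground_state {V : Plane → ℝ} (hV : IsTrap V) {κ β lam n : ℝ} (hκ : κ < 1)
    (hGN : IsGNConst (aParam β lam n) (bParam lam n) κ) :
    ⊥ < groundEnergy V β lam n ∧ ∃ u : H1, Admissible V u ∧ (energy V β lam n u : EReal) = groundEnergy V β lam n := by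
  obtain ⟨c, hc⟩ := hV.exists_min
  set W : Plane → ℝ := fun x => V x + c with hWdef
  have hWint : ∀ u : H1, Admissible V u → Integrable (fun x => W x * u.density x) ∧
      ∫ x, V x * ‖u.toFun x‖ ^ 2 = (∫ x, W x * u.density x) - c := by
    intro u hu
    have hi : Integrable (fun x => c * u.density x) := u.integrable_density.const_mul c
    have e : ∀ x, W x * u.density x = V x * ‖u.toFun x‖ ^ 2 + c * u.density x := fun x => by
      simp only [hWdef, density]; ring
    simp_rw [e]
    refine ⟨hu.1.add hi, ?_⟩
    rw [integral_add hu.1 hi, integral_const_mul]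
    have : ∫ x, u.density x = 1 := hu.2
    rw [this]; ring
  have hW0 : ∀ u : H1, 0 ≤ ∫ x, W x * u.density x := fun u =>
    integral_nonneg fun x => mul_nonneg (hc x) (u.density_nonneg x)
  obtain ⟨C, hC⟩ := exists_energy_ge hκ hGN V
  have hcoer : ∀ u : H1, Admissible V u → (1 - κ) / 4 * u.dirichlet + (∫ x, W x * u.density x) ≤ energy V β lam n u + (C + c) := by
    intro u hu
    have := hC u hu.2
    rw [(hWint u hu).2] at this; linarith
  set S : Set ℝ := energy V β lam n '' {u | Admissible V u} with hS
  have hne : S.Nonempty := by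
    obtain ⟨u, hu⟩ := exists_admissible hV.1.continuous
    exact ⟨_, u, hu, rfl⟩
  have hbdd : BddBelow S := by
    refine ⟨-(C + c), ?_⟩
    rintro _ ⟨u, hu, rfl⟩
    have h1 := hcoer u hu
    have h2 := hW0 u
    have h3 : 0 ≤ (1 - κ) / 4 * u.dirichlet := mul_nonneg (by linarith) u.dirichlet_nonneg
    linarith
  set m := sInf S with hm
  suffices hmin : ∃ w, Admissible V w ∧ energy V β lam n w ≤ m by
    obtain ⟨w, hw, hle⟩ := hmin
    have hge : (energy V β lam n w : EReal) = groundEnergy V β lam n := by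
      refine le_antisymm (le_iInf₂ fun u hu => ?_) (iInf₂_le w hw)
      exact EReal.coe_le_coe (hle.trans (csInf_le hbdd ⟨u, hu, rfl⟩))
    exact ⟨by rw [← hge]; exact EReal.bot_lt_coe _, w, hw, hge⟩
  obtain ⟨e, hanti, hlim, hmem⟩ := exists_seq_tendsto_sInf hne hbdd
  choose u hu hue using hmem
  set X := e 0 + (C + c) with hX
  have hEX : ∀ k, (1 - κ) / 4 * (u k).dirichlet + (∫ x, W x * (u k).density x) ≤ X := fun k => by
    have := hcoer (u k) (hu k)
    rw [hue] at this
    have := hanti (Nat.zero_le k)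
    linarith
  have hWX : ∀ k, ∫ x, W x * (u k).density x ≤ X := fun k => by
    have := hEX k
    have h3 : 0 ≤ (1 - κ) / 4 * (u k).dirichlet := mul_nonneg (by linarith) (u k).dirichlet_nonneg
    linarith
  have hX0 : 0 ≤ X := (hW0 _).trans (hWX 0)
  set B := 1 + X / ((1 - κ) / 4) with hB
  have hκ4 : 0 < (1 - κ) / 4 := by linarith
  have hMB : ∀ k, (u k).mass ≤ B := fun k => by
    rw [(hu k).2, hB]; have : 0 ≤ X / ((1 - κ) / 4) := by positivity
    linarith
  have hDB : ∀ k, (u k).dirichlet ≤ B := fun k => by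
    have h1 := hEX k
    have h2 := hW0 (u k)
    have h3 : (u k).dirichlet ≤ X / ((1 - κ) / 4) := by rw [le_div_iff₀ hκ4]; linarith
    linarith
  obtain ⟨w, φ, hφ, hw⟩ := exists_weakTo_subseq hMB hDB
  have tM : Tendsto (fun k => ((u (φ k)).sub w).mass) atTop (𝓝 (1 - w.mass)) := by
    have := hw.tendsto_mass_sub.const_sub 1
    refine this.congr fun k => ?_
    rw [(hu _).2]; ring
  have hm0 : 1 - w.mass ≤ 0 := by
    refine hw.mass_le_of_confined (fun k => hMB _) (fun k => hDB _) (W := W) hc (fun K => ?_)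
      (fun k => (hWint _ (hu _)).1) (fun k => hWX _) tM
    obtain ⟨r, hr⟩ := hV.exists_radius (K - c)
    exact ⟨r, fun x hx => by have := hr x hx; simp only [hWdef]; linarith⟩
  have hm1 : 1 - w.mass = 0 := le_antisymm hm0 (ge_of_tendsto' tM fun k => mass_nonneg _)
  rw [hm1] at tM
  have tlp : Tendsto (fun k => (u (φ k)).lp) atTop (𝓝 w.lp) := by
    rw [tendsto_iff_norm_sub_tendsto_zero]
    have h1 := (Real.continuous_sqrt.tendsto 0).comp tM
    rw [Real.sqrt_zero] at h1
    refine h1.congr fun k => ?_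
    simp only [Function.comp_apply]
    rw [mass_eq, sub_lp, Real.sqrt_sq (norm_nonneg _)]
  obtain ⟨ψ, hψ, hae⟩ := (tendstoInMeasure_of_tendsto_Lp tlp).exists_seq_tendsto_ae
  -- The potential energies lie in [0, X]; a further subsequence makes them converge, so that Fatou
  -- can be stated with a limit.
  obtain ⟨L, -, θ, hθ, hL⟩ := (isCompact_Icc (a := (0:ℝ)) (b := X)).tendsto_subseq
    (x := fun k => ∫ x, W x * (u (φ (ψ k))).density x) fun k => ⟨hW0 _, hWX _⟩
  let χ : ℕ → ℕ := fun k => φ (ψ (θ k))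
  have hχ : StrictMono χ := hφ.comp (hψ.comp hθ)
  have hχ' : StrictMono (fun k => ψ (θ k)) := hψ.comp hθ
  have hwχ : WeakTo (fun k => u (χ k)) w := ⟨hw.1.comp hχ', fun i => (hw.2 i).comp hχ'⟩
  have hdens : ∀ᵐ x, Tendsto (fun k => (u (χ k)).density x) atTop (𝓝 (w.density x)) := by
    filter_upwards [hae, ae_all_iff.2 fun k => (u k).lp_ae, w.lp_ae] with x h1 h2 h3
    have h4 := ((h1.comp hθ.tendsto_atTop).norm).pow 2
    rw [h3] at h4
    refine h4.congr fun k => ?_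
    simp only [Function.comp_apply, h2, density, χ]
  have hVc : Continuous V := hV.1.continuous
  have hWc : Continuous W := hVc.add continuous_const
  obtain ⟨hWi, hWL⟩ := integral_le_of_tendsto_ae (f := fun k x => W x * (u (χ k)).density x) (g := fun x => W x * w.density x)
    (L := L) (fun k => (hWint _ (hu _)).1) (fun k x => mul_nonneg (hc x) ((u (χ k)).density_nonneg x))
    (hWc.aestronglyMeasurable.mul w.integrable_density.1) (by filter_upwards [hdens] with x hx using hx.const_mul _) hL
  have hwadm : Admissible V w := by
    refine ⟨?_, by linarith⟩
    refine (hWi.sub (w.integrable_density.const_mul c)).congr (ae_of_all _ fun x => ?_)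
    simp only [Pi.sub_apply, hWdef, density]; ring
  have tMχ : Tendsto (fun k => ((u (χ k)).sub w).mass) atTop (𝓝 0) := tM.comp hχ'.tendsto_atTop
  set σ := energySymbol β lam n with hσ
  have tQ : Tendsto (fun k => σ.quad (u (χ k)).densLp) atTop (𝓝 (σ.quad w.densLp)) :=
    hwχ.tendsto_quad (fun k => hMB _) (fun k => hDB _) tMχ σ
  -- Total, potential and interaction energies converge, hence so does the Dirichlet energy; this
  -- limit bounds that of w from above.
  have tD : Tendsto (fun k => (u (χ k)).dirichlet) atTop (𝓝 (2 * (m - (L - c) + 1 / 2 * σ.quad w.densLp))) := by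
    have h1 := (((hlim.comp hχ.tendsto_atTop).sub (hL.sub_const c)).add (tQ.const_mul (1 / 2))).const_mul 2
    refine h1.congr fun k => ?_
    have h2 := energy_eq V β lam n (u (χ k))
    rw [(hWint _ (hu _)).2, hue] at h2
    simp only [Function.comp_apply, χ] at h2 ⊢
    rw [h2]; ring
  have hDle : w.dirichlet ≤ 2 * (m - (L - c) + 1 / 2 * σ.quad w.densLp) :=
    le_of_tendsto_of_tendsto' hwχ.tendsto_dirichlet_sub tD fun k => by
      have := ((u (χ k)).sub w).dirichlet_nonneg; linarith
  refine ⟨w, hwadm, ?_⟩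
  rw [energy_eq, (hWint w hwadm).2]
  linarith


/-! ### Collapse -/

namespace H1

/-- The truncation of `u` to a large ball. -/
def trunc (u : H1) (n : ℕ) : H1 := u.mulTest (cut (n + 1)) (isTest_cut n.cast_add_one_pos)

lemma trunc_eq_zero (u : H1) (n : ℕ) {x : Plane} (hx : 2 * (n + 1 : ℝ) ≤ ‖x‖) : (u.trunc n).toFun x = 0 := by
  simp [trunc, mulTest, cut_eq_zero n.cast_add_one_pos hx]

lemma eventually_cut_eq_one (x : Plane) : ∀ᶠ n : ℕ in atTop, cut (n + 1) x = 1 := by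
  obtain ⟨N, hN⟩ := exists_nat_ge ‖x‖
  filter_upwards [eventually_ge_atTop N] with n hn
  have : (N : ℝ) ≤ n := by exact_mod_cast hn
  exact cut_eq_one n.cast_add_one_pos (by linarith)

lemma norm_cut_smul_sub_le (R : ℝ) (x : Plane) (z : ℂ) : ‖cut R x • z - z‖ ≤ ‖z‖ := by
  have h1 := cut_nonneg R x
  have h2 := cut_le_one R x
  have e : cut R x • z - z = (cut R x - 1) • z := by rw [sub_smul, one_smul]
  rw [e, norm_smul]
  refine mul_le_of_le_one_left (norm_nonneg _) ?_
  rw [Real.norm_eq_abs, abs_le]; constructor <;> linarith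

lemma tendsto_trunc_lp (u : H1) : Tendsto (fun n => (u.trunc n).lp) atTop (𝓝 u.lp) := by
  refine (Lp.tendsto_Lp_iff_tendsto_eLpNorm'' _ (fun n => (u.trunc n).memLp) _ u.memLp).2 ?_
  refine tendsto_eLpNorm_two_of_dominated u.memLp.norm
    (Eventually.of_forall fun n => (u.trunc n).memLp.1.sub u.memLp.1)
    (Eventually.of_forall fun n => ae_of_all _ fun x => norm_cut_smul_sub_le _ x (u.toFun x)) (ae_of_all _ fun x => ?_)
  refine tendsto_const_nhds.congr' ?_
  filter_upwards [eventually_cut_eq_one x] with n hn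
  simp [trunc, mulTest, hn]

lemma tendsto_trunc_glp (u : H1) (i : Fin 2) : Tendsto (fun n => (u.trunc n).glp i) atTop (𝓝 (u.glp i)) := by
  obtain ⟨B, hB0, hB⟩ := exists_pderiv_cut_bound
  refine (Lp.tendsto_Lp_iff_tendsto_eLpNorm'' _ (fun n => (u.trunc n).memLp_grad i) _ (u.memLp_grad i)).2 ?_
  have e : ∀ n x, ((u.trunc n).grad i - u.grad i) x
      = (cut (n + 1) x • u.grad i x - u.grad i x) + pderiv i (cut (n + 1)) x • u.toFun x := by
    intro n x; simp only [trunc, mulTest, Pi.sub_apply]; ring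
  refine tendsto_eLpNorm_two_of_dominated ((u.memLp_grad i).norm.add (u.memLp.norm.const_mul B))
    (Eventually.of_forall fun n => ((u.trunc n).memLp_grad i).1.sub (u.memLp_grad i).1)
    (Eventually.of_forall fun n => ae_of_all _ fun x => ?_) (ae_of_all _ fun x => ?_)
  · rw [e]
    refine (norm_add_le _ _).trans (add_le_add (norm_cut_smul_sub_le _ x _) ?_)
    rw [norm_smul]
    refine mul_le_mul_of_nonneg_right ((hB _ n.cast_add_one_pos i x).trans ?_) (norm_nonneg _)
    exact div_le_self hB0.le (by have : (0:ℝ) ≤ n := n.cast_nonneg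
                                 linarith)
  · have h1 : Tendsto (fun n : ℕ => pderiv i (cut (n + 1)) x • u.toFun x) atTop (𝓝 0) := by
      have h2 : Tendsto (fun n : ℕ => pderiv i (cut (n + 1)) x) atTop (𝓝 0) :=
        squeeze_zero_norm (fun n => hB _ n.cast_add_one_pos i x)
          ((tendsto_atTop_add_const_right _ _ tendsto_natCast_atTop_atTop).const_div_atTop B)
      simpa using h2.smul_const (u.toFun x)
    refine h1.congr' ?_
    filter_upwards [eventually_cut_eq_one x] with n hn
    rw [e, hn, one_smul, sub_self, zero_add]

lemma tendsto_trunc_mass (u : H1) : Tendsto (fun n => (u.trunc n).mass) atTop (𝓝 u.mass) := by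
  simp only [mass_eq]; exact (u.tendsto_trunc_lp.norm).pow 2

lemma tendsto_trunc_dirichlet (u : H1) : Tendsto (fun n => (u.trunc n).dirichlet) atTop (𝓝 u.dirichlet) := by
  simp only [dirichlet_eq]
  exact tendsto_finsetSum _ fun i _ => ((u.tendsto_trunc_glp i).norm).pow 2

/-- Strong convergence in H¹ is weak convergence with remainders vanishing in L². -/
lemma tendsto_trunc_interaction (u : H1) (a b : ℝ) :
    Tendsto (fun n => interaction a b (u.trunc n)) atTop (𝓝 (interaction a b u)) := by
  simp only [interaction_eq_quad]
  obtain ⟨B1, hB1⟩ := u.tendsto_trunc_mass.bddAbove_range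
  obtain ⟨B2, hB2⟩ := u.tendsto_trunc_dirichlet.bddAbove_range
  have hw : WeakTo u.trunc u :=
    ⟨fun h => tendsto_const_nhds.inner u.tendsto_trunc_lp, fun i h => tendsto_const_nhds.inner (u.tendsto_trunc_glp i)⟩
  refine hw.tendsto_quad (B := max B1 B2) (fun n => (hB1 ⟨n, rfl⟩).trans (le_max_left _ _))
    (fun n => (hB2 ⟨n, rfl⟩).trans (le_max_right _ _)) ?_ _
  simp only [mass_eq, sub_lp]
  have := ((u.tendsto_trunc_lp.sub_const u.lp).norm).pow 2
  simpa using this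

end H1

open H1 in
-- Mass-preserving dilations multiply the Dirichlet energy and the interaction by the same s². A
-- function violating the inequality with constant 1 therefore has energy bounded above by a
-- constant minus a positive multiple of s².
theorem groundEnergy_eq_bot {V : Plane → ℝ} (hV : Continuous V) {β lam n : ℝ}
    (h : ¬ IsGNConst (aParam β lam n) (bParam lam n) 1) : groundEnergy V β lam n = ⊥ := by
  set a := aParam β lam n with ha
  set b := bParam lam n with hb
  simp only [IsGNConst, not_forall, not_le, one_mul] at h
  obtain ⟨u, hu⟩ := h
  -- The strict inequality survives truncation; compact support is needed since V may grow
  -- arbitrarily fast.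
  obtain ⟨N, hN⟩ := ((u.tendsto_trunc_dirichlet.mul u.tendsto_trunc_mass).eventually_lt (u.tendsto_trunc_interaction a b) hu).exists
  set v := u.trunc N with hv
  have hDM : 0 < v.dirichlet * v.mass :=
    dirichlet_mul_mass_pos_of_interaction_pos ((mul_nonneg v.dirichlet_nonneg v.mass_nonneg).trans_lt hN)
  have hM : 0 < v.mass := pos_of_mul_pos_right hDM v.dirichlet_nonneg
  set c := (√v.mass)⁻¹ with hc
  have hc0 : 0 < c := inv_pos.2 (Real.sqrt_pos.2 hM)
  have hc2 : c ^ 2 * v.mass = 1 := by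
    rw [hc, inv_pow, Real.sq_sqrt hM.le]; field_simp
  set F := c ^ 4 * interaction a b v with hF
  set D := c ^ 2 * v.dirichlet with hD
  set q := c ^ 4 * v.quartic with hq
  have hq0 : 0 ≤ q := mul_nonneg (by positivity) v.quartic_nonneg
  have hDF : D < F := by
    have h1 := mul_lt_mul_of_pos_left hN (by positivity : 0 < c ^ 4)
    have h2 : c ^ 4 * (v.dirichlet * v.mass) = D * (c ^ 2 * v.mass) := by rw [hD]; ring
    rwa [h2, hc2, mul_one] at h1
  -- This ε lets the error consume at most half of the gap F - D after scaling by s².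
  obtain ⟨C, -, hC⟩ := exists_abs_energySymbol_quad_sub_le β lam n (ε := (F - D) / (2 * (q + 1))) (div_pos (by linarith) (by linarith))
  obtain ⟨A, hA⟩ := exists_potential_bound hV (2 * (N + 1 : ℝ))
  have key : ∀ s : ℝ, 1 ≤ s → ∃ w, Admissible V w ∧ energy V β lam n w ≤ A + C / 2 - (F - D) / 4 * s ^ 2 := by
    intro s hs
    have hs0 : 0 < s := by linarith
    -- The factor c normalizes the mass and s concentrates. For s ≥ 1 the support stays in the
    -- original ball, where V is bounded.
    set w := v.rescale (c * s) (fun _ => s) (fun _ => hs0) 0 with hw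
    have wM : w.mass = 1 := by
      rw [hw, rescale_mass, ← hc2]; field_simp
    have wD : w.dirichlet = s ^ 2 * D := by
      rw [hw, rescale_dirichlet_iso _ _ _ _ hs0]; ring
    have wF : interaction a b w = s ^ 2 * F := by
      rw [hw, interaction_rescale_iso _ _ _ _ hs0, hF]; field_simp
    have wq : w.quartic = s ^ 2 * q := by
      rw [hw, quartic_rescale_iso _ _ hs0, hq]; field_simp
    have hsupp : ∀ x, 2 * (N + 1 : ℝ) ≤ ‖x‖ → w.toFun x = 0 := by
      intro x hx
      have e : diagAffine (fun _ => s) (fun _ => hs0) 0 x = s • x := by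
        rw [diagAffine_apply, add_zero]; ext i; simp [diagEquiv_apply]
      have : v.toFun (s • x) = 0 := by
        apply u.trunc_eq_zero N
        rw [norm_smul, Real.norm_of_nonneg hs0.le]
        have := norm_nonneg x
        nlinarith
      simp [hw, rescale, e, this]
    obtain ⟨hVi, hVA⟩ := hA w hsupp
    refine ⟨w, ⟨hVi, wM⟩, ?_⟩
    rw [wM, mul_one] at hVA
    have h1 := (abs_le.1 (hC w)).1
    rw [← ha, ← hb, wF, wq, wM] at h1
    have h2 : (F - D) / (2 * (q + 1)) * (s ^ 2 * q) ≤ (F - D) / 2 * s ^ 2 := by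
      have h3 : (F - D) / (2 * (q + 1)) * q ≤ (F - D) / 2 := by
        rw [div_mul_eq_mul_div, div_le_div_iff₀ (by linarith) (by norm_num)]
        nlinarith
      calc _ = (F - D) / (2 * (q + 1)) * q * s ^ 2 := by ring
        _ ≤ _ := by gcongr
    rw [energy_eq, wD]
    linarith
  rw [EReal.eq_bot_iff_forall_lt]
  intro y
  have hd : 0 < (F - D) / 4 := by linarith
  -- Chosen so that the linear quantity (F - D)/4 · s already exceeds A + C/2 - y; then s² ≥ s.
  set s := 1 + |A + C / 2 - y| / ((F - D) / 4) with hs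
  have hs1 : 1 ≤ s := by
    have : 0 ≤ |A + C / 2 - y| / ((F - D) / 4) := by positivity
    linarith
  obtain ⟨w, hw, hE⟩ := key s hs1
  refine (iInf₂_le w hw).trans_lt (EReal.coe_lt_coe ?_)
  have h1 : (F - D) / 4 * s = (F - D) / 4 + |A + C / 2 - y| := by
    rw [hs, mul_add, mul_one, mul_div_cancel₀ _ hd.ne']
  have h2 : (F - D) / 4 * s ≤ (F - D) / 4 * s ^ 2 := by
    refine mul_le_mul_of_nonneg_left ?_ hd.le
    nlinarith
  have := le_abs_self (A + C / 2 - y)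
  linarith

end Dipolar
end

/-! ### The main theorem -/

open Dipolar in
/-- Stability and instability of the two-dimensional dipolar gas. The first conjunct says that
all the terms in the inequality and in the energy are well defined on `H¹`. -/
theorem theorem1 :
    (∀ u : H1, MemLp u.density 2 volume ∧ (∃ w, IsPVConv u.density w) ∧
      ∀ n₃ ∈ Set.Icc (-1 : ℝ) 1, ∃ Φ, IsDipolarPotential n₃ u.density Φ) ∧
    (∀ a b : ℝ, (0 < a + b / 2 ∨ 0 < a - b / 2) →
      0 < gnConst a b ∧ IsLeast {C : ℝ | IsGNConst a b C} (gnConst a b) ∧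
        ∃ u : H1, 0 < u.mass ∧ interaction a b u = gnConst a b * (u.dirichlet * u.mass)) ∧
    (∀ (V : Plane → ℝ) (β lam n₃ a b : ℝ), IsTrap V → n₃ ∈ Set.Icc (-1 : ℝ) 1 →
      a = aParam β lam n₃ → b = bParam lam n₃ →
      (((a + b / 2 ≤ 0 ∧ a - b / 2 ≤ 0) ∨
          ((0 < a + b / 2 ∨ 0 < a - b / 2) ∧ gnConst a b < 1)) →
        ⊥ < groundEnergy V β lam n₃ ∧
          ∃ u : H1, Admissible V u ∧ (energy V β lam n₃ u : EReal) = groundEnergy V β lam n₃) ∧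
      (((0 < a + b / 2 ∨ 0 < a - b / 2) ∧ 1 < gnConst a b) →
        groundEnergy V β lam n₃ = ⊥)) := by
  refine ⟨fun u => ⟨u.memLp_density, ⟨_, isPVConv_pvLimit u.integrable_density u.memLp_density⟩,
    fun n₃ _ => ⟨_, isDipolarPotential_potLimit n₃ u.integrable_density u.memLp_density⟩⟩, fun a b h => ?_, ?_⟩
  · exact ⟨(isLeast_gnConst h).1, (isLeast_gnConst h).2, exists_optimizer h⟩
  rintro V β lam n₃ a b hV - rfl rfl
  refine ⟨?_, ?_⟩
  -- Both stable cases supply an admissible constant below one: 0 in the first, the optimal constant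
  -- in the second.
  · rintro (⟨h1, h2⟩ | ⟨h, hlt⟩)
    · exact exists_ground_state hV zero_lt_one (isGNConst_zero h1 h2)
    · exact exists_ground_state hV hlt (isLeast_gnConst h).2.1
  · rintro ⟨h, hlt⟩
    exact groundEnergy_eq_bot hV.1.continuous fun h1 => absurd ((isLeast_gnConst h).2.2 h1) (not_le.2 hlt)
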